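/- Let $L=p(t)\partial_t+q(t)\partial_x$ on $\mathbb R^2$, where $p,q$ are real polynomials without common real zeros, the real zeros of $p$ are $t_1<\dots<t_N$ ($N\ge 2$) with $p'(t_j)\ne0$, and $q$ has at most one zero in each $]t_j,t_{j+1}[$, $1\le j\le N-1$. Put $c_j=q(t_j)/p'(t_j)$ (the coefficient of $\ln|t-t_j|$ in a primitive of $q/p$). Fix $j\in\{1,\dots,N-1\}$, put $I_j=\,]t_j,t_{j+1}[$, and suppose that the strip $S_j=I_j\times\mathbb R$ is a separatrix: each characteristic curve $\dot x=q(t)/p(t)$, $t\in I_j$, either tends to $+\infty$ at both ends of $I_j$ or tends to $-\infty$ at both ends. Let $\theta_j\in I_j$ be the zero of $q$, let $\rho$ be a primitive of $q/p$ on $I_j$, and put $$L_j^{-1}f(t,x)=\int_{\theta_j}^t\frac{f(\tau,x+\rho(\tau)-\rho(t))}{p(\tau)}\,d\tau ,\qquad t\in I_j$$ (for $f$ with values in $\mathcal S'(\mathbb R)$ the translations and the integral are taken in $\mathcal S'(\mathbb R)$). i) For $r\in\mathbb R$ let $C^\infty(\overline I_j:E^r)$ be the space of all $f\in C^\infty(S_j)$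 such that for every $\alpha\in\mathbb Z_+^2$ there is $C$ with $|\partial^\alpha_{t,x}f(t,x)|\le Ce^{r|x|}$ for $t\in I_j$, $x\in\mathbb R$; let $C^\infty(I_j:E^r)$ be defined by the same bounds, with $C$ depending also on $K$, for $t$ in any compact set $K\subset I_j$; and let $u\in L^1(I_j:E^r)$ mean that $\int_{I_j}\sup_x e^{-r|x|}|\partial_x^ku(t,x)|\,dt<\infty$ for all $k\in\mathbb Z_+$. If $0<\varepsilon<\min\{|c_j|^{-1},|c_{j+1}|^{-1}\}$ and $r=\varepsilon$ (growth) or $r=-\varepsilon$ (decay), then $$L_j^{-1}:C^\infty(\overline I_j:E^{r})\to L^1(I_j:E^{r})\cap C^\infty(I_j:E^{r}),\qquad LL_j^{-1}f=f \text{ in } S_j .$$ ii) Let $H^{s_1,s_2}$ be the space of all $u\in\mathcal S'(\mathbb R)$ with $\|u\|_{s_1,s_2}=\|\langle x\rangle^{s_2}\langle D\rangle^{s_1}u\|_{L^2}<\infty$, where $\langle x\rangle=\sqrt{1+x^2}$, $D=-i\partial_x$. For all $s_1,s_2\in\mathbb R$, $$L_j^{-1}:C(\overline I_j:H^{s_1,s_2})\to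 L^1(I_j:H^{s_1,s_2})\cap C(I_j:H^{s_1,s_2}),\qquad LL_j^{-1}f=f \text{ in } S_j,$$ and for every $\varepsilon>0$ there is a constant $C=C_{\varepsilon,s_1,s_2}$ such that for all $f\in C(\overline I_j:H^{s_1,s_2})$ $$\sup_{t\in I_j}|t-t_j|^\varepsilon|t-t_{j+1}|^\varepsilon\,\|L_j^{-1}f(t,\cdot)\|_{s_1,s_2}\le C\sup_{t\in\overline I_j}\|f(t,\cdot)\|_{s_1,s_2}.$$ iii) For each $k\in\mathbb Z_+$ there are nonzero real numbers $\gamma_{\mu,\ell}$ ($\mu=j,j+1$, $0\le\ell\le k$) such that, for all $f(t,x)=\sum_{\ell=0}^kf_\ell(t)x^\ell$ with $f_\ell\in C(\overline I_j)$, one has $L_j^{-1}f(t,x)=\sum_{\ell=0}^kg_\ell(t)x^\ell$ on $S_j$ with $$g_\ell(t)=\big(f_k(t_\mu)\gamma_{\mu,\ell}+o(1)\big)\ln^{k+1-\ell}\frac1{|t-t_\mu|},\qquad t\to t_\mu,\ t\in I_j,\ \ \mu=j,j+1,\ 0\le\ell\le k .$$ In particular the coefficient $g_0$ of $x^0$ has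 the exact order $\ln^{k+1}\frac1{|t-t_\mu|}$ if $f_k(t_\mu)\neq0$, and the other coefficients are $o(\ln^{k+1}\frac1{|t-t_\mu|})$. iv) For all $s_1,s_2\in\mathbb R$ there is $\varepsilon_0>0$, depending only on $L$, $j$, $s_1$, $s_2$, with the following property. Let $b\in C^\infty(\mathbb R^3)$ be a symbol of order zero depending smoothly on $t$, i.e. $\sup_{t\in\overline I_j,\,x,\xi}\langle x\rangle^{\alpha}\langle\xi\rangle^{\beta}|\partial_t^m\partial_x^\alpha\partial_\xi^\beta b(t,x,\xi)|<\infty$ for all $m,\alpha,\beta\in\mathbb Z_+$, and let $$\max_{\alpha\le[|s_1|]+2,\ \beta\le[|s_2|]+2}\ \sup_{t\in\overline I_j,\ (x,\xi)\in\mathbb R^2}\langle x\rangle^{\alpha}\langle\xi\rangle^{\beta}|\partial_x^\alpha\partial_\xi^\beta b(t,x,\xi)|<\varepsilon_0 .$$ Then $L+b(t,x,D)$ has on $S_j$ a linear right inverse that maps $C(\overline I_j:H^{s_1,s_2})$ continuously into $L^1(I_j:H^{s_1,s_2})\cap C(I_j:H^{s_1,s_2})$. -/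

import Mathlib

open Set Filter Topology MeasureTheory Asymptotics
open scoped ENNReal NNReal ContDiff SchwartzMap FourierTransform

noncomputable section

namespace Strip

/-! ### The vector field `L = p(t) ∂_t + q(t) ∂_x` and its strips -/

/-- Standing assumptions on `L = p(t) ∂_t + q(t) ∂_x`: `p` and `q` are real polynomials without
common real zeros, the real zeros of `p` are exactly `t_1 < ... < t_N` (indexed by `Fin N`),
`N ≥ 2`, they are simple, and `q` has at most one zero between consecutive zeros of `p`. -/
structure IsAdmissible (p q : Polynomial ℝ) (N : ℕ) (t : Fin N → ℝ) : Prop where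
  two_le : 2 ≤ N
  strictMono : StrictMono t
  nonsingular : ∀ s : ℝ, ¬ (p.eval s = 0 ∧ q.eval s = 0)
  zero_iff : ∀ s : ℝ, p.eval s = 0 ↔ ∃ j, t j = s
  simple : ∀ j, p.derivative.eval (t j) ≠ 0
  atMostOne : ∀ (j : ℕ) (hj : j + 1 < N),
    ∀ x ∈ Ioo (t ⟨j, Nat.lt_of_succ_lt hj⟩) (t ⟨j + 1, hj⟩),
    ∀ y ∈ Ioo (t ⟨j, Nat.lt_of_succ_lt hj⟩) (t ⟨j + 1, hj⟩),
      q.eval x = 0 → q.eval y = 0 → x = y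

/-- The strip `]a, b[ × ℝ` is a separatrix: every characteristic curve `x' = q / p` over `]a, b[`
tends to `+∞` at both ends, or to `-∞` at both ends. -/
def IsSeparatrix (p q : Polynomial ℝ) (a b : ℝ) : Prop :=
  ∀ x : ℝ → ℝ, (∀ t ∈ Ioo a b, HasDerivAt x (q.eval t / p.eval t) t) →
    (Tendsto x (𝓝[>] a) atTop ∧ Tendsto x (𝓝[<] b) atTop) ∨
    (Tendsto x (𝓝[>] a) atBot ∧ Tendsto x (𝓝[<] b) atBot)

/-- The residue at a simple zero `τ` of `p` of the rational function `q / p`, that is, the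
coefficient `c` of `log |t - τ|` in a primitive of `q / p`. -/
def logCoeff (p q : Polynomial ℝ) (τ : ℝ) : ℝ := q.eval τ / p.derivative.eval τ

/-- `ρ(τ) - ρ(t)` for a primitive `ρ` of `q / p` on the strip that contains `t` and `τ`. -/
def rhoDiff (p q : Polynomial ℝ) (t τ : ℝ) : ℝ := ∫ s in t..τ, q.eval s / p.eval s

/-- The characteristic integral
`(L⁻¹ f)(t, x) = ∫_θ^t f(τ, x + ρ(τ) - ρ(t)) / p(τ) dτ` on functions. -/
def stripInv (p q : Polynomial ℝ) (θ : ℝ) (f : ℝ → ℝ → ℂ) (t x : ℝ) : ℂ :=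
  ∫ τ in θ..t, f τ (x + rhoDiff p q t τ) / ((p.eval τ : ℝ) : ℂ)

/-! ### Exponential growth and decay -/

/-- `∂_t^m ∂_x^k f (t, x)`. -/
def pderiv (m k : ℕ) (f : ℝ → ℝ → ℂ) (t x : ℝ) : ℂ :=
  iteratedDeriv m (fun t' => iteratedDeriv k (f t') x) t

/-- Smooth functions on `]a, b[ × ℝ`. -/
def SmoothOnStrip (a b : ℝ) (f : ℝ → ℝ → ℂ) : Prop :=
  ContDiffOn ℝ ∞ (fun z : ℝ × ℝ => f z.1 z.2) (Ioo a b ×ˢ univ)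

/-- `C^∞([a, b] : E)`, `E` being given by the bounds `O(e^{r |x|})` on all derivatives:
the bounds are uniform up to the ends of the interval. Growth is `r = ε`, decay is `r = -ε`. -/
def SmoothExpClosed (a b r : ℝ) (f : ℝ → ℝ → ℂ) : Prop :=
  SmoothOnStrip a b f ∧
  ∀ m k : ℕ, ∃ C : ℝ, ∀ t ∈ Ioo a b, ∀ x : ℝ, ‖pderiv m k f t x‖ ≤ C * Real.exp (r * |x|)

/-- `C^∞(]a, b[ : E)`: the bounds are uniform on the compact subsets of the open interval. -/
def SmoothExpOpen (a b r : ℝ) (f : ℝ → ℝ → ℂ) : Prop :=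
  SmoothOnStrip a b f ∧
  ∀ K : Set ℝ, IsCompact K → K ⊆ Ioo a b → ∀ m k : ℕ, ∃ C : ℝ,
    ∀ t ∈ K, ∀ x : ℝ, ‖pderiv m k f t x‖ ≤ C * Real.exp (r * |x|)

/-- `L^1(]a, b[ : E)`: each seminorm `sup_x e^{-r |x|} |∂_x^k f(t, x)|` of `E` is integrable
in `t`. -/
def IntegrableExp (a b r : ℝ) (f : ℝ → ℝ → ℂ) : Prop :=
  ∀ k : ℕ, ∫⁻ t in Ioo a b,
    ⨆ x : ℝ, ENNReal.ofReal (Real.exp (-(r * |x|)) * ‖pderiv 0 k f t x‖) < ⊤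

/-! ### Weighted Sobolev spaces -/

/-- `⟨x⟩ = √(1 + x²)`. -/
def japanese (x : ℝ) : ℝ := √(1 + x ^ 2)

/-- `⟨x⟩^{s₂} ⟨D⟩^{s₁} u`, with `D = -i ∂_x`. In the normalization `e^{-2πi x ξ}` of the Fourier
transform the symbol of `D` is `2π ξ`. -/
def weightOp (s₁ s₂ : ℝ) (u : 𝓢'(ℝ, ℂ)) : 𝓢'(ℝ, ℂ) :=
  TemperedDistribution.smulLeftCLM ℂ (fun x : ℝ => (((1 + x ^ 2) ^ (s₂ / 2) : ℝ) : ℂ))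
    (TemperedDistribution.fourierMultiplierCLM ℂ
      (fun ξ : ℝ => (((1 + (2 * Real.pi * ξ) ^ 2) ^ (s₁ / 2) : ℝ) : ℂ)) u)

/-- The norm `‖⟨x⟩^{s₂} ⟨D⟩^{s₁} u‖_{L²}` of `H^{s₁,s₂}(ℝ)`, equal to `∞` when
`⟨x⟩^{s₂} ⟨D⟩^{s₁} u` is not an `L²` function; so `u ∈ H^{s₁,s₂}` iff the norm is finite. -/
def sobNorm (s₁ s₂ : ℝ) (u : 𝓢'(ℝ, ℂ)) : ℝ≥0∞ :=
  ⨅ (g : Lp ℂ 2 (volume : Measure ℝ))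
    (_ : weightOp s₁ s₂ u = Lp.toTemperedDistribution g), ‖g‖ₑ

/-- `u ∈ C(S : H^{s₁,s₂})`. -/
def ContinuousIntoSob (s₁ s₂ : ℝ) (S : Set ℝ) (u : ℝ → 𝓢'(ℝ, ℂ)) : Prop :=
  ∀ t ∈ S, sobNorm s₁ s₂ (u t) < ⊤ ∧
    Tendsto (fun τ => sobNorm s₁ s₂ (u τ - u t)) (𝓝[S] t) (𝓝 0)

/-- The norm of `L^1(]a, b[ : H^{s₁,s₂})`. -/
def sobL1Norm (s₁ s₂ a b : ℝ) (u : ℝ → 𝓢'(ℝ, ℂ)) : ℝ≥0∞ :=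
  ∫⁻ t in Ioo a b, sobNorm s₁ s₂ (u t)

/-- The norm of `C([a, b] : H^{s₁,s₂})`. -/
def sobSupNorm (s₁ s₂ a b : ℝ) (u : ℝ → 𝓢'(ℝ, ℂ)) : ℝ≥0∞ :=
  ⨆ t ∈ Icc a b, sobNorm s₁ s₂ (u t)

/-- `u = L⁻¹ f` on `]a, b[`, for functions of `t` with values in `𝓢'(ℝ)`. The characteristic
integral is the same as in `stripInv`, the translate `f(τ, · + h)` of a distribution being
tested by `⟨f(τ, · + h), φ⟩ = ⟨f(τ, ·), φ(· - h)⟩`. -/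
def IsStripInv (p q : Polynomial ℝ) (a b θ : ℝ) (f u : ℝ → 𝓢'(ℝ, ℂ)) : Prop :=
  ∀ t ∈ Ioo a b, ∀ φ : 𝓢(ℝ, ℂ),
    u t φ = ∫ τ in θ..t,
      f τ (SchwartzMap.compSubConstCLM ℂ (rhoDiff p q t τ) φ) / ((p.eval τ : ℝ) : ℂ)

/-- `p ∂_t u + q ∂_x u = g` on `]a, b[ × ℝ`, as an identity in `𝓢'(ℝ)` at each time. -/
def SolvesField (p q : Polynomial ℝ) (a b : ℝ) (u g : ℝ → 𝓢'(ℝ, ℂ)) : Prop :=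
  ∀ t ∈ Ioo a b, ∀ φ : 𝓢(ℝ, ℂ), ∃ d : ℂ, HasDerivAt (fun s => u s φ) d t ∧
    ((p.eval t : ℝ) : ℂ) * d + ((q.eval t : ℝ) : ℂ) * TemperedDistribution.derivCLM ℂ (u t) φ = g t φ

/-! ### Pseudodifferential operators of order zero -/

/-- `∂_t^m ∂_x^α ∂_ξ^β b (t, x, ξ)`. -/
def symbolDeriv (m α β : ℕ) (b : ℝ → ℝ → ℝ → ℂ) (t x ξ : ℝ) : ℂ :=
  iteratedDeriv m (fun t' => iteratedDeriv α (fun x' => iteratedDeriv β (b t' x') ξ) x) t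

/-- `sup ⟨x⟩^α ⟨ξ⟩^β |∂_t^m ∂_x^α ∂_ξ^β b|` over `t ∈ [t₀, t₁]`, `(x, ξ) ∈ ℝ²`. -/
def symbolSeminorm (t₀ t₁ : ℝ) (m α β : ℕ) (b : ℝ → ℝ → ℝ → ℂ) : ℝ≥0∞ :=
  ⨆ t ∈ Icc t₀ t₁, ⨆ x : ℝ, ⨆ ξ : ℝ,
    ENNReal.ofReal (japanese x ^ α * japanese ξ ^ β * ‖symbolDeriv m α β b t x ξ‖)

/-- `b(t, x, ξ)` is a symbol of order zero (in `x` and in `ξ`) that depends smoothly on `t`: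
`|∂_t^m ∂_x^α ∂_ξ^β b| ≤ C ⟨x⟩^{-α} ⟨ξ⟩^{-β}` for `t ∈ [t₀, t₁]`. -/
def IsZeroOrderSymbol (t₀ t₁ : ℝ) (b : ℝ → ℝ → ℝ → ℂ) : Prop :=
  ContDiff ℝ ∞ (fun z : ℝ × ℝ × ℝ => b z.1 z.2.1 z.2.2) ∧
  ∀ m α β : ℕ, symbolSeminorm t₀ t₁ m α β b < ⊤

/-- `v = σ(x, D) u` for `u ∈ 𝓢'(ℝ)`, where
`σ(x, D) u (x) = (2π)⁻¹ ∫ e^{i x η} σ(x, η) û(η) dη = ∫ e^{2πi x ξ} σ(x, 2πξ) (𝓕 u)(ξ) dξ`.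
Tested against `φ` and with the order of integration exchanged this is `⟨𝓕 u, G⟩` with
`G(ξ) = ∫ e^{2πi x ξ} σ(x, 2πξ) φ(x) dx`, a Schwartz function. -/
def IsPseudoDiff (σ : ℝ → ℝ → ℂ) (u v : 𝓢'(ℝ, ℂ)) : Prop :=
  ∀ φ : 𝓢(ℝ, ℂ), ∃ G : 𝓢(ℝ, ℂ),
    (∀ ξ : ℝ, G ξ = ∫ x : ℝ,
      Complex.exp (2 * Real.pi * Complex.I * x * ξ) * σ x (2 * Real.pi * ξ) * φ x) ∧
    v φ = (𝓕 u) G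

/-- `R` is a right inverse of `L + b(t, x, D)` on `]t₀, t₁[ × ℝ` that maps
`C([t₀, t₁] : H^{s₁,s₂})` linearly and continuously into
`L^1(]t₀, t₁[ : H^{s₁,s₂}) ∩ C(]t₀, t₁[ : H^{s₁,s₂})`. -/
structure IsPerturbedRightInverse (p q : Polynomial ℝ) (t₀ t₁ : ℝ) (b : ℝ → ℝ → ℝ → ℂ)
    (s₁ s₂ : ℝ) (R : (ℝ → 𝓢'(ℝ, ℂ)) → (ℝ → 𝓢'(ℝ, ℂ))) : Prop where
  linear : ∀ f g, ContinuousIntoSob s₁ s₂ (Icc t₀ t₁) f →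
    ContinuousIntoSob s₁ s₂ (Icc t₀ t₁) g → ∀ (c : ℂ), ∀ t ∈ Ioo t₀ t₁,
      R (c • f + g) t = c • R f t + R g t
  rightInverse : ∀ f, ContinuousIntoSob s₁ s₂ (Icc t₀ t₁) f →
    ∃ v : ℝ → 𝓢'(ℝ, ℂ), (∀ t ∈ Ioo t₀ t₁, IsPseudoDiff (b t) (R f t) (v t)) ∧
      SolvesField p q t₀ t₁ (R f) (f - v)
  continuous : ∀ f, ContinuousIntoSob s₁ s₂ (Icc t₀ t₁) f →
    ContinuousIntoSob s₁ s₂ (Ioo t₀ t₁) (R f)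
  integrable : ∀ f, ContinuousIntoSob s₁ s₂ (Icc t₀ t₁) f →
    sobL1Norm s₁ s₂ t₀ t₁ (R f) < ⊤
  bound_L1 : ∃ C : ℝ≥0, ∀ f, ContinuousIntoSob s₁ s₂ (Icc t₀ t₁) f →
    sobL1Norm s₁ s₂ t₀ t₁ (R f) ≤ C * sobSupNorm s₁ s₂ t₀ t₁ f
  bound_compact : ∀ K : Set ℝ, IsCompact K → K ⊆ Ioo t₀ t₁ → ∃ C : ℝ≥0,
    ∀ f, ContinuousIntoSob s₁ s₂ (Icc t₀ t₁) f → ∀ t ∈ K,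
      sobNorm s₁ s₂ (R f t) ≤ C * sobSupNorm s₁ s₂ t₀ t₁ f

/-- The coefficient `g` has the asymptotics
`g(t) = κ log^n (1 / |t - τ|) + o(log^n (1 / |t - τ|))` along the filter `F`. For `κ ≠ 0` this is
`κ log^n (1 / |t - τ|) (1 + o(1))`. -/
def HasLogAsymptotics (F : Filter ℝ) (τ : ℝ) (n : ℕ) (κ : ℂ) (g : ℝ → ℂ) : Prop :=
  (fun t => g t - κ * ((Real.log (1 / |t - τ|) ^ n : ℝ) : ℂ)) =o[F]
    (fun t => Real.log (1 / |t - τ|) ^ n)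

end Strip

end

open Strip

/-! ### Kernel estimates at one simple zero of `p` -/

namespace Strip

/-! The characteristic integral is an integral operator in time whose kernel is `1/p(τ)` times the
translation in `x` by `ρ(τ) - ρ(t)`, so everything depends on this kernel at the two ends of the
strip. At a simple zero `a` of `p` one has `1/p = O(1/(τ - a))` and `ρ(τ) - ρ(t) = c (log (τ - a) -
log (t - a)) + O(1)`. If a translation by `h` costs at most `e^{δ|h|}`, the kernel for `t ≤ τ ≤ θ`
is therefore at most a constant times `(τ - a)^(κ-1) (t - a)^(-κ)` with `κ = δ|c|`, and integration
against it preserves the size `(t - a)^(-ν)` for every `ν > κ`. The other end follows by reflection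
in time. With the weight `w = |t - a|^ν |t - b|^ν` this is `IsStrip.exists_abs_integral_exp_le`: the
size `1/w` is preserved up to a constant.

Part i): on functions of size `e^{±ε|x|}` a translation costs `e^{ε|h|}`, and the restriction on `ε`
says that `ν` can be taken below `1`, so that `1/w` is integrable. Time derivatives are traded for
`x`-derivatives by means of the equation.

Part ii): `sobEmb` identifies `H^{s₁,s₂}` isometrically with `L²`. Since `⟨D⟩^{s₁}` commutes with
translations, a translation costs only a constant times `(1 + |h|)^{|s₂|}`, hence at most a constant
times `e^{δ|h|}` for any `δ > 0`, and every `ν > 0` is allowed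
(`IsStrip.exists_norm_sobStripInv_le`).

Part iii): the binomial theorem reduces the claim to the moments `∫ F (ρ(τ) - ρ(t))^n / p`. If `F`
is replaced by `F(a) q/q(a)`, the integrand becomes an exact derivative because `ρ' = q/p`, and the
result is a multiple of `(ρ(θ) - ρ(t))^(n+1)`, of exact order `log^(n+1)`. The remainder of `F`
vanishes at `a` and is negligible (`IsStrip.tendsto_charMoment_left`).

Part iv): `u = L⁻¹H` solves `(L + b)u = f` when `H = f - b L⁻¹H`. In the weighted sup norm this is a
contraction as soon as the operators `b(t,x,D)` are small on `H^{s₁,s₂}`; uniqueness makes the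
solution linear in `f`. Smallness comes from a Calderón–Vaillancourt type estimate
(`exists_norm_integral_op_le`). The windows `(1 - 2πi(x - y))^{-N}` are produced by integrating by
parts, each derivative of the symbol paying for one power of decay. Plancherel's theorem, Peetre's
inequality and Young's inequality then require `N > |s₁| + 1` derivatives in `x` and `M ≥ |s₂| + 1`
in `ξ`. -/

/-- `a` is a simple zero of `p`, and `p` has no other zero in `[a, θ]`. -/
structure IsLeftEnd (p : Polynomial ℝ) (a θ : ℝ) : Prop where
  lt : a < θ
  zero : p.eval a = 0
  simple : p.derivative.eval a ≠ 0
  ne_zero : ∀ s ∈ Ioc a θ, p.eval s ≠ 0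

namespace IsLeftEnd

variable {p q : Polynomial ℝ} {a θ : ℝ}

theorem exists_factor (h : IsLeftEnd p a θ) : ∃ p₁ : Polynomial ℝ,
    (∀ s, p.eval s = (s - a) * p₁.eval s) ∧ p₁.eval a = p.derivative.eval a ∧
    ∀ s ∈ Icc a θ, p₁.eval s ≠ 0 := by
  obtain ⟨p₁, hp₁⟩ := Polynomial.dvd_iff_isRoot.2 h.zero
  have h1 : p₁.eval a = p.derivative.eval a := by
    rw [hp₁]; simp
  refine ⟨p₁, fun s => by rw [hp₁]; simp, h1, fun s hs => ?_⟩
  rcases eq_or_lt_of_le hs.1 with rfl | hlt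
  · rw [h1]; exact h.simple
  · intro h0
    apply h.ne_zero s ⟨hlt, hs.2⟩
    rw [hp₁]; simp [h0]

theorem exists_inv_le (h : IsLeftEnd p a θ) : ∃ C : ℝ, 0 < C ∧
    ∀ s ∈ Ioc a θ, |p.eval s|⁻¹ ≤ C * (s - a)⁻¹ := by
  obtain ⟨p₁, hp, -, hne⟩ := h.exists_factor
  have hc : ContinuousOn (fun s => |p₁.eval s|⁻¹) (Icc a θ) :=
    (p₁.continuous.abs.continuousOn).inv₀ fun s hs => abs_ne_zero.2 (hne s hs)
  obtain ⟨C, hC⟩ := isCompact_Icc.exists_bound_of_continuousOn hc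
  refine ⟨max C 1, by positivity, fun s hs => ?_⟩
  have h0 : 0 < s - a := sub_pos.2 hs.1
  have := hC s ⟨hs.1.le, hs.2⟩
  rw [Real.norm_eq_abs, abs_of_nonneg (by positivity)] at this
  rw [hp, abs_mul, mul_inv, abs_of_pos h0, mul_comm]
  gcongr
  exact this.trans (le_max_left _ _)

/-- With `p = (s - a) p₁`, the number `c` is exactly the value for which `q - c p₁` vanishes at `a`.
Hence `q/p = c/(s - a) + q₁/p₁` with `q₁/p₁` continuous on `[a, θ]`: the first summand integrates to
the logarithms and the second contributes a bounded term. -/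
theorem exists_abs_rhoDiff_sub_le (h : IsLeftEnd p a θ) (q : Polynomial ℝ) : ∃ C : ℝ, 0 < C ∧
    ∀ t ∈ Ioc a θ, ∀ τ ∈ Ioc a θ,
      |rhoDiff p q t τ - logCoeff p q a * (Real.log (τ - a) - Real.log (t - a))| ≤ C := by
  obtain ⟨p₁, hp, hpa, hne⟩ := h.exists_factor
  set c := logCoeff p q a with hc
  have hroot : (q - Polynomial.C c * p₁).IsRoot a := by
    have := h.simple
    simp only [Polynomial.IsRoot, Polynomial.eval_sub, Polynomial.eval_mul, Polynomial.eval_C, hpa,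
      hc, logCoeff]
    field_simp
    simp
  obtain ⟨q₁, hq₁⟩ := Polynomial.dvd_iff_isRoot.2 hroot
  have hq : ∀ s, q.eval s = c * p₁.eval s + (s - a) * q₁.eval s := fun s => by
    have := congrArg (Polynomial.eval s) hq₁
    simp at this
    linarith
  have hcont : ContinuousOn (fun s => q₁.eval s / p₁.eval s) (Icc a θ) :=
    q₁.continuous.continuousOn.div p₁.continuous.continuousOn hne
  obtain ⟨C, hC⟩ := isCompact_Icc.exists_bound_of_continuousOn hcont
  refine ⟨max C 1 * (θ - a), mul_pos (by positivity) (sub_pos.2 h.lt), fun t ht τ hτ => ?_⟩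
  have hsub : uIcc t τ ⊆ Ioc a θ := (convex_Ioc a θ).ordConnected.uIcc_subset ht hτ
  have hsub' : uIcc t τ ⊆ Icc a θ := hsub.trans Ioc_subset_Icc_self
  have hpos : ∀ s ∈ uIcc t τ, s - a ≠ 0 := fun s hs => (sub_pos.2 (hsub hs).1).ne'
  have hint1 : IntervalIntegrable (fun s => c * (s - a)⁻¹) volume t τ := by
    apply ContinuousOn.intervalIntegrable
    exact continuousOn_const.mul ((continuousOn_id.sub continuousOn_const).inv₀ hpos)
  have hint2 : IntervalIntegrable (fun s => q₁.eval s / p₁.eval s) volume t τ :=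
    (hcont.mono hsub').intervalIntegrable
  have heq : rhoDiff p q t τ = c * (Real.log (τ - a) - Real.log (t - a)) +
      ∫ s in t..τ, q₁.eval s / p₁.eval s := by
    have h1 : ∫ s in t..τ, (s - a)⁻¹ = Real.log (τ - a) - Real.log (t - a) := by
      rw [intervalIntegral.integral_comp_sub_right (fun s => s⁻¹), integral_inv_of_pos
        (sub_pos.2 ht.1) (sub_pos.2 hτ.1), Real.log_div (sub_pos.2 hτ.1).ne' (sub_pos.2 ht.1).ne']
    rw [← h1, ← intervalIntegral.integral_const_mul, ← intervalIntegral.integral_add hint1 hint2]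
    apply intervalIntegral.integral_congr
    intro s hs
    have h2 := hpos s hs
    have h3 := hne s (hsub' hs)
    simp only [hp, hq]
    field_simp
  rw [heq, add_sub_cancel_left]
  refine (intervalIntegral.norm_integral_le_of_norm_le_const (C := max C 1) fun s hs =>
    (hC s (hsub' (uIoc_subset_uIcc hs))).trans (le_max_left _ _)).trans ?_
  gcongr
  rw [abs_le]
  constructor <;> linarith [ht.1, ht.2, hτ.1, hτ.2]

/-- Exponentiation turns the logarithmic shift into powers: with `κ = δ|c|`, the factor `e^{δ|ρ(τ) -
ρ(t)|}` is at most a constant times `((τ - a)/(t - a))^κ`, and `1/|p|` supplies one more `(τ -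
a)⁻¹`. -/
theorem exists_exp_le (h : IsLeftEnd p a θ) (q : Polynomial ℝ) {δ : ℝ} (hδ : 0 ≤ δ) :
    ∃ C : ℝ, 0 < C ∧ ∀ t ∈ Ioc a θ, ∀ τ ∈ Icc t θ,
      Real.exp (δ * |rhoDiff p q t τ|) / |p.eval τ| ≤
        C * ((τ - a) ^ (δ * |logCoeff p q a| - 1) * (t - a) ^ (-(δ * |logCoeff p q a|))) := by
  obtain ⟨C₁, hC₁, h1⟩ := h.exists_inv_le
  obtain ⟨C₂, hC₂, h2⟩ := h.exists_abs_rhoDiff_sub_le q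
  set c := logCoeff p q a
  refine ⟨Real.exp (δ * C₂) * C₁, by positivity, fun t ht τ hτ => ?_⟩
  have ht0 : 0 < t - a := sub_pos.2 ht.1
  have hτa : a < τ := ht.1.trans_le hτ.1
  have hτ0 : 0 < τ - a := sub_pos.2 hτa
  have hlog : Real.log (t - a) ≤ Real.log (τ - a) := Real.log_le_log ht0 (by linarith [hτ.1])
  have h3 : |rhoDiff p q t τ| ≤ C₂ + |c| * (Real.log (τ - a) - Real.log (t - a)) := by
    have := h2 t ht τ ⟨hτa, hτ.2⟩
    calc _ = |(rhoDiff p q t τ - c * (Real.log (τ - a) - Real.log (t - a))) +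
          c * (Real.log (τ - a) - Real.log (t - a))| := by ring_nf
      _ ≤ _ := (abs_add_le _ _).trans (by
          rw [abs_mul, abs_of_nonneg (sub_nonneg.2 hlog)]; gcongr)
  have h4 : Real.exp (δ * |rhoDiff p q t τ|) ≤
      Real.exp (δ * C₂) * ((τ - a) ^ (δ * |c|) * (t - a) ^ (-(δ * |c|))) := by
    rw [Real.rpow_def_of_pos hτ0, Real.rpow_def_of_pos ht0, ← Real.exp_add, ← Real.exp_add]
    apply Real.exp_le_exp.2
    nlinarith
  rw [div_eq_mul_inv, Real.rpow_sub_one hτ0.ne', div_eq_mul_inv]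
  calc _ ≤ (Real.exp (δ * C₂) * ((τ - a) ^ (δ * |c|) * (t - a) ^ (-(δ * |c|)))) *
        (C₁ * (τ - a)⁻¹) := mul_le_mul h4 (h1 τ ⟨hτa, hτ.2⟩) (by positivity) (by positivity)
    _ = _ := by ring

theorem continuousOn_rhoDiff (h : IsLeftEnd p a θ) (q : Polynomial ℝ) {t : ℝ} (ht : t ∈ Ioc a θ) :
    ContinuousOn (rhoDiff p q t) (Icc t θ) := by
  have hc : ContinuousOn (fun s => q.eval s / p.eval s) (Icc t θ) :=
    q.continuous.continuousOn.div p.continuous.continuousOn fun s hs =>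
      h.ne_zero s ⟨ht.1.trans_le hs.1, hs.2⟩
  have := intervalIntegral.continuousOn_primitive_interval (a := t) (b := θ) (μ := volume)
    (f := fun s => q.eval s / p.eval s)
    (by rw [uIcc_of_le ht.2]; exact hc.integrableOn_Icc)
  rwa [uIcc_of_le ht.2] at this

/-- A Schur type test with power weights. By `exists_exp_le` the integrand is at most a multiple of
`(τ - a)^(κ-1-ν)`; because `ν > κ`, its integral is controlled by `(t - a)^(κ-ν)`. Multiplied by `(t
- a)^(-κ)` this gives back `(t - a)^(-ν)`. -/
theorem exists_integral_le (h : IsLeftEnd p a θ) (q : Polynomial ℝ) {δ ν : ℝ} (hδ : 0 ≤ δ)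
    (hν : δ * |logCoeff p q a| < ν) :
    ∃ C : ℝ, 0 < C ∧ ∀ t ∈ Ioc a θ,
      ∫ τ in t..θ, Real.exp (δ * |rhoDiff p q t τ|) / |p.eval τ| * (τ - a) ^ (-ν) ≤
        C * (t - a) ^ (-ν) := by
  obtain ⟨C, hC, h1⟩ := h.exists_exp_le q hδ
  set κ := δ * |logCoeff p q a|
  refine ⟨C * (ν - κ)⁻¹, mul_pos hC (inv_pos.2 (sub_pos.2 hν)), fun t ht => ?_⟩
  have ht0 : 0 < t - a := sub_pos.2 ht.1
  have hpos : ∀ τ ∈ Icc t θ, 0 < τ - a := fun τ hτ => by linarith [hτ.1]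
  have hcp : ∀ e : ℝ, ContinuousOn (fun τ => (τ - a) ^ e) (Icc t θ) := fun e =>
    (continuousOn_id.sub continuousOn_const).rpow_const fun τ hτ => Or.inl (hpos τ hτ).ne'
  have hle : ∀ τ ∈ Icc t θ, Real.exp (δ * |rhoDiff p q t τ|) / |p.eval τ| * (τ - a) ^ (-ν) ≤
      C * (t - a) ^ (-κ) * (τ - a) ^ (κ - 1 - ν) := fun τ hτ => by
    have h0 := hpos τ hτ
    calc _ ≤ C * ((τ - a) ^ (κ - 1) * (t - a) ^ (-κ)) * (τ - a) ^ (-ν) := by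
          gcongr; exact h1 t ht τ hτ
      _ = _ := by rw [sub_eq_add_neg (κ - 1) ν, Real.rpow_add h0]; ring
  have hI1 : IntervalIntegrable (fun τ => Real.exp (δ * |rhoDiff p q t τ|) / |p.eval τ| *
      (τ - a) ^ (-ν)) volume t θ := by
    apply ContinuousOn.intervalIntegrable
    rw [uIcc_of_le ht.2]
    refine ContinuousOn.mul (ContinuousOn.div ?_ p.continuous.abs.continuousOn fun s hs =>
      abs_ne_zero.2 (h.ne_zero s ⟨ht.1.trans_le hs.1, hs.2⟩)) (hcp _)
    exact Real.continuous_exp.comp_continuousOn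
      (continuousOn_const.mul (h.continuousOn_rhoDiff q ht).abs)
  have hI2 : IntervalIntegrable (fun τ => C * (t - a) ^ (-κ) * (τ - a) ^ (κ - 1 - ν)) volume t θ := by
    apply ContinuousOn.intervalIntegrable
    rw [uIcc_of_le ht.2]
    exact continuousOn_const.mul (hcp _)
  refine (intervalIntegral.integral_mono_on ht.2 hI1 hI2 hle).trans ?_
  rw [intervalIntegral.integral_const_mul,
    intervalIntegral.integral_comp_sub_right (fun s => s ^ (κ - 1 - ν)) a]
  have h0 : (0:ℝ) ∉ uIcc (t - a) (θ - a) := by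
    rw [uIcc_of_le (by linarith [ht.2])]
    exact fun hh => absurd hh.1 (not_le.2 ht0)
  rw [integral_rpow (Or.inr ⟨by linarith, h0⟩)]
  have e1 : κ - 1 - ν + 1 = κ - ν := by ring
  rw [e1]
  -- The exponent `κ - ν` is negative, so the boundary term at `θ` has a favourable sign and is
  -- dropped.
  have h5 : ((θ - a) ^ (κ - ν) - (t - a) ^ (κ - ν)) / (κ - ν) ≤ (ν - κ)⁻¹ * (t - a) ^ (κ - ν) := by
    rw [← neg_sub ν κ, div_neg, ← neg_div, div_eq_inv_mul]
    have : 0 < (ν - κ)⁻¹ := inv_pos.2 (sub_pos.2 hν)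
    gcongr
    have : 0 ≤ (θ - a) ^ (-(ν - κ)) := Real.rpow_nonneg (sub_nonneg.2 h.lt.le) _
    linarith
  calc _ ≤ C * (t - a) ^ (-κ) * ((ν - κ)⁻¹ * (t - a) ^ (κ - ν)) := by gcongr
    _ = C * (ν - κ)⁻¹ * ((t - a) ^ (-κ) * (t - a) ^ (κ - ν)) := by ring
    _ = _ := by rw [← Real.rpow_add ht0]; ring_nf

end IsLeftEnd

end Strip

/-! ### The weighted kernel estimate on the whole strip -/

namespace Strip

/-- `a < θ < b` where `a` and `b` are consecutive zeros of `p`, and both are simple. -/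
structure IsStrip (p : Polynomial ℝ) (a b θ : ℝ) : Prop where
  mem : θ ∈ Ioo a b
  zero_left : p.eval a = 0
  zero_right : p.eval b = 0
  simple_left : p.derivative.eval a ≠ 0
  simple_right : p.derivative.eval b ≠ 0
  ne_zero : ∀ s ∈ Ioo a b, p.eval s ≠ 0

/-- The weight `|t - a|^ν |t - b|^ν`. -/
noncomputable def endWeight (a b ν t : ℝ) : ℝ := |t - a| ^ ν * |t - b| ^ ν

theorem endWeight_pos {a b t : ℝ} (ν : ℝ) (ht : t ∈ Ioo a b) : 0 < endWeight a b ν t :=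
  mul_pos (Real.rpow_pos_of_pos (abs_pos.2 (sub_ne_zero.2 ht.1.ne')) _)
    (Real.rpow_pos_of_pos (abs_pos.2 (sub_ne_zero.2 ht.2.ne)) _)

theorem endWeight_neg (a b ν t : ℝ) : endWeight (-b) (-a) ν (-t) = endWeight a b ν t := by
  have h : ∀ x y : ℝ, |-x - -y| = |x - y| := fun x y => by
    rw [← neg_sub_neg, neg_neg, neg_neg, ← abs_neg]; ring_nf
  rw [endWeight, endWeight, h, h, mul_comm]

theorem continuousOn_endWeight (a b ν : ℝ) : ContinuousOn (endWeight a b ν) (Ioo a b) :=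
  (((continuousOn_id.sub continuousOn_const).abs).rpow_const
    fun _ ht => Or.inl (abs_ne_zero.2 (sub_ne_zero.2 ht.1.ne'))).mul
  (((continuousOn_id.sub continuousOn_const).abs).rpow_const
    fun _ ht => Or.inl (abs_ne_zero.2 (sub_ne_zero.2 ht.2.ne)))

theorem endWeight_le {a b ν t : ℝ} (hν : 0 ≤ ν) (ht : t ∈ Icc a b) :
    endWeight a b ν t ≤ (b - a) ^ ν * (b - a) ^ ν := by
  have h1 : |t - a| ≤ b - a := by rw [abs_of_nonneg (by linarith [ht.1])]; linarith [ht.2]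
  have h2 : |t - b| ≤ b - a := by rw [abs_of_nonpos (by linarith [ht.2])]; linarith [ht.1]
  unfold endWeight
  have := h1.trans' (abs_nonneg _)
  gcongr

theorem lintegral_inv_endWeight_lt_top {a b ν : ℝ} (hν : 0 < ν) (hν1 : ν < 1) :
    ∫⁻ t in Ioo a b, ENNReal.ofReal (endWeight a b ν t)⁻¹ < ⊤ := by
  rcases le_or_gt b a with hab | hab
  · simp [Ioo_eq_empty (not_lt.2 hab)]
  have h1 : IntegrableOn (fun t => (t - a) ^ (-ν)) (Ioo a b) := by
    have := (intervalIntegral.intervalIntegrable_rpow' (r := -ν) (a := a - a) (b := b - a)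
      (by linarith)).comp_sub_right a
    simp only [sub_add_cancel] at this
    exact (intervalIntegrable_iff_integrableOn_Ioo_of_le hab.le).1 this
  have h2 : IntegrableOn (fun t => (b - t) ^ (-ν)) (Ioo a b) := by
    have := (intervalIntegral.intervalIntegrable_rpow' (r := -ν) (a := b - a) (b := b - b)
      (by linarith)).comp_sub_left b
    simp only [sub_sub_cancel] at this
    exact (intervalIntegrable_iff_integrableOn_Ioo_of_le hab.le).1 this
  set D := ((b - a) / 2) ^ (-ν)
  have hD : 0 ≤ D := Real.rpow_nonneg (by linarith) _
  have h3 := ((h1.add h2).const_mul D).lintegral_lt_top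
  refine lt_of_le_of_lt (setLIntegral_mono_ae' measurableSet_Ioo
    (Eventually.of_forall fun t ht => ?_)) h3
  apply ENNReal.ofReal_le_ofReal
  have ha : 0 < t - a := sub_pos.2 ht.1
  have hb : 0 < b - t := sub_pos.2 ht.2
  rw [endWeight, abs_of_pos ha, abs_of_neg (sub_neg.2 ht.2), neg_sub, mul_inv, ← Real.rpow_neg ha.le,
    ← Real.rpow_neg hb.le]
  have ha' := Real.rpow_nonneg ha.le (-ν)
  have hb' := Real.rpow_nonneg hb.le (-ν)
  simp only [Pi.add_apply]
  -- The farther of the two ends is at distance at least `(b - a)/2`, so its factor is at most `D`;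
  -- the other factor is integrable since `ν < 1`.
  rcases le_total (t - a) (b - t) with hh | hh
  · have : (b - t) ^ (-ν) ≤ D :=
      Real.rpow_le_rpow_of_nonpos (by linarith) (by linarith) (by linarith)
    nlinarith
  · have : (t - a) ^ (-ν) ≤ D :=
      Real.rpow_le_rpow_of_nonpos (by linarith) (by linarith) (by linarith)
    nlinarith

/-- The substitution `t ↦ -t` turns the right end into a left end, and both the logarithmic
coefficient and the increments of the primitive change sign. The estimates at `b` are deduced in
this way from those at `a`. -/
theorem logCoeff_reflect (p q : Polynomial ℝ) (b : ℝ) :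
    logCoeff (p.comp (-Polynomial.X)) (q.comp (-Polynomial.X)) (-b) = -logCoeff p q b := by
  simp [logCoeff, Polynomial.derivative_comp, div_neg]

theorem rhoDiff_reflect (p q : Polynomial ℝ) (t τ : ℝ) :
    rhoDiff (p.comp (-Polynomial.X)) (q.comp (-Polynomial.X)) (-t) (-τ) = -rhoDiff p q t τ := by
  simp only [rhoDiff, Polynomial.eval_comp, Polynomial.eval_neg, Polynomial.eval_X]
  rw [intervalIntegral.integral_comp_neg (fun s => q.eval s / p.eval s), neg_neg, neg_neg,
    intervalIntegral.integral_symm]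

/-- On `]a, θ]` the factor of the weight that belongs to `b` is bounded above and below, so it
enters `exists_integral_le` only through constants. -/
theorem IsLeftEnd.exists_integral_endWeight_le {p : Polynomial ℝ} {a θ : ℝ} (h : IsLeftEnd p a θ)
    (q : Polynomial ℝ) {b δ ν : ℝ} (hb : θ < b) (hδ : 0 ≤ δ) (hν0 : 0 < ν)
    (hν : δ * |logCoeff p q a| < ν) :
    ∃ C : ℝ, 0 < C ∧ ∀ t ∈ Ioc a θ,
      ∫ τ in t..θ, Real.exp (δ * |rhoDiff p q t τ|) / |p.eval τ| * (endWeight a b ν τ)⁻¹ ≤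
        C * (endWeight a b ν t)⁻¹ := by
  obtain ⟨C, hC, h1⟩ := h.exists_integral_le q hδ hν
  have hθb : 0 < b - θ := sub_pos.2 hb
  have hab : 0 < b - a := by linarith [h.lt]
  refine ⟨(b - θ) ^ (-ν) * C * (b - a) ^ ν, by positivity, fun t ht => ?_⟩
  have hpos : ∀ τ ∈ Icc t θ, 0 < τ - a := fun τ hτ => by linarith [hτ.1, ht.1]
  have hw : ∀ τ ∈ Icc t θ, (endWeight a b ν τ)⁻¹ = (τ - a) ^ (-ν) * (b - τ) ^ (-ν) := fun τ hτ => by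
    have := hpos τ hτ
    have hbt : τ - b < 0 := by linarith [hτ.2]
    rw [endWeight, abs_of_pos this, abs_of_neg hbt, neg_sub, mul_inv,
      Real.rpow_neg this.le, Real.rpow_neg (by linarith)]
  have hcp : ∀ e : ℝ, ContinuousOn (fun τ => (τ - a) ^ e) (Icc t θ) := fun e =>
    (continuousOn_id.sub continuousOn_const).rpow_const fun τ hτ => Or.inl (hpos τ hτ).ne'
  have hc0 : ContinuousOn (fun τ => Real.exp (δ * |rhoDiff p q t τ|) / |p.eval τ|) (Icc t θ) := by
    refine ContinuousOn.div ?_ p.continuous.abs.continuousOn fun s hs =>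
      abs_ne_zero.2 (h.ne_zero s ⟨ht.1.trans_le hs.1, hs.2⟩)
    exact Real.continuous_exp.comp_continuousOn
      (continuousOn_const.mul (h.continuousOn_rhoDiff q ht).abs)
  have hcw : ContinuousOn (fun τ => (endWeight a b ν τ)⁻¹) (Icc t θ) :=
    ((continuousOn_endWeight a b ν).mono fun τ hτ =>
      ⟨by linarith [hpos τ hτ], by linarith [hτ.2]⟩).inv₀ fun τ hτ =>
        (endWeight_pos ν ⟨by linarith [hpos τ hτ], by linarith [hτ.2]⟩).ne'
  have hI : ∀ g : ℝ → ℝ, ContinuousOn g (Icc t θ) → IntervalIntegrable g volume t θ := fun g hg => by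
    apply ContinuousOn.intervalIntegrable; rwa [uIcc_of_le ht.2]
  calc _ ≤ ∫ τ in t..θ, (b - θ) ^ (-ν) *
        (Real.exp (δ * |rhoDiff p q t τ|) / |p.eval τ| * (τ - a) ^ (-ν)) := by
        refine intervalIntegral.integral_mono_on ht.2 (hI _ (hc0.mul hcw))
          (hI _ (continuousOn_const.mul (hc0.mul (hcp _)))) fun τ hτ => ?_
        have h0 := hpos τ hτ
        have : (b - τ) ^ (-ν) ≤ (b - θ) ^ (-ν) :=
          Real.rpow_le_rpow_of_nonpos hθb (by linarith [hτ.2]) (by linarith)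
        rw [hw τ hτ]
        calc _ ≤ Real.exp (δ * |rhoDiff p q t τ|) / |p.eval τ| *
              ((τ - a) ^ (-ν) * (b - θ) ^ (-ν)) := by gcongr
          _ = _ := by ring
    _ ≤ (b - θ) ^ (-ν) * (C * (t - a) ^ (-ν)) := by
        rw [intervalIntegral.integral_const_mul]
        have := h1 t ht
        gcongr
    _ ≤ _ := by
        rw [hw t ⟨le_rfl, ht.2⟩]
        have h0 := hpos t ⟨le_rfl, ht.2⟩
        have hbt : 0 < b - t := by linarith [ht.2]
        -- This factor restores the part of `1/w(t)` that belongs to `b`.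
        have : 1 ≤ (b - a) ^ ν * (b - t) ^ (-ν) := by
          rw [Real.rpow_neg hbt.le, ← div_eq_mul_inv, one_le_div (by positivity)]
          exact Real.rpow_le_rpow hbt.le (by linarith [ht.1]) hν0.le
        calc (b - θ) ^ (-ν) * (C * (t - a) ^ (-ν))
            ≤ (b - θ) ^ (-ν) * (C * (t - a) ^ (-ν)) * ((b - a) ^ ν * (b - t) ^ (-ν)) :=
              le_mul_of_one_le_right (by positivity) this
          _ = _ := by ring

namespace IsStrip

variable {p : Polynomial ℝ} {a b θ : ℝ}

theorem leftEnd (h : IsStrip p a b θ) : IsLeftEnd p a θ :=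
  ⟨h.mem.1, h.zero_left, h.simple_left, fun s hs => h.ne_zero s ⟨hs.1, hs.2.trans_lt h.mem.2⟩⟩

theorem reflect (h : IsStrip p a b θ) : IsStrip (p.comp (-Polynomial.X)) (-b) (-a) (-θ) where
  mem := ⟨neg_lt_neg h.mem.2, neg_lt_neg h.mem.1⟩
  zero_left := by simp [h.zero_right]
  zero_right := by simp [h.zero_left]
  simple_left := by simp [Polynomial.derivative_comp, h.simple_right]
  simple_right := by simp [Polynomial.derivative_comp, h.simple_left]
  ne_zero := fun s hs => by
    simpa using h.ne_zero (-s) ⟨by linarith [hs.2], by linarith [hs.1]⟩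

/-- Left of `θ` this is the one-sided bound at `a`; right of `θ` it is the same bound on the
reflected strip. Parts i), ii) and iv) use the kernel only through this estimate, each with its own
admissible `δ` and `ν`. -/
theorem exists_abs_integral_exp_le (h : IsStrip p a b θ) (q : Polynomial ℝ) {δ ν : ℝ}
    (hδ : 0 ≤ δ) (hν0 : 0 < ν) (ha : δ * |logCoeff p q a| < ν) (hb : δ * |logCoeff p q b| < ν) :
    ∃ C : ℝ, 0 < C ∧ ∀ t ∈ Ioo a b,
      |∫ τ in θ..t, Real.exp (δ * |rhoDiff p q t τ|) / |p.eval τ| * (endWeight a b ν τ)⁻¹| ≤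
        C * (endWeight a b ν t)⁻¹ := by
  obtain ⟨C₁, hC₁, h1⟩ := h.leftEnd.exists_integral_endWeight_le q h.mem.2 hδ hν0 ha
  obtain ⟨C₂, hC₂, h2⟩ := h.reflect.leftEnd.exists_integral_endWeight_le
    (q.comp (-Polynomial.X)) (neg_lt_neg h.mem.1) hδ hν0 (by rwa [logCoeff_reflect, abs_neg])
  refine ⟨C₁ + C₂, by positivity, fun t ht => ?_⟩
  have hw := inv_pos.2 (endWeight_pos ν ht)
  have hnn : ∀ τ, 0 ≤ Real.exp (δ * |rhoDiff p q t τ|) / |p.eval τ| * (endWeight a b ν τ)⁻¹ :=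
    fun τ => by unfold endWeight; positivity
  rcases le_total t θ with htθ | htθ
  · rw [intervalIntegral.integral_symm, abs_neg, abs_of_nonneg
      (intervalIntegral.integral_nonneg htθ fun τ _ => hnn τ)]
    refine (h1 t ⟨ht.1, htθ⟩).trans ?_
    gcongr; linarith
  · rw [abs_of_nonneg (intervalIntegral.integral_nonneg htθ fun τ _ => hnn τ)]
    have := h2 (-t) ⟨neg_lt_neg ht.2, neg_le_neg htθ⟩
    rw [endWeight_neg] at this
    calc _ = ∫ τ in -t..-θ, Real.exp (δ * |rhoDiff (p.comp (-Polynomial.X))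
          (q.comp (-Polynomial.X)) (-t) τ|) / |(p.comp (-Polynomial.X)).eval τ| *
            (endWeight (-b) (-a) ν τ)⁻¹ := by
          have := intervalIntegral.integral_comp_neg (a := -t) (b := -θ)
            (fun τ => Real.exp (δ * |rhoDiff p q t τ|) / |p.eval τ| * (endWeight a b ν τ)⁻¹)
          rw [neg_neg, neg_neg] at this
          rw [← this]
          congr 1
          ext τ
          have e := rhoDiff_reflect p q t (-τ)
          have e' := endWeight_neg a b ν (-τ)
          rw [neg_neg] at e e'
          rw [e, e', abs_neg]
          simp
      _ ≤ _ := this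
      _ ≤ _ := by gcongr; linarith

theorem intervalIntegrable_of_continuousOn {E : Type*} [NormedAddCommGroup E]
    (h : IsStrip p a b θ) {g : ℝ → E} (hg : ContinuousOn g (Ioo a b)) {t : ℝ} (ht : t ∈ Ioo a b) :
    IntervalIntegrable g volume θ t :=
  (hg.mono ((convex_Ioo a b).ordConnected.uIcc_subset h.mem ht)).intervalIntegrable

theorem continuousOn_div (h : IsStrip p a b θ) (q : Polynomial ℝ) :
    ContinuousOn (fun s => q.eval s / p.eval s) (Ioo a b) :=
  q.continuous.continuousOn.div p.continuous.continuousOn h.ne_zero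

theorem rhoDiff_eq (h : IsStrip p a b θ) (q : Polynomial ℝ) {t τ : ℝ} (ht : t ∈ Ioo a b)
    (hτ : τ ∈ Ioo a b) : rhoDiff p q t τ = rhoDiff p q θ τ - rhoDiff p q θ t := by
  unfold rhoDiff
  rw [intervalIntegral.integral_interval_sub_left]
  · exact h.intervalIntegrable_of_continuousOn (h.continuousOn_div q) hτ
  · exact h.intervalIntegrable_of_continuousOn (h.continuousOn_div q) ht

theorem hasDerivAt_rhoDiff (h : IsStrip p a b θ) (q : Polynomial ℝ) {t : ℝ} (ht : t ∈ Ioo a b) :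
    HasDerivAt (rhoDiff p q θ) (q.eval t / p.eval t) t :=
  intervalIntegral.integral_hasDerivAt_right
    (h.intervalIntegrable_of_continuousOn (h.continuousOn_div q) ht)
    ((h.continuousOn_div q).stronglyMeasurableAtFilter isOpen_Ioo t ht)
    ((h.continuousOn_div q).continuousAt (isOpen_Ioo.mem_nhds ht))

theorem continuousOn_rhoDiff (h : IsStrip p a b θ) (q : Polynomial ℝ) :
    ContinuousOn (rhoDiff p q θ) (Ioo a b) :=
  fun _ ht => (h.hasDerivAt_rhoDiff q ht).continuousAt.continuousWithinAt

theorem continuousOn_rhoDiff_right (h : IsStrip p a b θ) (q : Polynomial ℝ) {t : ℝ}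
    (ht : t ∈ Ioo a b) : ContinuousOn (rhoDiff p q t) (Ioo a b) :=
  ((h.continuousOn_rhoDiff q).sub continuousOn_const).congr fun _ hτ => h.rhoDiff_eq q ht hτ

/-- The characteristic integral of a function of size `e^{δ |ρ(τ) - ρ(t)|} / w(τ)`. -/
theorem norm_integral_le {E : Type*} [NormedAddCommGroup E] [NormedSpace ℝ E]
    (h : IsStrip p a b θ) (q : Polynomial ℝ) {δ ν C M : ℝ} {t : ℝ}
    (hC : |∫ τ in θ..t, Real.exp (δ * |rhoDiff p q t τ|) / |p.eval τ| * (endWeight a b ν τ)⁻¹| ≤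
        C * (endWeight a b ν t)⁻¹) (ht : t ∈ Ioo a b) {g : ℝ → E} (hM : 0 ≤ M)
    (hg : ∀ τ ∈ Ioo a b, ‖g τ‖ ≤
      M * (Real.exp (δ * |rhoDiff p q t τ|) / |p.eval τ| * (endWeight a b ν τ)⁻¹)) :
    ‖∫ τ in θ..t, g τ‖ ≤ M * C * (endWeight a b ν t)⁻¹ := by
  have hsub : uIcc θ t ⊆ Ioo a b := (convex_Ioo a b).ordConnected.uIcc_subset h.mem ht
  have hI : IntervalIntegrable (fun τ => M * (Real.exp (δ * |rhoDiff p q t τ|) / |p.eval τ| *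
      (endWeight a b ν τ)⁻¹)) volume θ t := by
    refine h.intervalIntegrable_of_continuousOn (continuousOn_const.mul (ContinuousOn.mul
      (ContinuousOn.div ?_ p.continuous.abs.continuousOn fun s hs => abs_ne_zero.2 (h.ne_zero s hs))
      ((continuousOn_endWeight a b ν).inv₀ fun s hs => (endWeight_pos ν hs).ne'))) ht
    exact Real.continuous_exp.comp_continuousOn
      (continuousOn_const.mul (h.continuousOn_rhoDiff_right q ht).abs)
  refine (intervalIntegral.norm_integral_le_abs_of_norm_le ?_ hI).trans ?_
  · exact (ae_restrict_mem measurableSet_uIoc).mono fun τ hτ => hg τ (hsub (uIoc_subset_uIcc hτ))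
  · rw [intervalIntegral.integral_const_mul, abs_mul, abs_of_nonneg hM, mul_assoc]
    gcongr

end IsStrip

/-- A cost that is polynomial in the translation is absorbed by an exponential of arbitrarily small
rate, and therefore by an arbitrarily weak singular weight at the ends. -/
theorem exists_rpow_le_exp (n : ℝ) {δ : ℝ} (hδ : 0 < δ) :
    ∃ C : ℝ, 0 < C ∧ ∀ r : ℝ, (1 + |r|) ^ n ≤ C * Real.exp (δ * |r|) := by
  obtain ⟨m, hm⟩ := exists_nat_ge n
  refine ⟨(m.factorial : ℝ) / δ ^ m * Real.exp δ, by positivity, fun r => ?_⟩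
  have h1 : 1 ≤ 1 + |r| := by linarith [abs_nonneg r]
  have h2 : (1 + |r|) ^ n ≤ (1 + |r|) ^ m := by
    rw [← Real.rpow_natCast]; exact Real.rpow_le_rpow_of_exponent_le h1 hm
  have h3 := Real.pow_div_factorial_le_exp (δ * (1 + |r|)) (by positivity) m
  rw [mul_pow, div_le_iff₀ (by positivity)] at h3
  refine h2.trans ?_
  have : (1 + |r|) ^ m ≤ Real.exp (δ * (1 + |r|)) * m.factorial / δ ^ m := by
    rw [le_div_iff₀ (by positivity)]; linarith
  refine this.trans (le_of_eq ?_)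
  rw [mul_add, Real.exp_add, mul_one]; ring

end Strip

/-! ### Primitives in time that depend on a parameter -/

namespace Strip

section Parametric

variable {E : Type*} [NormedAddCommGroup E] [NormedSpace ℝ E] {a b θ : ℝ}

theorem continuousOn_parametric_primitive (hθ : θ ∈ Ioo a b) {F : ℝ → ℝ → E}
    (hF : ContinuousOn (fun z : ℝ × ℝ => F z.1 z.2) (Ioo a b ×ˢ univ)) :
    ContinuousOn (fun z : ℝ × ℝ => ∫ τ in θ..z.1, F τ z.2) (Ioo a b ×ˢ univ) := by
  rintro ⟨t, y⟩ ⟨ht, -⟩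
  obtain ⟨α, hα, hα'⟩ := exists_between (lt_min hθ.1 ht.1)
  obtain ⟨β, hβ, hβ'⟩ := exists_between (max_lt hθ.2 ht.2)
  rw [lt_min_iff] at hα'
  rw [max_lt_iff] at hβ
  have hαβ : α ≤ β := (hα'.1.trans hβ.1).le
  -- Clamping `τ` to a compact interval inside `]a, b[` makes the integrand continuous everywhere
  -- without changing it where it is integrated.
  have hcl : ∀ τ, max α (min τ β) ∈ Ioo a b := fun τ =>
    ⟨hα.trans_le (le_max_left _ _), max_lt (hαβ.trans_lt hβ') ((min_le_right _ _).trans_lt hβ')⟩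
  have hc : Continuous (Function.uncurry fun (z : ℝ × ℝ) (τ : ℝ) => F (max α (min τ β)) z.2) := by
    refine hF.comp_continuous (f := fun w : (ℝ × ℝ) × ℝ => (max α (min w.2 β), w.1.2)) (by fun_prop)
      fun w => ⟨hcl _, mem_univ _⟩
  have h1 := intervalIntegral.continuous_parametric_intervalIntegral_of_continuous (μ := volume)
    (a₀ := θ) hc (s := Prod.fst) continuous_fst
  refine (h1.continuousAt.congr ?_).continuousWithinAt
  have : ∀ᶠ z : ℝ × ℝ in 𝓝 (t, y), z.1 ∈ Ioo α β :=
    continuous_fst.continuousAt.eventually (isOpen_Ioo.mem_nhds ⟨hα'.2, hβ.2⟩)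
  filter_upwards [this] with z hz
  apply intervalIntegral.integral_congr
  intro τ hτ
  have hτ' : τ ∈ Icc α β := (convex_Icc α β).ordConnected.uIcc_subset
    ⟨hα'.1.le, hβ.1.le⟩ ⟨hz.1.le, hz.2.le⟩ hτ
  simp [min_eq_left hτ'.2, max_eq_right hτ'.1]

variable {F F' : ℝ → ℝ → E}

theorem continuousOn_left_of_strip {E : Type*} [TopologicalSpace E] {F : ℝ → ℝ → E}
    (hF : ContinuousOn (fun z : ℝ × ℝ => F z.1 z.2) (Ioo a b ×ˢ univ)) (y : ℝ) :
    ContinuousOn (fun τ => F τ y) (Ioo a b) :=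
  hF.comp (f := fun τ => (τ, y)) (by fun_prop) fun _ hτ => ⟨hτ, mem_univ _⟩

theorem hasDerivAt_parametric_primitive_right (hθ : θ ∈ Ioo a b)
    (hF : ContinuousOn (fun z : ℝ × ℝ => F z.1 z.2) (Ioo a b ×ˢ univ))
    (hF' : ContinuousOn (fun z : ℝ × ℝ => F' z.1 z.2) (Ioo a b ×ˢ univ))
    (hd : ∀ τ ∈ Ioo a b, ∀ y, HasDerivAt (F τ) (F' τ y) y) {t : ℝ} (ht : t ∈ Ioo a b) (y : ℝ) :
    HasDerivAt (fun y => ∫ τ in θ..t, F τ y) (∫ τ in θ..t, F' τ y) y := by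
  have hsub : uIcc θ t ⊆ Ioo a b := (convex_Ioo a b).ordConnected.uIcc_subset hθ ht
  obtain ⟨C, hC⟩ := (isCompact_uIcc (a := θ) (b := t)).prod
    (isCompact_closedBall y 1) |>.exists_bound_of_continuousOn
      (hF'.mono (prod_mono hsub (subset_univ _)))
  have hi : ∀ {G : ℝ → ℝ → E}, ContinuousOn (fun z : ℝ × ℝ => G z.1 z.2) (Ioo a b ×ˢ univ) →
      ∀ y, IntervalIntegrable (fun τ => G τ y) volume θ t := fun hG y =>
    ((continuousOn_left_of_strip hG y).mono hsub).intervalIntegrable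
  refine (intervalIntegral.hasDerivAt_integral_of_dominated_loc_of_deriv_le
    (F := fun y τ => F τ y) (F' := fun y τ => F' τ y) (bound := fun _ => C)
    (Metric.closedBall_mem_nhds y one_pos)
    (Eventually.of_forall fun z => (intervalIntegrable_iff.1 (hi hF z)).aestronglyMeasurable) (hi hF y)
    (intervalIntegrable_iff.1 (hi hF' y)).aestronglyMeasurable
    (Eventually.of_forall fun τ hτ z hz => hC (τ, z) ⟨uIoc_subset_uIcc hτ, hz⟩)
    intervalIntegrable_const
    (Eventually.of_forall fun τ hτ z _ => hd τ (hsub (uIoc_subset_uIcc hτ)) z)).2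

variable [CompleteSpace E]

/-- Both partial derivatives, `F(t, y)` in time and `∫ ∂_y F` in the parameter, exist near the point
and are continuous in the pair. Joint differentiability is what permits the chain rule along a
characteristic curve. -/
theorem hasStrictFDerivAt_parametric_primitive (hθ : θ ∈ Ioo a b)
    (hF : ContinuousOn (fun z : ℝ × ℝ => F z.1 z.2) (Ioo a b ×ˢ univ))
    (hF' : ContinuousOn (fun z : ℝ × ℝ => F' z.1 z.2) (Ioo a b ×ˢ univ))
    (hd : ∀ τ ∈ Ioo a b, ∀ y, HasDerivAt (F τ) (F' τ y) y) {t : ℝ} (ht : t ∈ Ioo a b) (y : ℝ) :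
    HasStrictFDerivAt (fun z : ℝ × ℝ => ∫ τ in θ..z.1, F τ z.2)
      ((ContinuousLinearMap.toSpanSingleton ℝ (F t y)).coprod
        (ContinuousLinearMap.toSpanSingleton ℝ (∫ τ in θ..t, F' τ y))) (t, y) := by
  have hΩ : IsOpen (Ioo a b ×ˢ (univ : Set ℝ)) := isOpen_Ioo.prod isOpen_univ
  have hmem : Ioo a b ×ˢ (univ : Set ℝ) ∈ 𝓝 (t, y) := hΩ.mem_nhds ⟨ht, mem_univ _⟩
  have hL : Continuous fun e : E => ContinuousLinearMap.toSpanSingleton ℝ e :=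
    (ContinuousLinearMap.toSpanSingletonCLE (𝕜 := ℝ) (E := E)).continuous
  refine hasStrictFDerivAt_uncurry_coprod (𝕜 := ℝ) (f := fun t y => ∫ τ in θ..t, F τ y)
    (f₁ := fun t y => ContinuousLinearMap.toSpanSingleton ℝ (F t y))
    (f₂ := fun t y => ContinuousLinearMap.toSpanSingleton ℝ (∫ τ in θ..t, F' τ y))
    (u := (t, y)) ?_ ?_ ?_ ?_
  · filter_upwards [hmem] with z hz
    have hc := continuousOn_left_of_strip hF z.2
    refine (intervalIntegral.integral_hasDerivAt_right (f := fun τ => F τ z.2)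
      ((hc.mono ((convex_Ioo a b).ordConnected.uIcc_subset hθ hz.1)).intervalIntegrable)
      (hc.stronglyMeasurableAtFilter isOpen_Ioo z.1 hz.1)
      (hc.continuousAt (isOpen_Ioo.mem_nhds hz.1))).hasFDerivAt
  · filter_upwards [hmem] with z hz
    exact (hasDerivAt_parametric_primitive_right hθ hF hF' hd hz.1 z.2).hasFDerivAt
  · exact hL.continuousAt.comp (hF.continuousAt hmem)
  · exact hL.continuousAt.comp ((continuousOn_parametric_primitive hθ hF').continuousAt hmem)

/-- The derivative of `t ↦ ∫_θ^t F(τ, y(t)) dτ`. -/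
theorem hasDerivAt_parametric_primitive_comp (hθ : θ ∈ Ioo a b)
    (hF : ContinuousOn (fun z : ℝ × ℝ => F z.1 z.2) (Ioo a b ×ˢ univ))
    (hF' : ContinuousOn (fun z : ℝ × ℝ => F' z.1 z.2) (Ioo a b ×ˢ univ))
    (hd : ∀ τ ∈ Ioo a b, ∀ y, HasDerivAt (F τ) (F' τ y) y) {t : ℝ} (ht : t ∈ Ioo a b)
    {y : ℝ → ℝ} {y' : ℝ} (hy : HasDerivAt y y' t) :
    HasDerivAt (fun t => ∫ τ in θ..t, F τ (y t)) (F t (y t) + y' • ∫ τ in θ..t, F' τ (y t)) t := by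
  have h1 := (hasStrictFDerivAt_parametric_primitive hθ hF hF' hd ht (y t)).hasFDerivAt
  have h2 := h1.comp_hasDerivAt t ((hasDerivAt_id t).prodMk hy)
  exact h2.congr_deriv (by simp)

end Parametric

section Smooth

variable {a b θ : ℝ} {f : ℝ → ℝ → ℂ}

theorem isOpen_strip : IsOpen (Ioo a b ×ˢ (univ : Set ℝ)) := isOpen_Ioo.prod isOpen_univ

theorem SmoothOnStrip.hasDerivAt_right (hf : SmoothOnStrip a b f) {t : ℝ} (ht : t ∈ Ioo a b)
    (x : ℝ) : HasDerivAt (f t) (fderiv ℝ (fun z : ℝ × ℝ => f z.1 z.2) (t, x) (0, 1)) x := by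
  have h1 := ((hf.contDiffAt (isOpen_strip.mem_nhds (show (t, x) ∈ _ from ⟨ht, mem_univ _⟩))
    ).differentiableAt (by simp)).hasFDerivAt
  exact h1.comp_hasDerivAt x ((hasDerivAt_const x t).prodMk (hasDerivAt_id x))

theorem SmoothOnStrip.deriv_right (hf : SmoothOnStrip a b f) :
    SmoothOnStrip a b (fun t x => deriv (f t) x) := by
  have h1 : ContDiffOn ℝ ∞ (fun z => fderiv ℝ (fun z : ℝ × ℝ => f z.1 z.2) z (0, 1))
      (Ioo a b ×ˢ univ) :=
    ((contDiffOn_infty_iff_fderiv_of_isOpen isOpen_strip).1 hf).2.clm_apply contDiffOn_const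
  exact h1.congr fun z hz => (hf.hasDerivAt_right hz.1 z.2).deriv

theorem SmoothOnStrip.iteratedDeriv_right (hf : SmoothOnStrip a b f) (k : ℕ) :
    SmoothOnStrip a b (fun t x => iteratedDeriv k (f t) x) := by
  induction k with
  | zero => simpa using hf
  | succ k ih => simpa only [iteratedDeriv_succ] using ih.deriv_right

theorem SmoothOnStrip.contDiffOn_left (hf : SmoothOnStrip a b f) (x : ℝ) :
    ContDiffOn ℝ ∞ (fun t => f t x) (Ioo a b) :=
  ContDiffOn.comp (g := fun z : ℝ × ℝ => f z.1 z.2) (f := fun t => (t, x)) hf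
    (by fun_prop) fun _ ht => ⟨ht, mem_univ _⟩

theorem SmoothOnStrip.parametric_primitive (hθ : θ ∈ Ioo a b) (hf : SmoothOnStrip a b f) :
    SmoothOnStrip a b (fun t y => ∫ τ in θ..t, f τ y) := by
  -- The function stays general in the induction because the `y`-derivative of the primitive is the
  -- primitive of `∂_y f`.
  have key : ∀ n : ℕ, ∀ f : ℝ → ℝ → ℂ, SmoothOnStrip a b f →
      ContDiffOn ℝ n (fun z : ℝ × ℝ => ∫ τ in θ..z.1, f τ z.2) (Ioo a b ×ˢ univ) := by
    intro n
    induction n with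
    | zero =>
      intro f hf
      simpa using continuousOn_parametric_primitive hθ hf.continuousOn
    | succ n ih =>
      intro f hf
      have hd : ∀ z ∈ Ioo a b ×ˢ (univ : Set ℝ), HasFDerivAt
          (fun z : ℝ × ℝ => ∫ τ in θ..z.1, f τ z.2)
          ((ContinuousLinearMap.fst ℝ ℝ ℝ).smulRight (f z.1 z.2) +
            (ContinuousLinearMap.snd ℝ ℝ ℝ).smulRight (∫ τ in θ..z.1, deriv (f τ) z.2)) z := by
        intro z hz
        have := (hasStrictFDerivAt_parametric_primitive hθ hf.continuousOn
          hf.deriv_right.continuousOn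
          (fun τ hτ y => (hf.hasDerivAt_right hτ y).differentiableAt.hasDerivAt) hz.1 z.2).hasFDerivAt
        refine this.congr_fderiv ?_
        ext <;> simp
      push_cast
      rw [contDiffOn_succ_iff_fderiv_of_isOpen isOpen_strip]
      refine ⟨fun z hz => (hd z hz).differentiableAt.differentiableWithinAt, by simp, ?_⟩
      refine ContDiffOn.congr ?_ fun z hz => (hd z hz).fderiv
      exact (contDiffOn_const.smulRight (hf.of_le (by exact_mod_cast le_top))).add
        (contDiffOn_const.smulRight (ih _ hf.deriv_right))
  exact contDiffOn_infty.2 fun n => key n f hf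

end Smooth

end Strip

/-! ### Part i): exponential growth and decay -/

namespace Strip

variable {p q : Polynomial ℝ} {a b θ : ℝ} {f : ℝ → ℝ → ℂ}

theorem contDiff_eval (P : Polynomial ℝ) : ContDiff ℝ ∞ fun s : ℝ => P.eval s := by
  simpa using P.contDiff_aeval (𝕜 := ℝ) ∞

theorem contDiff_ofReal_eval (P : Polynomial ℝ) :
    ContDiff ℝ ∞ fun s : ℝ => ((P.eval s : ℝ) : ℂ) :=
  Complex.ofRealCLM.contDiff.comp (contDiff_eval P)

theorem IsStrip.ofReal_ne_zero (h : IsStrip p a b θ) {s : ℝ} (hs : s ∈ Ioo a b) :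
    ((p.eval s : ℝ) : ℂ) ≠ 0 := by exact_mod_cast h.ne_zero s hs

theorem IsStrip.contDiffOn_rhoDiff (h : IsStrip p a b θ) (q : Polynomial ℝ) :
    ContDiffOn ℝ ∞ (rhoDiff p q θ) (Ioo a b) := by
  rw [contDiffOn_infty_iff_deriv_of_isOpen isOpen_Ioo]
  refine ⟨fun t ht => (h.hasDerivAt_rhoDiff q ht).differentiableAt.differentiableWithinAt, ?_⟩
  exact ((contDiff_eval q).contDiffOn.div (contDiff_eval p).contDiffOn h.ne_zero).congr
    fun t ht => (h.hasDerivAt_rhoDiff q ht).deriv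

/-- The integrand of `L⁻¹ f` along a characteristic curve. -/
noncomputable def charIntegrand (p q : Polynomial ℝ) (θ : ℝ) (f : ℝ → ℝ → ℂ) (τ y : ℝ) : ℂ :=
  f τ (y + rhoDiff p q θ τ) / ((p.eval τ : ℝ) : ℂ)

theorem IsStrip.smooth_charIntegrand (h : IsStrip p a b θ) (q : Polynomial ℝ)
    (hf : SmoothOnStrip a b f) : SmoothOnStrip a b (charIntegrand p q θ f) := by
  have hfst : MapsTo (Prod.fst : ℝ × ℝ → ℝ) (Ioo a b ×ˢ univ) (Ioo a b) := fun z hz => hz.1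
  have hR : ContDiffOn ℝ ∞ (fun z : ℝ × ℝ => rhoDiff p q θ z.1) (Ioo a b ×ˢ univ) :=
    (h.contDiffOn_rhoDiff q).comp contDiff_fst.contDiffOn hfst
  have h1 : ContDiffOn ℝ ∞ (fun z : ℝ × ℝ => f z.1 (z.2 + rhoDiff p q θ z.1)) (Ioo a b ×ˢ univ) :=
    ContDiffOn.comp (g := fun z : ℝ × ℝ => f z.1 z.2)
      (f := fun z : ℝ × ℝ => (z.1, z.2 + rhoDiff p q θ z.1)) hf
      (contDiff_fst.contDiffOn.prodMk (contDiff_snd.contDiffOn.add hR))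
      fun z hz => ⟨hz.1, mem_univ _⟩
  have h2 : ContDiffOn ℝ ∞ (fun z : ℝ × ℝ => ((p.eval z.1 : ℝ) : ℂ)⁻¹) (Ioo a b ×ˢ univ) :=
    ((contDiff_ofReal_eval p).contDiffOn.comp contDiff_fst.contDiffOn hfst).inv
      fun z hz => h.ofReal_ne_zero hz.1
  simp only [SmoothOnStrip, charIntegrand, div_eq_mul_inv]
  exact h1.mul h2

/-- In the coordinate `y = x - ρ(t)`, which is constant along characteristics, the integrand no
longer depends on `t`. The operator is then a primitive in time with parameter `y`, and its
smoothness and derivatives come from the general results on such primitives. -/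
theorem IsStrip.stripInv_eq (h : IsStrip p a b θ) (q : Polynomial ℝ) (f : ℝ → ℝ → ℂ) {t : ℝ}
    (ht : t ∈ Ioo a b) (x : ℝ) : stripInv p q θ f t x =
      ∫ τ in θ..t, charIntegrand p q θ f τ (x - rhoDiff p q θ t) := by
  apply intervalIntegral.integral_congr
  intro τ hτ
  have hτ' := (convex_Ioo a b).ordConnected.uIcc_subset h.mem ht hτ
  simp only [charIntegrand, h.rhoDiff_eq q ht hτ']
  congr 2
  ring

theorem IsStrip.smooth_stripInv (h : IsStrip p a b θ) (q : Polynomial ℝ)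
    (hf : SmoothOnStrip a b f) : SmoothOnStrip a b (stripInv p q θ f) := by
  have hR : ContDiffOn ℝ ∞ (fun z : ℝ × ℝ => rhoDiff p q θ z.1) (Ioo a b ×ˢ univ) :=
    (h.contDiffOn_rhoDiff q).comp contDiff_fst.contDiffOn fun z hz => hz.1
  have h1 := (h.smooth_charIntegrand q hf).parametric_primitive h.mem
  refine (ContDiffOn.comp (g := fun z : ℝ × ℝ => ∫ τ in θ..z.1, charIntegrand p q θ f τ z.2)
      (f := fun z : ℝ × ℝ => (z.1, z.2 - rhoDiff p q θ z.1)) h1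
      (contDiff_fst.contDiffOn.prodMk (contDiff_snd.contDiffOn.sub hR))
      fun z hz => ⟨hz.1, mem_univ _⟩).congr fun z hz => h.stripInv_eq q f hz.1 z.2

theorem IsStrip.hasDerivAt_charIntegrand (q : Polynomial ℝ)
    (hf : SmoothOnStrip a b f) {τ : ℝ} (hτ : τ ∈ Ioo a b) (y : ℝ) :
    HasDerivAt (charIntegrand p q θ f τ) (charIntegrand p q θ (fun t x => deriv (f t) x) τ y) y := by
  have h1 := (hf.hasDerivAt_right hτ (y + rhoDiff p q θ τ)).differentiableAt.hasDerivAt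
  exact (h1.comp_add_const y _).div_const _

theorem IsStrip.hasDerivAt_stripInv_right (h : IsStrip p a b θ) (q : Polynomial ℝ)
    (hf : SmoothOnStrip a b f) {t : ℝ} (ht : t ∈ Ioo a b) (x : ℝ) :
    HasDerivAt (stripInv p q θ f t) (stripInv p q θ (fun t x => deriv (f t) x) t x) x := by
  have h1 := hasDerivAt_parametric_primitive_right h.mem (h.smooth_charIntegrand q hf).continuousOn
    (h.smooth_charIntegrand q hf.deriv_right).continuousOn
    (fun τ hτ y => hasDerivAt_charIntegrand q hf hτ y) ht (x - rhoDiff p q θ t)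
  rw [h.stripInv_eq q _ ht]
  exact (h1.comp_sub_const x _).congr_of_eventuallyEq
    (Eventually.of_forall fun x => h.stripInv_eq q f ht x)

theorem IsStrip.iteratedDeriv_stripInv (h : IsStrip p a b θ) (q : Polynomial ℝ)
    (hf : SmoothOnStrip a b f) (k : ℕ) {t : ℝ} (ht : t ∈ Ioo a b) :
    iteratedDeriv k (stripInv p q θ f t) =
      stripInv p q θ (fun t x => iteratedDeriv k (f t) x) t := by
  induction k with
  | zero => simp
  | succ k ih =>
    ext x
    rw [iteratedDeriv_succ, ih, (h.hasDerivAt_stripInv_right q (hf.iteratedDeriv_right k) ht x).deriv]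
    simp only [iteratedDeriv_succ]

/-- `p ∂_t u + q ∂_x u = f` for `u = L⁻¹ f`. -/
theorem IsStrip.hasDerivAt_stripInv_left (h : IsStrip p a b θ) (q : Polynomial ℝ)
    (hf : SmoothOnStrip a b f) {t : ℝ} (ht : t ∈ Ioo a b) (x : ℝ) :
    HasDerivAt (fun s => stripInv p q θ f s x)
      (((p.eval t : ℝ) : ℂ)⁻¹ * f t x - ((q.eval t : ℝ) : ℂ) / ((p.eval t : ℝ) : ℂ) *
        stripInv p q θ (fun t x => deriv (f t) x) t x) t := by
  have h1 := hasDerivAt_parametric_primitive_comp h.mem (h.smooth_charIntegrand q hf).continuousOn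
    (h.smooth_charIntegrand q hf.deriv_right).continuousOn
    (fun τ hτ y => hasDerivAt_charIntegrand q hf hτ y) ht
    (y := fun s => x - rhoDiff p q θ s) ((h.hasDerivAt_rhoDiff q ht).const_sub x)
  rw [h.stripInv_eq q _ ht]
  refine HasDerivAt.congr_of_eventuallyEq (h1.congr_deriv ?_) ?_
  · simp only [charIntegrand, sub_add_cancel, neg_smul, Complex.real_smul]
    push_cast
    ring
  · filter_upwards [isOpen_Ioo.mem_nhds ht] with s hs using h.stripInv_eq q f hs x

/-- Growth uses `|x + y| ≤ |x| + |y|` and decay uses `|x| ≤ |x + y| + |y|`. Both lose the same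
factor, so the two cases can be treated together. -/
theorem exp_mul_abs_add_le {ε r : ℝ} (hε : 0 ≤ ε) (hr : r = ε ∨ r = -ε) (x y : ℝ) :
    Real.exp (r * |x + y|) ≤ Real.exp (r * |x|) * Real.exp (ε * |y|) := by
  rw [← Real.exp_add]
  apply Real.exp_le_exp.2
  have h1 := abs_add_le x y
  have h2 : |x| ≤ |x + y| + |y| := by simpa using abs_sub (x + y) y
  rcases hr with rfl | rfl <;> nlinarith

theorem IsStrip.exists_norm_stripInv_le (h : IsStrip p a b θ) (q : Polynomial ℝ) {ε r : ℝ}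
    (hε : 0 < ε) (hεc : ε < min |logCoeff p q a|⁻¹ |logCoeff p q b|⁻¹) (hr : r = ε ∨ r = -ε) :
    ∃ ν D : ℝ, 0 < ν ∧ ν < 1 ∧ 0 ≤ D ∧ ∀ (f : ℝ → ℝ → ℂ) (C : ℝ),
      (∀ t ∈ Ioo a b, ∀ x : ℝ, ‖f t x‖ ≤ C * Real.exp (r * |x|)) →
      ∀ t ∈ Ioo a b, ∀ x : ℝ,
        ‖stripInv p q θ f t x‖ ≤ C * D * (endWeight a b ν t)⁻¹ * Real.exp (r * |x|) := by
  rw [lt_min_iff] at hεc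
  have hlt : ∀ c : ℝ, ε < |c|⁻¹ → ε * |c| < 1 := fun c hc => by
    rcases eq_or_ne c 0 with rfl | hc0
    · simp
    · have := abs_pos.2 hc0
      calc ε * |c| < |c|⁻¹ * |c| := by gcongr
        _ = 1 := inv_mul_cancel₀ this.ne'
  -- The exponent lies above `ε|c|` at both ends, as the kernel estimate requires, and below `1`, so
  -- that the inverse weight is integrable in time.
  obtain ⟨ν, h1, hν1⟩ := exists_between (max_lt (hlt _ hεc.1) (hlt _ hεc.2))
  rw [max_lt_iff] at h1
  have hν0 : 0 < ν := lt_of_le_of_lt (by positivity) h1.1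
  obtain ⟨C₀, hC₀, h2⟩ := h.exists_abs_integral_exp_le q hε.le hν0 h1.1 h1.2
  have hab : 0 < b - a := by linarith [h.mem.1, h.mem.2]
  set D₀ := (b - a) ^ ν * (b - a) ^ ν
  have hD₀ : 0 ≤ D₀ := by positivity
  refine ⟨ν, D₀ * C₀, hν0, hν1, by positivity, fun f C hf t ht x => ?_⟩
  have hC : 0 ≤ C := by
    have := (norm_nonneg _).trans (hf θ h.mem 0)
    simpa using this
  refine (h.norm_integral_le q (M := C * Real.exp (r * |x|) * D₀) (h2 t ht) ht (by positivity)
    fun τ hτ => ?_).trans (le_of_eq (by ring))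
  rw [norm_div, Complex.norm_real, Real.norm_eq_abs]
  have hw := endWeight_pos ν hτ
  -- Data bounded up to the ends are regarded as data of size `1/w`, at the price of the factor
  -- `D₀`.
  have h3 : 1 ≤ D₀ * (endWeight a b ν τ)⁻¹ := by
    rw [← div_eq_mul_inv, one_le_div hw]
    exact endWeight_le hν0.le (Ioo_subset_Icc_self hτ)
  calc _ ≤ C * (Real.exp (r * |x|) * Real.exp (ε * |rhoDiff p q t τ|)) / |p.eval τ| := by
        gcongr
        exact (hf τ hτ _).trans (by gcongr; exact exp_mul_abs_add_le hε.le hr _ _)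
    _ ≤ C * (Real.exp (r * |x|) * Real.exp (ε * |rhoDiff p q t τ|)) / |p.eval τ| *
        (D₀ * (endWeight a b ν τ)⁻¹) := le_mul_of_one_le_right (by positivity) h3
    _ = _ := by ring

theorem exists_norm_iteratedDeriv_le {A : ℝ → ℂ} (hA : ContDiffOn ℝ ∞ A (Ioo a b))
    {K : Set ℝ} (hK : IsCompact K) (hKab : K ⊆ Ioo a b) (i : ℕ) :
    ∃ C : ℝ, ∀ t ∈ K, ‖iteratedDeriv i A t‖ ≤ C := by
  have h1 : ContinuousOn (iteratedDeriv i A) (Ioo a b) :=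
    (hA.continuousOn_iteratedDerivWithin (m := i) (by exact_mod_cast le_top)
      isOpen_Ioo.uniqueDiffOn).congr fun t ht => (iteratedDerivWithin_of_isOpen isOpen_Ioo ht).symm
  exact hK.exists_bound_of_continuousOn (h1.mono hKab)

theorem exists_norm_iteratedDeriv_mul_le {A : ℝ → ℂ} (hA : ContDiffOn ℝ ∞ A (Ioo a b))
    {G : ℝ → ℝ → ℂ} (hG : ∀ x, ContDiffOn ℝ ∞ (fun s => G s x) (Ioo a b))
    {K : Set ℝ} (hK : IsCompact K) (hKab : K ⊆ Ioo a b) {e : ℝ → ℝ} {m : ℕ}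
    (hGb : ∀ i ≤ m, ∃ C, ∀ t ∈ K, ∀ x, ‖iteratedDeriv i (fun s => G s x) t‖ ≤ C * e x) :
    ∃ C, ∀ t ∈ K, ∀ x, ‖iteratedDeriv m (fun s => A s * G s x) t‖ ≤ C * e x := by
  choose CA hCA using fun i => exists_norm_iteratedDeriv_le hA hK hKab i
  choose! CG hCG using hGb
  refine ⟨∑ i ∈ Finset.range (m + 1), m.choose i * CA i * CG (m - i), fun t ht x => ?_⟩
  have ht' := isOpen_Ioo.mem_nhds (hKab ht)
  have hm : ∀ {g : ℝ → ℂ}, ContDiffOn ℝ ∞ g (Ioo a b) → ContDiffAt ℝ m g t := fun hg =>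
    (hg.contDiffAt ht').of_le (by exact_mod_cast le_top)
  have := iteratedDeriv_mul (hm hA) (hm (hG x))
  rw [show (fun s => A s * G s x) = A * fun s => G s x from rfl, this, Finset.sum_mul]
  refine (norm_sum_le _ _).trans (Finset.sum_le_sum fun i hi => ?_)
  have hCA0 := (norm_nonneg _).trans (hCA i t ht)
  rw [norm_mul, norm_mul, mul_assoc, mul_assoc, mul_assoc]
  have := hCG (m - i) (Nat.sub_le _ _) t ht x
  have h2 := hCA i t ht
  simp only [Complex.norm_natCast]
  gcongr

/-- Right-hand sides of exponential growth or decay. -/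
theorem IsStrip.exponential (h : IsStrip p a b θ) (q : Polynomial ℝ) {ε r : ℝ}
    (hε : 0 < ε) (hεc : ε < min |logCoeff p q a|⁻¹ |logCoeff p q b|⁻¹) (hr : r = ε ∨ r = -ε)
    (hf : SmoothExpClosed a b r f) :
    IntegrableExp a b r (stripInv p q θ f) ∧ SmoothExpOpen a b r (stripInv p q θ f) ∧
      ∀ s ∈ Ioo a b, ∀ x : ℝ, ((p.eval s : ℝ) : ℂ) * pderiv 1 0 (stripInv p q θ f) s x +
        ((q.eval s : ℝ) : ℂ) * pderiv 0 1 (stripInv p q θ f) s x = f s x := by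
  obtain ⟨hs, hb⟩ := hf
  obtain ⟨ν, D, hν0, hν1, hD, hbd⟩ := h.exists_norm_stripInv_le q hε hεc hr
  set fk : ℕ → ℝ → ℝ → ℂ := fun k t x => iteratedDeriv k (f t) x with hfk
  have hsk : ∀ k, SmoothOnStrip a b (fk k) := fun k => hs.iteratedDeriv_right k
  set U : ℕ → ℝ → ℝ → ℂ := fun k => stripInv p q θ (fk k) with hU
  have hUs : ∀ k, SmoothOnStrip a b (U k) := fun k => h.smooth_stripInv q (hsk k)
  have hUk : ∀ k, ∀ t ∈ Ioo a b, ∀ x, iteratedDeriv k (stripInv p q θ f t) x = U k t x :=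
    fun k t ht x => by rw [h.iteratedDeriv_stripInv q hs k ht]
  choose C hC using fun k => hb 0 k
  simp only [pderiv, iteratedDeriv_zero] at hC
  have hUb : ∀ k, ∀ t ∈ Ioo a b, ∀ x,
      ‖U k t x‖ ≤ C k * D * (endWeight a b ν t)⁻¹ * Real.exp (r * |x|) :=
    fun k => hbd (fk k) (C k) (hC k)
  have hC0 : ∀ k, 0 ≤ C k := fun k => by
    simpa using (norm_nonneg _).trans (hC k θ h.mem 0)
  refine ⟨fun k => ?_, ⟨h.smooth_stripInv q hs, fun K hK hKab m k => ?_⟩, fun s hs' x => ?_⟩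
  · have hfin : ∫⁻ t in Ioo a b, ENNReal.ofReal (C k * D) * ENNReal.ofReal (endWeight a b ν t)⁻¹ < ⊤ := by
      rw [lintegral_const_mul' _ _ ENNReal.ofReal_ne_top]
      exact ENNReal.mul_lt_top ENNReal.ofReal_lt_top (lintegral_inv_endWeight_lt_top hν0 hν1)
    refine lt_of_le_of_lt (setLIntegral_mono_ae' measurableSet_Ioo
      (Eventually.of_forall fun t ht => iSup_le fun x => ?_)) hfin
    rw [← ENNReal.ofReal_mul (mul_nonneg (hC0 k) hD)]
    apply ENNReal.ofReal_le_ofReal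
    simp only [pderiv, iteratedDeriv_zero]
    rw [hUk k t ht]
    calc _ ≤ Real.exp (-(r * |x|)) * (C k * D * (endWeight a b ν t)⁻¹ * Real.exp (r * |x|)) := by
          gcongr; exact hUb k t ht x
      _ = C k * D * (endWeight a b ν t)⁻¹ * (Real.exp (-(r * |x|)) * Real.exp (r * |x|)) := by ring
      _ = _ := by rw [← Real.exp_add]; simp
  -- The equation reads `∂_t U_k = f_k/p - (q/p) U_{k+1}`. By Leibniz' rule, `m + 1` time
  -- derivatives of `U_k` involve at most `m` of `U_{k+1}`, whence the strong induction on `m` with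
  -- `k` free.
  · have key : ∀ m, ∀ k, ∃ C, ∀ t ∈ K, ∀ x,
        ‖iteratedDeriv m (fun s => U k s x) t‖ ≤ C * Real.exp (r * |x|) := by
      intro m
      induction m using Nat.strong_induction_on with
      | _ m ih =>
        intro k
        rcases m with _ | m
        · have hcw : ContinuousOn (fun t => (endWeight a b ν t)⁻¹) K :=
            ((continuousOn_endWeight a b ν).mono hKab).inv₀ fun t ht => (endWeight_pos ν (hKab ht)).ne'
          obtain ⟨B, hB⟩ := hK.exists_bound_of_continuousOn hcw
          refine ⟨C k * D * B, fun t ht x => ?_⟩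
          simp only [iteratedDeriv_zero]
          refine (hUb k t (hKab ht) x).trans ?_
          have := (le_abs_self _).trans (hB t ht)
          have := mul_nonneg (hC0 k) hD
          gcongr
        · have hp : ContDiffOn ℝ ∞ (fun s : ℝ => ((p.eval s : ℝ) : ℂ)⁻¹) (Ioo a b) :=
            (contDiff_ofReal_eval p).contDiffOn.inv fun s hs => h.ofReal_ne_zero hs
          have hqp : ContDiffOn ℝ ∞ (fun s : ℝ => ((q.eval s : ℝ) : ℂ) / ((p.eval s : ℝ) : ℂ))
              (Ioo a b) := by
            simp only [div_eq_mul_inv]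
            exact (contDiff_ofReal_eval q).contDiffOn.mul hp
          obtain ⟨C₁, hC₁⟩ := exists_norm_iteratedDeriv_mul_le hp (G := fk k)
            (fun x => (hsk k).contDiffOn_left x) hK hKab (e := fun x => Real.exp (r * |x|)) (m := m)
            fun i _ => by
              obtain ⟨B, hB⟩ := hb i k
              exact ⟨B, fun t ht x => hB t (hKab ht) x⟩
          obtain ⟨C₂, hC₂⟩ := exists_norm_iteratedDeriv_mul_le hqp (G := U (k + 1))
            (fun x => (hUs (k + 1)).contDiffOn_left x) hK hKab (e := fun x => Real.exp (r * |x|))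
            (m := m) fun i hi => ih i (Nat.lt_succ_of_le hi) (k + 1)
          refine ⟨C₁ + C₂, fun t ht x => ?_⟩
          have heq : deriv (fun s => U k s x) =ᶠ[𝓝 t] fun s => ((p.eval s : ℝ) : ℂ)⁻¹ * fk k s x -
              ((q.eval s : ℝ) : ℂ) / ((p.eval s : ℝ) : ℂ) * U (k + 1) s x := by
            filter_upwards [isOpen_Ioo.mem_nhds (hKab ht)] with s hs
            rw [(h.hasDerivAt_stripInv_left q (hsk k) hs x).deriv]
            simp only [hU, hfk, iteratedDeriv_succ]
          have hm : ∀ {g : ℝ → ℂ}, ContDiffOn ℝ ∞ g (Ioo a b) → ContDiffAt ℝ m g t := fun hg =>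
            (hg.contDiffAt (isOpen_Ioo.mem_nhds (hKab ht))).of_le (by exact_mod_cast le_top)
          rw [iteratedDeriv_succ', heq.iteratedDeriv_eq, iteratedDeriv_fun_sub
            (hm (hp.mul ((hsk k).contDiffOn_left x))) (hm (hqp.mul ((hUs (k + 1)).contDiffOn_left x))),
            add_mul]
          exact (norm_sub_le _ _).trans (add_le_add (hC₁ t ht x) (hC₂ t ht x))
    obtain ⟨B, hB⟩ := key m k
    refine ⟨B, fun t ht x => ?_⟩
    have heq : (fun s => iteratedDeriv k (stripInv p q θ f s) x) =ᶠ[𝓝 t] fun s => U k s x := by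
      filter_upwards [isOpen_Ioo.mem_nhds (hKab ht)] with s hs using hUk k s hs x
    rw [pderiv, heq.iteratedDeriv_eq]
    exact hB t ht x
  · simp only [pderiv, iteratedDeriv_zero, iteratedDeriv_one]
    rw [(h.hasDerivAt_stripInv_left q hs hs' x).deriv, (h.hasDerivAt_stripInv_right q hs hs' x).deriv]
    have := h.ofReal_ne_zero hs'
    field_simp
    ring

end Strip

/-! ### Logarithmic asymptotics of the characteristic moments -/

namespace Strip

/-- The characteristic moment `∫_θ^t F(τ) (ρ(τ) - ρ(t))^n / p(τ) dτ`. -/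
noncomputable def charMoment (p q : Polynomial ℝ) (θ : ℝ) (n : ℕ) (F : ℝ → ℂ) (t : ℝ) : ℂ :=
  ∫ τ in θ..t, F τ * ((rhoDiff p q t τ : ℝ) : ℂ) ^ n / ((p.eval τ : ℝ) : ℂ)

/-- The leading coefficient of the `n`-th characteristic moment at an end `e`. -/
noncomputable def momentCoeff (p q : Polynomial ℝ) (e : ℝ) (n : ℕ) : ℝ :=
  -(logCoeff p q e ^ n / (p.derivative.eval e * (n + 1)))

theorem tendsto_log_one_div_abs_sub (a : ℝ) :
    Tendsto (fun t => Real.log (1 / |t - a|)) (𝓝[>] a) atTop := by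
  refine Real.tendsto_log_atTop.comp ?_
  simp only [one_div]
  refine tendsto_inv_nhdsGT_zero.comp (tendsto_nhdsWithin_iff.2 ⟨?_, ?_⟩)
  · have : Tendsto (fun t : ℝ => |t - a|) (𝓝 a) (𝓝 |a - a|) :=
      Continuous.tendsto (by fun_prop) a
    simp only [sub_self, abs_zero] at this
    exact this.mono_left nhdsWithin_le_nhds
  · filter_upwards [self_mem_nhdsWithin] with t ht
    exact abs_pos.2 (sub_ne_zero.2 (ne_of_gt (mem_Ioi.1 ht)))

theorem log_one_div_abs_sub {a t : ℝ} (ht : a < t) :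
    Real.log (1 / |t - a|) = -Real.log (t - a) := by
  rw [abs_of_pos (sub_pos.2 ht), one_div, Real.log_inv]

/-- Close to `a` the factor `e` is at most `η/2`, so that stretch contributes at most `η/2` times
the logarithm plus a constant, and the rest of the integral does not depend on `t`. This is where
continuity of the coefficients up to the end is used. -/
theorem tendsto_integral_div_log {a θ : ℝ} (hθ : a < θ) {e : ℝ → ℝ} (he : ContinuousOn e (Icc a θ))
    (he0 : e a = 0) (hnn : ∀ s, 0 ≤ e s) :
    Tendsto (fun t => (∫ τ in t..θ, e τ * (τ - a)⁻¹) / Real.log (1 / |t - a|)) (𝓝[>] a) (𝓝 0) := by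
  have hΛ := tendsto_log_one_div_abs_sub a
  have hI : ∀ s ∈ Ioc a θ, ∀ s' ∈ Ioc a θ, IntervalIntegrable (fun τ => e τ * (τ - a)⁻¹) volume s s' := by
    intro s hs s' hs'
    have hsub : uIcc s s' ⊆ Ioc a θ := (convex_Ioc a θ).ordConnected.uIcc_subset hs hs'
    exact ContinuousOn.intervalIntegrable ((he.mono (hsub.trans Ioc_subset_Icc_self)).mul
      ((continuousOn_id.sub continuousOn_const).inv₀ fun τ hτ => (sub_pos.2 (hsub hτ).1).ne'))
  rw [Metric.tendsto_nhds]
  intro η hη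
  have h1 : ∀ᶠ s in 𝓝[>] a, s ∈ Ioc a θ ∧ ∀ τ ∈ Ioc a s, e τ ≤ η / 2 := by
    have hc := he a ⟨le_rfl, hθ.le⟩
    have hc' : ∀ᶠ τ in 𝓝[Icc a θ] a, e τ < η / 2 := hc.eventually_lt_const (by rw [he0]; positivity)
    rw [eventually_nhdsWithin_iff, Metric.eventually_nhds_iff] at hc'
    obtain ⟨r, hr, hr'⟩ := hc'
    have : Ioo a (a + min r (θ - a)) ∈ 𝓝[>] a := Ioo_mem_nhdsGT (by
      have : 0 < min r (θ - a) := lt_min hr (sub_pos.2 hθ)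
      linarith)
    filter_upwards [this] with s hs
    have h2 := min_le_left r (θ - a)
    have h3 := min_le_right r (θ - a)
    refine ⟨⟨hs.1, by linarith [hs.2]⟩, fun τ hτ => (hr' ?_ ⟨hτ.1.le, ?_⟩).le⟩
    · rw [Real.dist_eq, abs_of_pos (sub_pos.2 hτ.1)]; linarith [hτ.2, hs.2]
    · linarith [hτ.2, hs.2]
  obtain ⟨s, hs, hes⟩ := h1.exists
  -- `B` gathers everything independent of `t`; it is negligible once the logarithm exceeds `2B/η`.
  set B := η / 2 * Real.log (s - a) + ∫ τ in s..θ, e τ * (τ - a)⁻¹ with hB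
  have hev : ∀ᶠ t in 𝓝[>] a, t ∈ Ioo a s := Ioo_mem_nhdsGT hs.1
  filter_upwards [hev, hΛ.eventually_gt_atTop 0, hΛ.eventually_gt_atTop (2 * B / η)]
    with t ht hΛ0 hΛB
  have htθ : t ∈ Ioc a θ := ⟨ht.1, ht.2.le.trans hs.2⟩
  have hnn' : 0 ≤ ∫ τ in t..θ, e τ * (τ - a)⁻¹ :=
    intervalIntegral.integral_nonneg htθ.2 fun τ hτ =>
      mul_nonneg (hnn τ) (inv_nonneg.2 (by linarith [hτ.1, ht.1]))
  rw [Real.dist_eq, sub_zero, abs_of_nonneg (div_nonneg hnn' hΛ0.le), div_lt_iff₀ hΛ0]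
  have hle : ∫ τ in t..s, e τ * (τ - a)⁻¹ ≤ η / 2 * (Real.log (s - a) - Real.log (t - a)) := by
    have h2 : ∫ τ in t..s, (τ - a)⁻¹ = Real.log (s - a) - Real.log (t - a) := by
      rw [intervalIntegral.integral_comp_sub_right (fun s => s⁻¹), integral_inv_of_pos
        (sub_pos.2 ht.1) (sub_pos.2 hs.1), Real.log_div (sub_pos.2 hs.1).ne' (sub_pos.2 ht.1).ne']
    rw [← h2, ← intervalIntegral.integral_const_mul]
    refine intervalIntegral.integral_mono_on ht.2.le (hI t htθ s hs) ?_ fun τ hτ => ?_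
    · refine ContinuousOn.intervalIntegrable (continuousOn_const.mul
        ((continuousOn_id.sub continuousOn_const).inv₀ fun τ hτ => ?_))
      rw [uIcc_of_le ht.2.le] at hτ
      exact (sub_pos.2 (ht.1.trans_le hτ.1)).ne'
    · have : 0 < τ - a := sub_pos.2 (ht.1.trans_le hτ.1)
      gcongr
      exact hes τ ⟨ht.1.trans_le hτ.1, hτ.2⟩
  rw [← intervalIntegral.integral_add_adjacent_intervals (hI t htθ s hs) (hI s hs θ ⟨hθ, le_rfl⟩)]
  rw [log_one_div_abs_sub ht.1] at hΛB ⊢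
  rw [div_lt_iff₀ hη] at hΛB
  nlinarith

theorem tendsto_affine_div {F : Filter ℝ} {L r : ℝ → ℝ} {c C : ℝ} (hL : Tendsto L F atTop)
    (hr : ∀ᶠ t in F, |r t - c * L t| ≤ C) : Tendsto (fun t => r t / L t) F (𝓝 c) := by
  have h1 : Tendsto (fun t => C / L t) F (𝓝 0) := hL.const_div_atTop C
  rw [tendsto_iff_norm_sub_tendsto_zero]
  refine squeeze_zero' (Eventually.of_forall fun _ => norm_nonneg _) ?_ h1
  filter_upwards [hr, hL.eventually_gt_atTop 0] with t ht hLt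
  rw [Real.norm_eq_abs, le_div_iff₀ hLt, ← abs_of_pos hLt, ← abs_mul, abs_of_pos hLt, sub_mul,
    div_mul_cancel₀ _ hLt.ne']
  exact ht

theorem IsStrip.tendsto_charMoment_left {p q : Polynomial ℝ} {a b θ : ℝ} (h : IsStrip p a b θ)
    (hq : q.eval a ≠ 0) (n : ℕ) {F : ℝ → ℂ} (hF : ContinuousOn F (Icc a b)) :
    Tendsto (fun t => charMoment p q θ n F t / ((Real.log (1 / |t - a|) ^ (n + 1) : ℝ) : ℂ))
      (𝓝[>] a) (𝓝 (F a * momentCoeff p q a n)) := by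
  set L : ℝ → ℝ := fun t => Real.log (1 / |t - a|) with hLdef
  have hL : Tendsto L (𝓝[>] a) atTop := tendsto_log_one_div_abs_sub a
  set c := logCoeff p q a with hc
  obtain ⟨C₁, hC₁, h1⟩ := h.leftEnd.exists_inv_le
  obtain ⟨C₂, hC₂, h2⟩ := h.leftEnd.exists_abs_rhoDiff_sub_le q
  have hθ := h.mem.1
  have hev : ∀ᶠ t in 𝓝[>] a, t ∈ Ioo a θ := Ioo_mem_nhdsGT hθ
  -- Subtracting `F(a) q/q(a)` rather than the constant `F(a)` still leaves a remainder that
  -- vanishes at `a`, while the subtracted part integrates exactly: `(ρ(τ) - ρ(t))^n q/p` is the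
  -- `τ`-derivative of `(ρ(τ) - ρ(t))^(n+1)/(n+1)`. The division requires `q(a) ≠ 0`.
  set E : ℝ → ℂ := fun τ => F τ - F a * ((q.eval τ / q.eval a : ℝ) : ℂ) with hE
  have hEc : ContinuousOn E (Icc a b) := by
    refine hF.sub (continuousOn_const.mul (Complex.continuous_ofReal.comp_continuousOn ?_))
    exact q.continuous.continuousOn.div_const _
  have hEa : E a = 0 := by simp [hE, hq]
  have hIt := tendsto_integral_div_log hθ (e := fun τ => ‖E τ‖)
    (hEc.norm.mono (Icc_subset_Icc_right h.mem.2.le)) (by simp [hEa]) fun _ => norm_nonneg _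
  have hsubs : ∀ t ∈ Ioo a θ, uIcc θ t ⊆ Ioo a b := fun t ht =>
    (convex_Ioo a b).ordConnected.uIcc_subset h.mem ⟨ht.1, ht.2.trans h.mem.2⟩
  -- the main term
  have hmain : ∀ t ∈ Ioo a θ, ∫ τ in θ..t, rhoDiff p q t τ ^ n * (q.eval τ / p.eval τ) =
      -(rhoDiff p q t θ ^ (n + 1) / (n + 1)) := by
    intro t ht
    have htb : t ∈ Ioo a b := ⟨ht.1, ht.2.trans h.mem.2⟩
    have hd : ∀ τ ∈ uIcc θ t, HasDerivAt (fun τ => rhoDiff p q t τ ^ (n + 1) / ((n : ℝ) + 1))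
        (rhoDiff p q t τ ^ n * (q.eval τ / p.eval τ)) τ := by
      intro τ hτ
      have hτ' := hsubs t ht hτ
      have h3 : HasDerivAt (rhoDiff p q t) (q.eval τ / p.eval τ) τ := by
        refine ((h.hasDerivAt_rhoDiff q hτ').sub_const (rhoDiff p q θ t)).congr_of_eventuallyEq ?_
        filter_upwards [isOpen_Ioo.mem_nhds hτ'] with s hs using h.rhoDiff_eq q htb hs
      have hn : ((n : ℝ) + 1) ≠ 0 := by positivity
      refine ((h3.pow (n + 1)).div_const ((n : ℝ) + 1)).congr_deriv ?_
      rw [Nat.add_sub_cancel]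
      push_cast
      field_simp
    rw [intervalIntegral.integral_eq_sub_of_hasDerivAt hd]
    · have : rhoDiff p q t t = 0 := by simp [rhoDiff]
      simp [this]
    · refine h.intervalIntegrable_of_continuousOn ?_ htb
      exact ((h.continuousOn_rhoDiff_right q htb).pow n).mul (h.continuousOn_div q)
  have hrho : Tendsto (fun t => rhoDiff p q t θ / L t) (𝓝[>] a) (𝓝 c) := by
    refine tendsto_affine_div (C := C₂ + |c| * |Real.log (θ - a)|) hL ?_
    filter_upwards [hev] with t ht
    have h3 := h2 t ⟨ht.1, ht.2.le⟩ θ ⟨hθ, le_rfl⟩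
    simp only [hLdef, log_one_div_abs_sub ht.1]
    calc _ = |(rhoDiff p q t θ - c * (Real.log (θ - a) - Real.log (t - a))) +
          c * Real.log (θ - a)| := by ring_nf
      _ ≤ _ := (abs_add_le _ _).trans (by rw [abs_mul]; gcongr)
  -- the error term
  set err : ℝ → ℂ := fun t =>
    ∫ τ in θ..t, E τ * ((rhoDiff p q t τ : ℝ) : ℂ) ^ n / ((p.eval τ : ℝ) : ℂ) with herr
  set C₃ := C₂ + |c| * |Real.log (θ - a)|
  have herr_le : ∀ t ∈ Ioo a θ, 0 < L t → ‖err t‖ ≤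
      (C₃ + |c| * L t) ^ n * (C₁ * ∫ τ in t..θ, ‖E τ‖ * (τ - a)⁻¹) := by
    intro t ht hLt
    rw [herr]
    simp only
    rw [intervalIntegral.integral_symm, norm_neg, ← intervalIntegral.integral_const_mul,
      ← intervalIntegral.integral_const_mul]
    refine intervalIntegral.norm_integral_le_of_norm_le ht.2.le (Eventually.of_forall fun τ hτ => ?_) ?_
    · have hτa : a < τ := ht.1.trans hτ.1
      have h3 := h2 t ⟨ht.1, ht.2.le⟩ τ ⟨hτa, hτ.2⟩
      have h4 : |rhoDiff p q t τ| ≤ C₃ + |c| * L t := by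
        have hl1 : Real.log (t - a) ≤ Real.log (τ - a) :=
          Real.log_le_log (sub_pos.2 ht.1) (by linarith [hτ.1])
        have hl2 : Real.log (τ - a) ≤ |Real.log (θ - a)| :=
          (Real.log_le_log (sub_pos.2 hτa) (by linarith [hτ.2])).trans (le_abs_self _)
        simp only [hLdef, log_one_div_abs_sub ht.1]
        calc _ = |(rhoDiff p q t τ - c * (Real.log (τ - a) - Real.log (t - a))) +
              c * (Real.log (τ - a) - Real.log (t - a))| := by ring_nf
          _ ≤ C₂ + |c| * (|Real.log (θ - a)| - Real.log (t - a)) :=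
              (abs_add_le _ _).trans (by
                rw [abs_mul, abs_of_nonneg (sub_nonneg.2 hl1)]; gcongr)
          _ = _ := by ring
      rw [norm_div, norm_mul, norm_pow, Complex.norm_real, Complex.norm_real, Real.norm_eq_abs,
        Real.norm_eq_abs, div_eq_mul_inv]
      calc _ ≤ ‖E τ‖ * (C₃ + |c| * L t) ^ n * (C₁ * (τ - a)⁻¹) := by
            gcongr
            exact h1 τ ⟨hτa, hτ.2⟩
        _ = _ := by ring
    · refine ContinuousOn.intervalIntegrable (continuousOn_const.mul (continuousOn_const.mul
        (ContinuousOn.mul ?_ ((continuousOn_id.sub continuousOn_const).inv₀ fun τ hτ => ?_))))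
      · refine hEc.norm.mono ?_
        rw [uIcc_of_le ht.2.le]
        exact Icc_subset_Icc ht.1.le h.mem.2.le
      · rw [uIcc_of_le ht.2.le] at hτ
        exact (sub_pos.2 (ht.1.trans_le hτ.1)).ne'
  have herr0 : Tendsto (fun t => err t / ((L t ^ (n + 1) : ℝ) : ℂ)) (𝓝[>] a) (𝓝 0) := by
    have hA : Tendsto (fun t => (C₃ + |c| * L t) / L t) (𝓝[>] a) (𝓝 |c|) :=
      tendsto_affine_div (C := |C₃|) hL (Eventually.of_forall fun t => by simp)
    have hB := (hA.pow n).mul (hIt.const_mul C₁)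
    simp only [mul_zero] at hB
    refine squeeze_zero_norm' ?_ hB
    filter_upwards [hev, hL.eventually_gt_atTop 0] with t ht hLt
    rw [norm_div, Complex.norm_real, Real.norm_eq_abs, abs_of_pos (pow_pos hLt _),
      div_le_iff₀ (pow_pos hLt _)]
    refine (herr_le t ht hLt).trans (le_of_eq ?_)
    change _ = ((C₃ + |c| * L t) / L t) ^ n * (C₁ * (_ / L t)) * L t ^ (n + 1)
    rw [div_pow, pow_succ]
    field_simp
  have hmain0 : Tendsto (fun t => ((-(F a / q.eval a) / (n + 1) : ℂ)) *
      (((rhoDiff p q t θ / L t) ^ (n + 1) : ℝ) : ℂ)) (𝓝[>] a)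
      (𝓝 (-(F a / q.eval a) / (n + 1) * ((c ^ (n + 1) : ℝ) : ℂ))) :=
    ((Complex.continuous_ofReal.tendsto _).comp (hrho.pow (n + 1))).const_mul _
  have hsum := hmain0.add herr0
  have hval : -(F a / q.eval a) / (n + 1) * ((c ^ (n + 1) : ℝ) : ℂ) + 0 =
      F a * momentCoeff p q a n := by
    have hq' : ((q.eval a : ℝ) : ℂ) ≠ 0 := by exact_mod_cast hq
    have hp' : ((p.derivative.eval a : ℝ) : ℂ) ≠ 0 := by exact_mod_cast h.simple_left
    have hn : ((n : ℂ) + 1) ≠ 0 := by exact_mod_cast Nat.succ_ne_zero n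
    have hcq : (c : ℂ) = ((q.eval a : ℝ) : ℂ) / ((p.derivative.eval a : ℝ) : ℂ) := by
      rw [hc, logCoeff]; push_cast; rfl
    rw [momentCoeff, ← hc]
    push_cast
    rw [pow_succ]
    -- One of the `n + 1` factors `c` is written as `q(a)/p'(a)` in order to cancel `q(a)`.
    nth_rewrite 2 [hcq]
    field_simp
    ring
  rw [hval] at hsum
  refine hsum.congr' ?_
  filter_upwards [hev, hL.eventually_gt_atTop 0] with t ht hLt
  have htb : t ∈ Ioo a b := ⟨ht.1, ht.2.trans h.mem.2⟩
  have hrc : ContinuousOn (fun τ => ((rhoDiff p q t τ : ℝ) : ℂ) ^ n) (Ioo a b) :=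
    (Complex.continuous_ofReal.comp_continuousOn (h.continuousOn_rhoDiff_right q htb)).pow n
  have hpc : ContinuousOn (fun τ => ((p.eval τ : ℝ) : ℂ)⁻¹) (Ioo a b) :=
    (Complex.continuous_ofReal.comp p.continuous).continuousOn.inv₀ fun s hs => h.ofReal_ne_zero hs
  have hsplit : charMoment p q θ n F t = (F a / q.eval a) *
      ((∫ τ in θ..t, rhoDiff p q t τ ^ n * (q.eval τ / p.eval τ) : ℝ) : ℂ) + err t := by
    rw [← intervalIntegral.integral_ofReal, ← intervalIntegral.integral_const_mul, herr]
    simp only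
    rw [← intervalIntegral.integral_add]
    · apply intervalIntegral.integral_congr
      intro τ hτ
      have hq' : ((q.eval a : ℝ) : ℂ) ≠ 0 := by exact_mod_cast hq
      have := h.ofReal_ne_zero (hsubs t ht hτ)
      simp only [hE]
      push_cast
      field_simp
      ring
    · refine h.intervalIntegrable_of_continuousOn (continuousOn_const.mul
        (Complex.continuous_ofReal.comp_continuousOn ?_)) htb
      exact ((h.continuousOn_rhoDiff_right q htb).pow n).mul (h.continuousOn_div q)
    · refine h.intervalIntegrable_of_continuousOn ?_ htb
      simp only [div_eq_mul_inv]
      exact ((hEc.mono Ioo_subset_Icc_self).mul hrc).mul hpc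
  have hL0 : ((L t : ℝ) : ℂ) ≠ 0 := by exact_mod_cast hLt.ne'
  have hn : ((n : ℂ) + 1) ≠ 0 := by exact_mod_cast Nat.succ_ne_zero n
  rw [hsplit, hmain t ht, add_div]
  congr 1
  change _ = _ / (((L t) ^ (n + 1) : ℝ) : ℂ)
  push_cast
  rw [div_pow]
  field_simp

theorem IsStrip.charMoment_reflect {p : Polynomial ℝ} (q : Polynomial ℝ) (θ : ℝ)
    (n : ℕ) (F : ℝ → ℂ) (t : ℝ) :
    charMoment p q θ n F t = -(-1) ^ n * charMoment (p.comp (-Polynomial.X))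
      (q.comp (-Polynomial.X)) (-θ) n (fun s => F (-s)) (-t) := by
  unfold charMoment
  have := intervalIntegral.integral_comp_neg (a := -θ) (b := -t)
    (fun τ => F τ * ((rhoDiff p q t τ : ℝ) : ℂ) ^ n / ((p.eval τ : ℝ) : ℂ))
  rw [neg_neg, neg_neg] at this
  rw [intervalIntegral.integral_symm, ← this, neg_mul, ← intervalIntegral.integral_const_mul]
  congr 2
  ext s
  have e := rhoDiff_reflect p q t (-s)
  rw [neg_neg] at e
  rw [e]
  simp only [Polynomial.eval_comp, Polynomial.eval_neg, Polynomial.eval_X]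
  push_cast
  rw [neg_pow ((rhoDiff p q t (-s) : ℝ) : ℂ)]
  have : ((-1 : ℂ) ^ n) * (-1) ^ n = 1 := by rw [← mul_pow]; simp
  linear_combination (-(F (-s) * ((rhoDiff p q t (-s) : ℝ) : ℂ) ^ n /
    ((p.eval (-s) : ℝ) : ℂ))) * this

/-- Reflection multiplies the moment and the coefficient `momentCoeff` by the same sign `-(-1)^n`,
so the formula at `b` is the one at `a`. -/
theorem IsStrip.tendsto_charMoment_right {p q : Polynomial ℝ} {a b θ : ℝ} (h : IsStrip p a b θ)
    (hq : q.eval b ≠ 0) (n : ℕ) {F : ℝ → ℂ} (hF : ContinuousOn F (Icc a b)) :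
    Tendsto (fun t => charMoment p q θ n F t / ((Real.log (1 / |t - b|) ^ (n + 1) : ℝ) : ℂ))
      (𝓝[<] b) (𝓝 (F b * momentCoeff p q b n)) := by
  have hF' : ContinuousOn (fun s => F (-s)) (Icc (-b) (-a)) :=
    hF.comp continuousOn_neg fun s hs => ⟨by linarith [hs.2], by linarith [hs.1]⟩
  have h1 := h.reflect.tendsto_charMoment_left (q := q.comp (-Polynomial.X)) (by simpa using hq) n hF'
  have h2 := (h1.comp tendsto_neg_nhdsLT).const_mul (-(-1) ^ n : ℂ)
  have hval : (-(-1) ^ n : ℂ) * (F (- -b) * momentCoeff (p.comp (-Polynomial.X))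
      (q.comp (-Polynomial.X)) (-b) n) = F b * momentCoeff p q b n := by
    rw [momentCoeff, momentCoeff, logCoeff_reflect]
    have : ((-1 : ℂ) ^ n) * (-1) ^ n = 1 := by rw [← mul_pow]; simp
    simp only [Polynomial.derivative_comp, neg_neg]
    simp
    rw [neg_pow (logCoeff p q b : ℂ), div_neg]
    linear_combination (-(F b * ((logCoeff p q b : ℂ) ^ n /
      (((p.derivative.eval b : ℝ) : ℂ) * (n + 1))))) * this
  rw [hval] at h2
  refine h2.congr fun t => ?_
  rw [IsStrip.charMoment_reflect q θ n F t]
  simp only [Function.comp_apply]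
  have : |-t - -b| = |t - b| := by rw [← abs_neg]; ring_nf
  rw [this, mul_div_assoc]

end Strip

/-! ### Part iii): right-hand sides that are polynomial in `x` -/

namespace Strip

variable {p q : Polynomial ℝ} {a b θ : ℝ}

theorem hasLogAsymptotics_of_tendsto {F : Filter ℝ} {τ : ℝ} {n : ℕ} {κ : ℂ} {g : ℝ → ℂ}
    (hL : Tendsto (fun t => Real.log (1 / |t - τ|)) F atTop)
    (h : Tendsto (fun t => g t / ((Real.log (1 / |t - τ|) ^ n : ℝ) : ℂ)) F (𝓝 κ)) :
    HasLogAsymptotics F τ n κ g := by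
  have hpos := hL.eventually_gt_atTop 0
  have h1 : (fun t => g t - κ * ((Real.log (1 / |t - τ|) ^ n : ℝ) : ℂ)) =o[F]
      fun t => ((Real.log (1 / |t - τ|) ^ n : ℝ) : ℂ) := by
    rw [isLittleO_iff_tendsto']
    · have := h.sub_const κ
      rw [sub_self] at this
      refine this.congr' ?_
      filter_upwards [hpos] with t ht
      have : ((Real.log (1 / |t - τ|) ^ n : ℝ) : ℂ) ≠ 0 := by exact_mod_cast (pow_pos ht n).ne'
      rw [sub_div, mul_div_cancel_right₀ _ this]
    · filter_upwards [hpos] with t ht h0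
      exact absurd h0 (by exact_mod_cast (pow_pos ht n).ne')
  exact h1.trans_isBigO (isBigO_of_le _ fun t => by rw [Complex.norm_real])

/-- The coefficient of `x^l` in `L⁻¹ f`, for `f` a polynomial in `x` of degree at most `k`. -/
noncomputable def polyCoeff (p q : Polynomial ℝ) (θ : ℝ) (k : ℕ) (F : ℕ → ℝ → ℂ) (l : ℕ)
    (t : ℝ) : ℂ :=
  ∑ m ∈ Finset.range (k + 1), (m.choose l : ℂ) * charMoment p q θ (m - l) (F m) t

/-- The binomial theorem for `(x + ρ(τ) - ρ(t))^m`, integrated term by term. The sum over `l ≤ m`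
may run up to `k` because the binomial coefficients vanish for `l > m`, which also makes the
truncated difference `m - l` harmless. -/
theorem IsStrip.stripInv_polynomial (h : IsStrip p a b θ) (q : Polynomial ℝ) {k : ℕ}
    {F : ℕ → ℝ → ℂ} (hF : ∀ l ≤ k, ContinuousOn (F l) (Icc a b)) {s : ℝ} (hs : s ∈ Ioo a b)
    (x : ℝ) :
    stripInv p q θ (fun τ y => ∑ l ∈ Finset.range (k + 1), F l τ * (y : ℂ) ^ l) s x =
      ∑ l ∈ Finset.range (k + 1), polyCoeff p q θ k F l s * (x : ℂ) ^ l := by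
  have hint : ∀ m ∈ Finset.range (k + 1), ∀ n : ℕ, IntervalIntegrable (fun τ => F m τ *
      ((rhoDiff p q s τ : ℝ) : ℂ) ^ n / ((p.eval τ : ℝ) : ℂ)) volume θ s := fun m hm n => by
    refine h.intervalIntegrable_of_continuousOn (ContinuousOn.div (ContinuousOn.mul ?_ ?_)
      (Complex.continuous_ofReal.comp p.continuous).continuousOn fun s hs => h.ofReal_ne_zero hs) hs
    · exact (hF m (Nat.lt_succ_iff.1 (Finset.mem_range.1 hm))).mono Ioo_subset_Icc_self
    · exact (Complex.continuous_ofReal.comp_continuousOn (h.continuousOn_rhoDiff_right q hs)).pow n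
  have hexp : ∀ τ, (∑ m ∈ Finset.range (k + 1), F m τ * ((x + rhoDiff p q s τ : ℝ) : ℂ) ^ m) /
      ((p.eval τ : ℝ) : ℂ) = ∑ l ∈ Finset.range (k + 1), ∑ m ∈ Finset.range (k + 1),
        (m.choose l : ℂ) * (x : ℂ) ^ l *
          (F m τ * ((rhoDiff p q s τ : ℝ) : ℂ) ^ (m - l) / ((p.eval τ : ℝ) : ℂ)) := by
    intro τ
    rw [Finset.sum_comm, Finset.sum_div]
    refine Finset.sum_congr rfl fun m hm => ?_
    push_cast
    rw [add_pow, Finset.mul_sum, Finset.sum_div]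
    have hmk : m + 1 ≤ k + 1 := Finset.mem_range.1 hm
    rw [← Finset.sum_subset (Finset.range_mono hmk)]
    · exact Finset.sum_congr rfl fun l _ => by ring
    · intro l _ hl
      rw [Nat.choose_eq_zero_of_lt (by simpa using hl)]
      simp
  unfold stripInv polyCoeff
  simp only [hexp]
  rw [intervalIntegral.integral_finsetSum]
  · refine Finset.sum_congr rfl fun l _ => ?_
    rw [intervalIntegral.integral_finsetSum]
    · rw [Finset.sum_mul]
      refine Finset.sum_congr rfl fun m _ => ?_
      rw [intervalIntegral.integral_const_mul, charMoment]
      ring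
    · exact fun m hm => (hint m hm _).const_mul _
  · intro l _
    simpa only [Finset.sum_fn] using IntervalIntegrable.sum (Finset.range (k + 1))
      fun m hm => (hint m hm (m - l)).const_mul ((m.choose l : ℂ) * (x : ℂ) ^ l)

/-- For `l ≤ m` the term of index `m` has order at most `log^(m-l+1)`, so only `m = k` can reach
`log^(k+1-l)`. This identifies the constant of the theorem as `k.choose l` times the moment
coefficient of order `k - l`. -/
theorem tendsto_polyCoeff {G : Filter ℝ} {e : ℝ} {k l : ℕ} (hl : l ≤ k) {F : ℕ → ℝ → ℂ}
    (hL : Tendsto (fun t => Real.log (1 / |t - e|)) G atTop)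
    (hm : ∀ m ≤ k, ∀ n, Tendsto (fun t => charMoment p q θ n (F m) t /
      ((Real.log (1 / |t - e|) ^ (n + 1) : ℝ) : ℂ)) G (𝓝 (F m e * momentCoeff p q e n))) :
    HasLogAsymptotics G e (k + 1 - l) (F k e * (((k.choose l : ℝ) * momentCoeff p q e (k - l) : ℝ) : ℂ))
      (polyCoeff p q θ k F l) := by
  refine hasLogAsymptotics_of_tendsto hL ?_
  have hpos := hL.eventually_gt_atTop 0
  have hterm : ∀ m ∈ Finset.range (k + 1), Tendsto (fun t => (m.choose l : ℂ) *
      charMoment p q θ (m - l) (F m) t / ((Real.log (1 / |t - e|) ^ (k + 1 - l) : ℝ) : ℂ)) G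
      (𝓝 (if m = k then F k e * (((k.choose l : ℝ) * momentCoeff p q e (k - l) : ℝ) : ℂ) else 0)) := by
    intro m hmk
    have hmk' : m ≤ k := Nat.lt_succ_iff.1 (Finset.mem_range.1 hmk)
    rcases lt_or_ge m l with hml | hml
    · rw [if_neg (by omega), Nat.choose_eq_zero_of_lt hml]
      simpa using tendsto_const_nhds
    have h1 := (hm m hmk' (m - l)).const_mul (m.choose l : ℂ)
    split_ifs with hmeq
    · subst hmeq
      have e1 : m + 1 - l = m - l + 1 := by omega
      rw [e1]
      refine (h1.congr fun t => by rw [mul_div_assoc]).trans (le_of_eq ?_)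
      push_cast
      congr 1
      ring
    -- For `l ≤ m < k` the term is short of `k - m ≥ 1` powers of the logarithm.
    · have h2 : Tendsto (fun t => (((Real.log (1 / |t - e|) ^ (k - m))⁻¹ : ℝ) : ℂ)) G (𝓝 ((0 : ℝ) : ℂ)) :=
        (Complex.continuous_ofReal.tendsto _).comp
          (tendsto_inv_atTop_zero.comp ((tendsto_pow_atTop (by omega)).comp hL))
      have h3 := h1.mul h2
      rw [Complex.ofReal_zero, mul_zero] at h3
      refine h3.congr' ?_
      filter_upwards [hpos] with t ht
      have h0 : ((Real.log (1 / |t - e|) : ℝ) : ℂ) ≠ 0 := by exact_mod_cast ht.ne'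
      have e1 : k + 1 - l = (m - l + 1) + (k - m) := by omega
      rw [e1, pow_add]
      push_cast
      field_simp
      ring
  have hsum := tendsto_finsetSum _ hterm
  simp only [polyCoeff, Finset.sum_div]
  refine hsum.trans (le_of_eq ?_)
  simp

theorem momentCoeff_ne_zero {e : ℝ} (hq : q.eval e ≠ 0) (hp : p.derivative.eval e ≠ 0) (n : ℕ) :
    momentCoeff p q e n ≠ 0 :=
  neg_ne_zero.2 (div_ne_zero (pow_ne_zero _ (div_ne_zero hq hp))
    (mul_ne_zero hp (by positivity)))

theorem tendsto_log_one_div_abs_sub_right (b : ℝ) :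
    Tendsto (fun t => Real.log (1 / |t - b|)) (𝓝[<] b) atTop := by
  refine ((tendsto_log_one_div_abs_sub (-b)).comp tendsto_neg_nhdsLT).congr fun t => ?_
  have : |-t - -b| = |t - b| := by rw [← abs_neg]; ring_nf
  simp only [Function.comp_apply, this]

/-- Right-hand sides that are polynomial in `x`. -/
theorem IsStrip.polynomial (h : IsStrip p a b θ) (hqa : q.eval a ≠ 0) (hqb : q.eval b ≠ 0) (k : ℕ) :
    ∃ γa γb : ℕ → ℝ, (∀ l ≤ k, γa l ≠ 0 ∧ γb l ≠ 0) ∧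
      ∀ F : ℕ → ℝ → ℂ, (∀ l ≤ k, ContinuousOn (F l) (Icc a b)) →
        ∃ g : ℕ → ℝ → ℂ,
          (∀ s ∈ Ioo a b, ∀ x : ℝ,
            stripInv p q θ (fun τ y => ∑ l ∈ Finset.range (k + 1), F l τ * (y : ℂ) ^ l) s x =
              ∑ l ∈ Finset.range (k + 1), g l s * (x : ℂ) ^ l) ∧
          ∀ l ≤ k,
            HasLogAsymptotics (𝓝[>] a) a (k + 1 - l) (F k a * γa l) (g l) ∧
            HasLogAsymptotics (𝓝[<] b) b (k + 1 - l) (F k b * γb l) (g l) := by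
  refine ⟨fun l => k.choose l * momentCoeff p q a (k - l),
    fun l => k.choose l * momentCoeff p q b (k - l), fun l hl => ?_, fun F hF =>
    ⟨polyCoeff p q θ k F, fun s hs x => h.stripInv_polynomial q hF hs x, fun l hl => ⟨?_, ?_⟩⟩⟩
  · have : (k.choose l : ℝ) ≠ 0 := by exact_mod_cast (Nat.choose_pos hl).ne'
    exact ⟨mul_ne_zero this (momentCoeff_ne_zero hqa h.simple_left _),
      mul_ne_zero this (momentCoeff_ne_zero hqb h.simple_right _)⟩
  · exact tendsto_polyCoeff hl (tendsto_log_one_div_abs_sub a)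
      fun m hm n => h.tendsto_charMoment_left hqa n (hF m hm)
  · exact tendsto_polyCoeff hl (tendsto_log_one_div_abs_sub_right b)
      fun m hm n => h.tendsto_charMoment_right hqb n (hF m hm)

end Strip

/-! ### Reduction of the weighted Sobolev spaces to `L²(ℝ)` -/

namespace Strip

open SchwartzMap

/-- The space `L²(ℝ)`. -/
abbrev L2 : Type := Lp ℂ 2 (volume : Measure ℝ)

/-! ### The bilinear pairing on `L²(ℝ)` -/

/-- Complex conjugation on `L²(ℝ)`. -/
noncomputable def conjL2 : L2 →SL[starRingEnd ℂ] L2 :=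
  ((starL ℂ : ℂ ≃L⋆[ℂ] ℂ) : ℂ →SL[starRingEnd ℂ] ℂ).compLpL 2 volume

theorem coeFn_conjL2 (g : L2) : ∀ᵐ x ∂(volume : Measure ℝ), conjL2 g x = star (g x) :=
  ((starL ℂ : ℂ ≃L⋆[ℂ] ℂ) : ℂ →SL[starRingEnd ℂ] ℂ).coeFn_compLp g

theorem norm_conjL2 (g : L2) : ‖conjL2 g‖ = ‖g‖ := by
  rw [Lp.norm_def, Lp.norm_def]
  congr 1
  apply eLpNorm_congr_norm_ae
  filter_upwards [coeFn_conjL2 g] with x hx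
  rw [hx, norm_star]

theorem conjL2_conjL2 (g : L2) : conjL2 (conjL2 g) = g := by
  apply Lp.ext
  filter_upwards [coeFn_conjL2 g, coeFn_conjL2 (conjL2 g)] with x h1 h2
  rw [h2, h1, star_star]

/-- The bilinear pairing `∫ g h` on `L²(ℝ)`. -/
noncomputable def pairL2 (g h : L2) : ℂ := inner ℂ (conjL2 g) h

theorem pairL2_eq_integral (g h : L2) : pairL2 g h = ∫ x, h x * g x := by
  rw [pairL2, L2.inner_def]
  apply integral_congr_ae
  filter_upwards [coeFn_conjL2 g] with x hx
  simp [hx]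

theorem pairL2_comm (g h : L2) : pairL2 g h = pairL2 h g := by
  simp only [pairL2_eq_integral, mul_comm]

/-- `h ↦ ∫ g h`. -/
noncomputable def pairL2CLM (g : L2) : L2 →L[ℂ] ℂ := innerSL ℂ (conjL2 g)

theorem pairL2CLM_apply (g h : L2) : pairL2CLM g h = pairL2 g h := rfl

theorem toTemperedDistribution_eq_pairL2 (g : L2) (φ : 𝓢(ℝ, ℂ)) :
    Lp.toTemperedDistribution g φ = pairL2 g (φ.toLp 2) := by
  rw [Lp.toTemperedDistribution_apply, pairL2_eq_integral]
  apply integral_congr_ae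
  filter_upwards [φ.coeFn_toLp 2 volume] with x hx
  rw [hx, smul_eq_mul]

theorem pairL2_toLp_toLp (φ ψ : 𝓢(ℝ, ℂ)) :
    pairL2 (φ.toLp 2) (ψ.toLp 2) = ∫ x, ψ x * φ x := by
  rw [pairL2_eq_integral]
  apply integral_congr_ae
  filter_upwards [φ.coeFn_toLp 2 volume, ψ.coeFn_toLp 2 volume] with x h1 h2
  rw [h1, h2]

/-- The inclusion of `𝓢(ℝ)` into `L²(ℝ)`. -/
noncomputable def toL2 : 𝓢(ℝ, ℂ) →L[ℂ] L2 := toLpCLM ℂ ℂ 2 volume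

theorem toL2_apply (φ : 𝓢(ℝ, ℂ)) : toL2 φ = φ.toLp 2 := rfl

theorem denseRange_toL2 : DenseRange toL2 := denseRange_toLpCLM (F := ℂ) (by simp)

theorem pairL2_ext {g h : L2} (H : ∀ φ : 𝓢(ℝ, ℂ), pairL2 g (toL2 φ) = pairL2 h (toL2 φ)) :
    g = h := by
  have h1 : pairL2CLM g = pairL2CLM h := by
    ext x
    exact congrFun (denseRange_toL2.equalizer (pairL2CLM g).continuous (pairL2CLM h).continuous
      (funext H)) x
  have h2 : conjL2 g = conjL2 h := by
    refine ext_inner_right ℂ fun v => ?_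
    exact congrArg (fun L : L2 →L[ℂ] ℂ => L v) h1
  rw [← conjL2_conjL2 g, h2, conjL2_conjL2]

theorem norm_toL2_le {φ ψ : 𝓢(ℝ, ℂ)} {C : ℝ} (hC : 0 ≤ C) (h : ∀ x, ‖φ x‖ ≤ C * ‖ψ x‖) :
    ‖toL2 φ‖ ≤ C * ‖toL2 ψ‖ := by
  rw [toL2_apply, toL2_apply, norm_toLp, norm_toLp, ← ENNReal.toReal_ofReal hC,
    ← ENNReal.toReal_mul]
  refine ENNReal.toReal_mono ?_ (eLpNorm_le_mul_eLpNorm_of_ae_le_mul (Eventually.of_forall h) 2)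
  exact ENNReal.mul_ne_top ENNReal.ofReal_ne_top (ψ.eLpNorm_lt_top 2 volume).ne

theorem norm_toL2_sq (φ : 𝓢(ℝ, ℂ)) : ‖toL2 φ‖ ^ 2 = ∫ x, ‖φ x‖ ^ 2 := by
  rw [toL2_apply, norm_toLp' (by simp) (by simp)]
  have : 0 ≤ ∫ x, ‖φ x‖ ^ 2 := integral_nonneg fun x => by positivity
  simp only [ENNReal.toReal_ofNat]
  rw [← Real.rpow_natCast, ← Real.rpow_mul (integral_nonneg fun x => by positivity)]
  norm_num

theorem norm_toL2_le_of_le_inv {φ : 𝓢(ℝ, ℂ)} {B : ℝ} (hB : 0 ≤ B)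
    (h : ∀ x, ‖φ x‖ ≤ B * (1 + x ^ 2) ^ (-(1 / 2) : ℝ)) : ‖toL2 φ‖ ≤ B * √Real.pi := by
  refine le_of_sq_le_sq ?_ (by positivity)
  rw [norm_toL2_sq, mul_pow, Real.sq_sqrt Real.pi_pos.le, ← integral_univ_inv_one_add_sq,
    ← integral_const_mul]
  refine integral_mono_of_nonneg (Eventually.of_forall fun x => by positivity)
    (integrable_inv_one_add_sq.const_mul _) (Eventually.of_forall fun x => ?_)
  have h0 : (0 : ℝ) ≤ 1 + x ^ 2 := by positivity
  calc ‖φ x‖ ^ 2 ≤ (B * (1 + x ^ 2) ^ (-(1 / 2) : ℝ)) ^ 2 := by gcongr; exact h x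
    _ = B ^ 2 * (1 + x ^ 2)⁻¹ := by
      rw [mul_pow, ← Real.rpow_natCast ((1 + x ^ 2) ^ _), ← Real.rpow_mul h0, ← Real.rpow_neg_one]
      norm_num

theorem norm_toL2_fourier (φ : 𝓢(ℝ, ℂ)) : ‖toL2 (𝓕 φ)‖ = ‖toL2 φ‖ := norm_fourier_toL2_eq φ

/-! ### Weights -/

/-- The weight `⟨x⟩^s`. -/
noncomputable def wt (s : ℝ) (x : ℝ) : ℂ := (((1 + x ^ 2) ^ (s / 2) : ℝ) : ℂ)

/-- The symbol of `⟨D⟩^s`. -/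
noncomputable def wtD (s : ℝ) (ξ : ℝ) : ℂ := (((1 + (2 * Real.pi * ξ) ^ 2) ^ (s / 2) : ℝ) : ℂ)

theorem wtD_eq (s ξ : ℝ) : wtD s ξ = wt s (2 * Real.pi * ξ) := rfl

theorem hasTemperateGrowth_wt (s : ℝ) : (wt s).HasTemperateGrowth := by
  have h := Function.hasTemperateGrowth_one_add_norm_sq_rpow ℝ (s / 2)
  simp only [Real.norm_eq_abs, sq_abs] at h
  exact Function.HasTemperateGrowth.comp Complex.ofRealCLM.hasTemperateGrowth h

theorem hasTemperateGrowth_wtD (s : ℝ) : (wtD s).HasTemperateGrowth :=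
  (hasTemperateGrowth_wt s).comp
    (ContinuousLinearMap.hasTemperateGrowth ((2 * Real.pi) • ContinuousLinearMap.id ℝ ℝ))

theorem wt_mul_wt (s s' x : ℝ) : wt s x * wt s' x = wt (s + s') x := by
  rw [wt, wt, wt, ← Complex.ofReal_mul, ← Real.rpow_add (by positivity), add_div]

theorem wt_zero (x : ℝ) : wt 0 x = 1 := by simp [wt]

theorem norm_wt (s x : ℝ) : ‖wt s x‖ = (1 + x ^ 2) ^ (s / 2) := by
  rw [wt, Complex.norm_real, Real.norm_of_nonneg (by positivity)]

/-- Peetre's inequality. -/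
theorem norm_wt_mul_le (s x y : ℝ) :
    ‖wt s x * wt (-s) y‖ ≤ 2 ^ (|s| / 2) * (1 + |x - y|) ^ |s| := by
  have key : ∀ x y : ℝ, (1 + x ^ 2) / (1 + y ^ 2) ≤ 2 * (1 + |x - y|) ^ 2 := fun x y => by
    rw [div_le_iff₀ (by positivity)]
    have h1 : (x - y) ^ 2 ≤ (1 + |x - y|) ^ 2 := by
      rw [← sq_abs (x - y)]; gcongr; linarith
    have h2 : 1 ≤ (1 + |x - y|) ^ 2 := by nlinarith [abs_nonneg (x - y)]
    have h3 : (1 + (x - y) ^ 2) ≤ (1 + |x - y|) ^ 2 := by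
      rw [← sq_abs (x - y)]; nlinarith [abs_nonneg (x - y)]
    nlinarith [sq_nonneg (x - 2 * y), mul_nonneg (sq_nonneg (x - y)) (sq_nonneg y)]
  have hfin : ∀ x y s : ℝ, 0 ≤ s → ((1 + x ^ 2) / (1 + y ^ 2)) ^ (s / 2) ≤
      2 ^ (s / 2) * (1 + |x - y|) ^ s := fun x y s hs => by
    calc _ ≤ (2 * (1 + |x - y|) ^ 2) ^ (s / 2) :=
          Real.rpow_le_rpow (by positivity) (key x y) (by positivity)
      _ = _ := by
        rw [Real.mul_rpow (by norm_num) (by positivity), ← Real.rpow_natCast (1 + |x - y|) 2,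
          ← Real.rpow_mul (by positivity)]
        congr 2
        push_cast
        ring
  rw [norm_mul, norm_wt, norm_wt, neg_div, Real.rpow_neg (by positivity), ← div_eq_mul_inv,
    ← Real.div_rpow (by positivity) (by positivity)]
  rcases le_total 0 s with hs | hs
  · rw [abs_of_nonneg hs]; exact hfin x y s hs
  · rw [abs_of_nonpos hs, abs_sub_comm]
    refine le_trans (le_of_eq ?_) (hfin y x (-s) (by linarith))
    rw [neg_div, Real.rpow_neg (by positivity), ← Real.inv_rpow (by positivity), inv_div]

/-- Multiplication by `⟨x⟩^s` on `𝓢(ℝ)`. -/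
noncomputable def mulWt (s : ℝ) : 𝓢(ℝ, ℂ) →L[ℂ] 𝓢(ℝ, ℂ) := smulLeftCLM ℂ (wt s)

/-- Multiplication by the symbol of `⟨D⟩^s` on `𝓢(ℝ)`. -/
noncomputable def mulWtD (s : ℝ) : 𝓢(ℝ, ℂ) →L[ℂ] 𝓢(ℝ, ℂ) := smulLeftCLM ℂ (wtD s)

theorem mulWt_apply (s : ℝ) (φ : 𝓢(ℝ, ℂ)) (x : ℝ) : mulWt s φ x = wt s x * φ x :=
  smulLeftCLM_apply_apply (hasTemperateGrowth_wt s) φ x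

theorem mulWtD_apply (s : ℝ) (φ : 𝓢(ℝ, ℂ)) (x : ℝ) : mulWtD s φ x = wtD s x * φ x :=
  smulLeftCLM_apply_apply (hasTemperateGrowth_wtD s) φ x

theorem mulWt_mulWt (s s' : ℝ) (φ : 𝓢(ℝ, ℂ)) : mulWt s (mulWt s' φ) = mulWt (s + s') φ := by
  ext x; simp only [mulWt_apply, ← wt_mul_wt, mul_assoc]

theorem mulWtD_mulWtD (s s' : ℝ) (φ : 𝓢(ℝ, ℂ)) : mulWtD s (mulWtD s' φ) = mulWtD (s + s') φ := by
  ext x; simp only [mulWtD_apply, wtD_eq, ← wt_mul_wt, mul_assoc]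

theorem mulWt_zero (φ : 𝓢(ℝ, ℂ)) : mulWt 0 φ = φ := by
  ext x; simp [mulWt_apply, wt_zero]

theorem mulWtD_zero (φ : 𝓢(ℝ, ℂ)) : mulWtD 0 φ = φ := by
  ext x; simp [mulWtD_apply, wtD_eq, wt_zero]

end Strip

namespace Strip

open SchwartzMap FourierTransform

/-! ### The weighted Sobolev spaces as images of `L²(ℝ)` -/

/-- The Fourier multiplier `𝓕 ⟨D⟩^s 𝓕⁻¹` on `𝓢(ℝ)`. -/
noncomputable def bessel (s : ℝ) : 𝓢(ℝ, ℂ) →L[ℂ] 𝓢(ℝ, ℂ) :=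
  fourierCLM ℂ 𝓢(ℝ, ℂ) ∘L mulWtD s ∘L fourierInvCLM ℂ 𝓢(ℝ, ℂ)

theorem bessel_apply (s : ℝ) (φ : 𝓢(ℝ, ℂ)) : bessel s φ = 𝓕 (mulWtD s (𝓕⁻ φ)) := rfl

theorem bessel_bessel (s s' : ℝ) (φ : 𝓢(ℝ, ℂ)) : bessel s (bessel s' φ) = bessel (s + s') φ := by
  simp only [bessel_apply, fourierInv_fourier_eq, mulWtD_mulWtD]

theorem bessel_zero (φ : 𝓢(ℝ, ℂ)) : bessel 0 φ = φ := by
  simp only [bessel_apply, mulWtD_zero, fourier_fourierInv_eq]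

/-- Operators on `𝓢'` are transposes of operators on `𝓢`, so the factors appear in reverse order.
The transpose of `𝓕⁻¹ g 𝓕` is `𝓕 g 𝓕⁻¹`, which explains the shape of `bessel`. -/
theorem weightOp_apply (s₁ s₂ : ℝ) (u : 𝓢'(ℝ, ℂ)) (φ : 𝓢(ℝ, ℂ)) :
    weightOp s₁ s₂ u φ = u (bessel s₁ (mulWt s₂ φ)) := rfl

/-- The distribution `⟨D⟩^{-s₁} ⟨x⟩^{-s₂} g`. -/
noncomputable def sobEmb (s₁ s₂ : ℝ) (g : L2) : 𝓢'(ℝ, ℂ) :=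
  TemperedDistribution.fourierMultiplierCLM ℂ (wtD (-s₁))
    (TemperedDistribution.smulLeftCLM ℂ (wt (-s₂)) (Lp.toTemperedDistribution g))

theorem sobEmb_apply (s₁ s₂ : ℝ) (g : L2) (φ : 𝓢(ℝ, ℂ)) :
    sobEmb s₁ s₂ g φ = pairL2 g (toL2 (mulWt (-s₂) (bessel (-s₁) φ))) :=
  toTemperedDistribution_eq_pairL2 g _

theorem weightOp_sobEmb (s₁ s₂ : ℝ) (g : L2) :
    weightOp s₁ s₂ (sobEmb s₁ s₂ g) = Lp.toTemperedDistribution g := by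
  ext φ
  rw [weightOp_apply, sobEmb_apply, bessel_bessel, neg_add_cancel, bessel_zero, mulWt_mulWt,
    neg_add_cancel, mulWt_zero, toTemperedDistribution_eq_pairL2, toL2_apply]

theorem eq_sobEmb_of_weightOp_eq {s₁ s₂ : ℝ} {u : 𝓢'(ℝ, ℂ)} {g : L2}
    (h : weightOp s₁ s₂ u = Lp.toTemperedDistribution g) : u = sobEmb s₁ s₂ g := by
  ext φ
  have h1 := congrArg (fun v : 𝓢'(ℝ, ℂ) => v (mulWt (-s₂) (bessel (-s₁) φ))) h
  simp only [weightOp_apply, mulWt_mulWt, add_neg_cancel, mulWt_zero, bessel_bessel,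
    bessel_zero, toTemperedDistribution_eq_pairL2] at h1
  rw [h1, sobEmb_apply, toL2_apply]

theorem toTemperedDistribution_injective :
    Function.Injective (Lp.toTemperedDistribution : L2 → 𝓢'(ℝ, ℂ)) := fun g h H => by
  refine pairL2_ext fun φ => ?_
  rw [toL2_apply, ← toTemperedDistribution_eq_pairL2, ← toTemperedDistribution_eq_pairL2, H]

theorem sobEmb_injective (s₁ s₂ : ℝ) : Function.Injective (sobEmb s₁ s₂) := fun g h H =>
  toTemperedDistribution_injective (by rw [← weightOp_sobEmb s₁ s₂, H, weightOp_sobEmb])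

/-- `weightOp` undoes `sobEmb`, and `L²` embeds injectively in `𝓢'`, so the infimum that defines
`sobNorm` runs over a single element. Together with `exists_eq_sobEmb` this makes `sobEmb` an
isometry of `L²` onto `H^{s₁,s₂}`, and all estimates can be made in `L²`. -/
theorem sobNorm_sobEmb (s₁ s₂ : ℝ) (g : L2) : sobNorm s₁ s₂ (sobEmb s₁ s₂ g) = ‖g‖ₑ := by
  unfold sobNorm
  rw [weightOp_sobEmb]
  refine le_antisymm (iInf_le_of_le g (iInf_le _ rfl)) (le_iInf₂ fun g' hg' => ?_)
  rw [toTemperedDistribution_injective hg']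

theorem exists_eq_sobEmb {s₁ s₂ : ℝ} {u : 𝓢'(ℝ, ℂ)} (h : sobNorm s₁ s₂ u < ⊤) :
    ∃ g, u = sobEmb s₁ s₂ g := by
  unfold sobNorm at h
  simp only [iInf_lt_iff] at h
  obtain ⟨g, hg, -⟩ := h
  exact ⟨g, eq_sobEmb_of_weightOp_eq hg⟩

theorem sobEmb_add (s₁ s₂ : ℝ) (g h : L2) :
    sobEmb s₁ s₂ (g + h) = sobEmb s₁ s₂ g + sobEmb s₁ s₂ h := by
  ext φ
  simp [sobEmb_apply, pairL2, inner_add_left]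

theorem sobEmb_smul (s₁ s₂ : ℝ) (c : ℂ) (g : L2) :
    sobEmb s₁ s₂ (c • g) = c • sobEmb s₁ s₂ g := by
  ext φ
  simp [sobEmb_apply, pairL2, inner_smul_left]

theorem sobEmb_sub (s₁ s₂ : ℝ) (g h : L2) :
    sobEmb s₁ s₂ (g - h) = sobEmb s₁ s₂ g - sobEmb s₁ s₂ h := by
  ext φ
  simp [sobEmb_apply, pairL2, inner_sub_left]

theorem continuousIntoSob_sobEmb {s₁ s₂ : ℝ} {S : Set ℝ} {G : ℝ → L2} (hG : ContinuousOn G S) :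
    ContinuousIntoSob s₁ s₂ S fun t => sobEmb s₁ s₂ (G t) := fun t ht => by
  refine ⟨by rw [sobNorm_sobEmb]; exact enorm_lt_top, ?_⟩
  simp only [← sobEmb_sub, sobNorm_sobEmb]
  have h1 : Tendsto (fun τ => G τ - G t) (𝓝[S] t) (𝓝 0) := by
    simpa using (hG t ht).tendsto.sub_const (G t)
  simpa [Function.comp_def] using (continuous_enorm.tendsto (0 : L2)).comp h1

theorem ContinuousIntoSob.congr {s₁ s₂ : ℝ} {S : Set ℝ} {u v : ℝ → 𝓢'(ℝ, ℂ)}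
    (hu : ContinuousIntoSob s₁ s₂ S u) (h : ∀ t ∈ S, v t = u t) : ContinuousIntoSob s₁ s₂ S v :=
  fun t ht => by
    rw [h t ht]
    refine ⟨(hu t ht).1, (hu t ht).2.congr' ?_⟩
    filter_upwards [self_mem_nhdsWithin] with τ hτ
    rw [h τ hτ]

theorem ContinuousIntoSob.exists_continuousOn {s₁ s₂ : ℝ} {S : Set ℝ} {u : ℝ → 𝓢'(ℝ, ℂ)}
    (hu : ContinuousIntoSob s₁ s₂ S u) :
    ∃ G : ℝ → L2, ContinuousOn G S ∧ ∀ t ∈ S, u t = sobEmb s₁ s₂ (G t) := by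
  classical
  choose! G hG using fun t (ht : t ∈ S) => exists_eq_sobEmb (hu t ht).1
  refine ⟨G, fun t ht => ?_, hG⟩
  have h1 := (hu t ht).2
  rw [ContinuousWithinAt, tendsto_iff_edist_tendsto_0]
  refine h1.congr' ?_
  filter_upwards [self_mem_nhdsWithin] with τ hτ
  rw [hG τ hτ, hG t ht, ← sobEmb_sub, sobNorm_sobEmb, edist_eq_enorm_sub]

/-! ### Translations -/

theorem fourierInv_translate (h : ℝ) (φ : 𝓢(ℝ, ℂ)) (ξ : ℝ) :
    𝓕⁻ (compSubConstCLM ℂ h φ) ξ = Complex.exp (2 * Real.pi * Complex.I * h * ξ) * 𝓕⁻ φ ξ := by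
  rw [fourierInv_coe, fourierInv_coe, Real.fourierInv_eq', Real.fourierInv_eq']
  simp only [compSubConstCLM_apply, smul_eq_mul]
  rw [← integral_const_mul, ← integral_add_right_eq_self _ h]
  congr 1
  ext x
  rw [add_sub_cancel_right, ← mul_assoc, ← Complex.exp_add]
  congr 2
  simp
  ring

/-- Under `𝓕⁻¹` a translation becomes multiplication by a character, which commutes with
multiplication by `⟨2πξ⟩^s`. Hence `s₁` drops out of every estimate for translations, and only the
weight `⟨x⟩^{s₂}` is felt. -/
theorem bessel_translate (s h : ℝ) (φ : 𝓢(ℝ, ℂ)) :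
    bessel s (compSubConstCLM ℂ h φ) = compSubConstCLM ℂ h (bessel s φ) := by
  have h1 : 𝓕⁻ (bessel s (compSubConstCLM ℂ h φ)) = 𝓕⁻ (compSubConstCLM ℂ h (bessel s φ)) := by
    ext ξ
    rw [fourierInv_translate, bessel_apply, bessel_apply, fourierInv_fourier_eq,
      fourierInv_fourier_eq, mulWtD_apply, mulWtD_apply, fourierInv_translate]
    ring
  simpa only [fourier_fourierInv_eq] using congrArg (fun ψ : 𝓢(ℝ, ℂ) => 𝓕 ψ) h1

theorem derivCLM_eq_lineDeriv (φ : 𝓢(ℝ, ℂ)) :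
    derivCLM ℂ ℂ φ = LineDeriv.lineDerivOp (1 : ℝ) φ := by
  ext x
  rw [derivCLM_apply, lineDerivOp_apply_eq_fderiv, fderiv_apply_one_eq_deriv]

/-- Multiplication by the variable on `𝓢(ℝ)`. -/
noncomputable def mulX : 𝓢(ℝ, ℂ) →L[ℂ] 𝓢(ℝ, ℂ) := smulLeftCLM ℂ (fun x : ℝ => (x : ℂ))

theorem mulX_apply (φ : 𝓢(ℝ, ℂ)) (x : ℝ) : mulX φ x = x * φ x :=
  smulLeftCLM_apply_apply Complex.ofRealCLM.hasTemperateGrowth φ x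

theorem smulLeftCLM_inner_one (φ : 𝓢(ℝ, ℂ)) :
    smulLeftCLM ℂ (fun x : ℝ => inner ℝ x (1 : ℝ)) φ = mulX φ := by
  ext x
  rw [smulLeftCLM_apply_apply (by fun_prop), mulX_apply]
  simp

theorem deriv_fourier (φ : 𝓢(ℝ, ℂ)) :
    derivCLM ℂ ℂ (𝓕 φ) = 𝓕 (-(2 * Real.pi * Complex.I) • mulX φ) := by
  rw [derivCLM_eq_lineDeriv, lineDerivOp_fourier_eq, smulLeftCLM_inner_one]

theorem fourier_deriv (φ : 𝓢(ℝ, ℂ)) :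
    𝓕 (derivCLM ℂ ℂ φ) = (2 * Real.pi * Complex.I) • mulX (𝓕 φ) := by
  rw [derivCLM_eq_lineDeriv, fourier_lineDerivOp_eq, smulLeftCLM_inner_one]

theorem fourierInv_deriv (φ : 𝓢(ℝ, ℂ)) :
    𝓕⁻ (derivCLM ℂ ℂ φ) = -(2 * Real.pi * Complex.I) • mulX (𝓕⁻ φ) := by
  rw [derivCLM_eq_lineDeriv, fourierInv_lineDerivOp_eq, smulLeftCLM_inner_one]

theorem bessel_deriv (s : ℝ) (φ : 𝓢(ℝ, ℂ)) :
    bessel s (derivCLM ℂ ℂ φ) = derivCLM ℂ ℂ (bessel s φ) := by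
  rw [bessel_apply, bessel_apply, deriv_fourier, fourierInv_deriv]
  congr 1
  ext x
  simp [mulWtD_apply, mulX_apply]
  ring

end Strip

namespace Strip

open SchwartzMap

/-! ### Transposes of operators that are bounded in the `L²` norm -/

/-- The operator `B` on `L²(ℝ)` with `∫ (B g) φ = ∫ g (K φ)` for `φ ∈ 𝓢(ℝ)`. -/
noncomputable def transposeL2 (K : 𝓢(ℝ, ℂ) →ₗ[ℂ] 𝓢(ℝ, ℂ)) : L2 →L[ℂ] L2 :=
  conjL2.comp ((ContinuousLinearMap.adjoint
    ((toL2.toLinearMap ∘ₗ K).extendOfNorm toL2.toLinearMap)).comp conjL2)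

/-- The bound makes `extendOfNorm` a genuine extension of `K` to `L²`. The two conjugations convert
the adjoint for the inner product into the transpose for the bilinear pairing. -/
theorem pairL2_transposeL2 {K : 𝓢(ℝ, ℂ) →ₗ[ℂ] 𝓢(ℝ, ℂ)} {C : ℝ}
    (hK : ∀ φ, ‖toL2 (K φ)‖ ≤ C * ‖toL2 φ‖) (g : L2) (φ : 𝓢(ℝ, ℂ)) :
    pairL2 (transposeL2 K g) (toL2 φ) = pairL2 g (toL2 (K φ)) := by
  have h1 : (toL2.toLinearMap ∘ₗ K).extendOfNorm toL2.toLinearMap (toL2 φ) = toL2 (K φ) :=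
    LinearMap.extendOfNorm_eq denseRange_toL2 ⟨C, hK⟩ φ
  simp only [pairL2, transposeL2, ContinuousLinearMap.comp_apply, conjL2_conjL2,
    ContinuousLinearMap.adjoint_inner_left, h1]

theorem norm_transposeL2_le {K : 𝓢(ℝ, ℂ) →ₗ[ℂ] 𝓢(ℝ, ℂ)} {C : ℝ} (hC : 0 ≤ C)
    (hK : ∀ φ, ‖toL2 (K φ)‖ ≤ C * ‖toL2 φ‖) : ‖transposeL2 K‖ ≤ C := by
  refine ContinuousLinearMap.opNorm_le_bound _ hC fun g => ?_
  simp only [transposeL2, ContinuousLinearMap.comp_apply, norm_conjL2]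
  refine (ContinuousLinearMap.le_opNorm _ _).trans ?_
  rw [LinearIsometryEquiv.norm_map, norm_conjL2]
  gcongr
  exact LinearMap.opNorm_extendOfNorm_le denseRange_toL2 hC hK

/-! ### Differentiability of weighted translations -/

theorem exists_norm_wt_mul_translate_le (s R : ℝ) (φ : 𝓢(ℝ, ℂ)) :
    ∃ B : ℝ, 0 ≤ B ∧ ∀ h, |h| ≤ R → ∀ x,
      ‖wt s x * φ (x - h)‖ ≤ B * (1 + x ^ 2) ^ (-(1 / 2) : ℝ) := by
  refine ⟨2 ^ (|s + 1| / 2) * (1 + |R|) ^ |s + 1| * SchwartzMap.seminorm ℂ 0 0 (mulWt (s + 1) φ),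
    by positivity, fun h hh x => ?_⟩
  -- The three factors are controlled by Peetre's inequality, by a Schwartz seminorm, and by the
  -- square integrable weight `⟨x⟩⁻¹`.
  have e : wt s x * φ (x - h) =
      (wt (s + 1) x * wt (-(s + 1)) (x - h)) * mulWt (s + 1) φ (x - h) * wt (-1) x := by
    have e1 : wt (-(s + 1)) (x - h) * wt (s + 1) (x - h) = 1 := by
      rw [wt_mul_wt, neg_add_cancel, wt_zero]
    have e2 : wt (s + 1) x * wt (-1) x = wt s x := by rw [wt_mul_wt]; congr 1; ring
    rw [mulWt_apply, ← e2]
    linear_combination (-(wt (s + 1) x * wt (-1) x * φ (x - h))) * e1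
  rw [e, norm_mul, norm_mul]
  have h1 := norm_wt_mul_le (s + 1) x (x - h)
  rw [sub_sub_cancel] at h1
  have h2 : (1 + |h|) ^ |s + 1| ≤ (1 + |R|) ^ |s + 1| :=
    Real.rpow_le_rpow (by positivity) (by linarith [le_abs_self R]) (abs_nonneg _)
  have h3 := SchwartzMap.norm_le_seminorm ℂ (mulWt (s + 1) φ) (x - h)
  have h4 : ‖wt (-1) x‖ = (1 + x ^ 2) ^ (-(1 / 2) : ℝ) := by rw [norm_wt]; norm_num
  rw [h4]
  gcongr
  exact h1.trans (by gcongr)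

theorem hasDerivAt_translate (φ : 𝓢(ℝ, ℂ)) (c : ℂ) (x h : ℝ) :
    HasDerivAt (fun h : ℝ => c * φ (x - h)) (-(c * derivCLM ℂ ℂ φ (x - h))) h := by
  have h1 : HasDerivAt φ (derivCLM ℂ ℂ φ (x - h)) (x - h) := by
    rw [derivCLM_apply]; exact φ.differentiableAt.hasDerivAt
  have h2 := (h1.scomp h ((hasDerivAt_id h).const_sub x)).const_mul c
  exact h2.congr_deriv (by simp)

/-- A second order Taylor estimate in `h` at each point `x`, with a remainder of size `|h - h₀|²
⟨x⟩⁻¹`, holds uniformly enough in `x` to differentiate in the norm of `L²`. -/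
theorem hasDerivAt_toL2_translate (s : ℝ) (φ : 𝓢(ℝ, ℂ)) (h₀ : ℝ) :
    HasDerivAt (fun h => toL2 (mulWt s (compSubConstCLM ℂ h φ)))
      (-toL2 (mulWt s (compSubConstCLM ℂ h₀ (derivCLM ℂ ℂ φ)))) h₀ := by
  obtain ⟨B, hB, h1⟩ := exists_norm_wt_mul_translate_le s (|h₀| + 1) (derivCLM ℂ ℂ (derivCLM ℂ ℂ φ))
  have hball : ∀ h ∈ Metric.closedBall h₀ 1, |h| ≤ |h₀| + 1 := fun h hh => by
    rw [Metric.mem_closedBall, Real.dist_eq] at hh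
    linarith [abs_sub_abs_le_abs_sub h h₀]
  have hsub : ∀ {h}, h ∈ Metric.closedBall h₀ 1 → uIcc h₀ h ⊆ Metric.closedBall h₀ 1 :=
    fun {h} hh => (convex_closedBall h₀ 1).ordConnected.uIcc_subset (by simp) hh
  have lip : ∀ h ∈ Metric.closedBall h₀ 1, ∀ x,
      ‖wt s x * derivCLM ℂ ℂ φ (x - h) - wt s x * derivCLM ℂ ℂ φ (x - h₀)‖ ≤
        B * (1 + x ^ 2) ^ (-(1 / 2) : ℝ) * |h - h₀| := fun h hh x => by
    refine (convex_closedBall h₀ 1).norm_image_sub_le_of_norm_hasDerivWithin_le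
      (f := fun h => wt s x * derivCLM ℂ ℂ φ (x - h))
      (fun k hk => (hasDerivAt_translate _ _ x k).hasDerivWithinAt) (fun k hk => ?_)
      (by simp) hh
    rw [norm_neg]
    exact h1 k (hball k hk) x
  have hlin : ∀ (k : ℝ) (c : ℂ), HasDerivAt (fun k : ℝ => (k : ℂ) * c) c k := fun k c => by
    simpa using (Complex.ofRealCLM.hasDerivAt (x := k)).mul_const c
  -- The mean value inequality is applied a second time, to the translate corrected by its linear
  -- part; the derivative of this difference is controlled by `lip`.
  have tay : ∀ h ∈ Metric.closedBall h₀ 1, ∀ x,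
      ‖wt s x * φ (x - h) - wt s x * φ (x - h₀) + (h - h₀ : ℝ) * (wt s x * derivCLM ℂ ℂ φ (x - h₀))‖
        ≤ B * |h - h₀| ^ 2 * (1 + x ^ 2) ^ (-(1 / 2) : ℝ) := fun h hh x => by
    have h2 := (convex_uIcc h₀ h).norm_image_sub_le_of_norm_hasDerivWithin_le
      (f := fun k : ℝ => wt s x * φ (x - k) + (k : ℂ) * (wt s x * derivCLM ℂ ℂ φ (x - h₀)))
      (f' := fun k => -(wt s x * derivCLM ℂ ℂ φ (x - k)) + wt s x * derivCLM ℂ ℂ φ (x - h₀))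
      (C := B * (1 + x ^ 2) ^ (-(1 / 2) : ℝ) * |h - h₀|)
      (x := h₀) (y := h)
      (fun k hk => ((hasDerivAt_translate _ _ x k).add (hlin k _)).hasDerivWithinAt) (fun k hk => by
        rw [neg_add_eq_sub, norm_sub_rev]
        refine (lip k (hsub hh hk) x).trans ?_
        gcongr B * (1 + x ^ 2) ^ (-(1 / 2) : ℝ) * ?_
        exact abs_sub_left_of_mem_uIcc hk) left_mem_uIcc right_mem_uIcc
    rw [Real.norm_eq_abs] at h2
    calc _ = _ := by congr 1; push_cast; ring
      _ ≤ _ := h2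
      _ = _ := by ring
  rw [hasDerivAt_iff_isLittleO]
  have key : ∀ h ∈ Metric.closedBall h₀ 1, ‖toL2 (mulWt s (compSubConstCLM ℂ h φ)) -
      toL2 (mulWt s (compSubConstCLM ℂ h₀ φ)) -
      (h - h₀) • (-toL2 (mulWt s (compSubConstCLM ℂ h₀ (derivCLM ℂ ℂ φ))))‖ ≤
      B * √Real.pi * ‖(h - h₀) ^ 2‖ := fun h hh => by
    have e : toL2 (mulWt s (compSubConstCLM ℂ h φ)) - toL2 (mulWt s (compSubConstCLM ℂ h₀ φ)) -
      (h - h₀) • (-toL2 (mulWt s (compSubConstCLM ℂ h₀ (derivCLM ℂ ℂ φ)))) =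
      toL2 (mulWt s (compSubConstCLM ℂ h φ) - mulWt s (compSubConstCLM ℂ h₀ φ) +
        ((h - h₀ : ℝ) : ℂ) • mulWt s (compSubConstCLM ℂ h₀ (derivCLM ℂ ℂ φ))) := by
      rw [map_add, map_sub, map_smul, smul_neg, sub_neg_eq_add]
      rfl
    rw [e, norm_pow, Real.norm_eq_abs]
    refine (norm_toL2_le_of_le_inv (B := B * |h - h₀| ^ 2) (by positivity) fun x => ?_).trans
      (le_of_eq (by ring))
    simpa [mulWt_apply] using tay h hh x
  refine (IsBigO.of_bound (B * √Real.pi) ?_).trans_isLittleO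
    (isLittleO_pow_sub_sub h₀ one_lt_two)
  filter_upwards [Metric.closedBall_mem_nhds h₀ one_pos] with h hh
  simpa only [norm_pow, norm_norm] using key h hh

theorem continuous_toL2_translate (s : ℝ) (φ : 𝓢(ℝ, ℂ)) :
    Continuous fun h => toL2 (mulWt s (compSubConstCLM ℂ h φ)) :=
  continuous_iff_continuousAt.2 fun h => (hasDerivAt_toL2_translate s φ h).continuousAt

/-! ### Translations on the weighted Sobolev spaces -/

/-- `φ ↦ ⟨x⟩^s τ_h ⟨x⟩^{-s} φ`, where `τ_h φ = φ(· - h)`. -/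
noncomputable def weightedTranslate (s h : ℝ) : 𝓢(ℝ, ℂ) →L[ℂ] 𝓢(ℝ, ℂ) :=
  mulWt s ∘L compSubConstCLM ℂ h ∘L mulWt (-s)

theorem weightedTranslate_apply (s h : ℝ) (φ : 𝓢(ℝ, ℂ)) (x : ℝ) :
    weightedTranslate s h φ x = wt s x * (wt (-s) (x - h) * φ (x - h)) := by
  rw [← mulWt_apply (-s)]
  exact mulWt_apply s _ x

theorem norm_toL2_compSubConstCLM (h : ℝ) (φ : 𝓢(ℝ, ℂ)) :
    ‖toL2 (compSubConstCLM ℂ h φ)‖ = ‖toL2 φ‖ := by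
  refine (sq_eq_sq₀ (norm_nonneg _) (norm_nonneg _)).1 ?_
  rw [norm_toL2_sq, norm_toL2_sq]
  exact integral_sub_right_eq_self (fun x => ‖φ x‖ ^ 2) h

theorem norm_toL2_weightedTranslate_le (s h : ℝ) (φ : 𝓢(ℝ, ℂ)) :
    ‖toL2 (weightedTranslate s h φ)‖ ≤ 2 ^ (|s| / 2) * (1 + |h|) ^ |s| * ‖toL2 φ‖ := by
  rw [← norm_toL2_compSubConstCLM h φ]
  refine norm_toL2_le (by positivity) fun x => ?_
  rw [weightedTranslate_apply, ← mul_assoc, norm_mul, compSubConstCLM_apply]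
  gcongr
  simpa using norm_wt_mul_le s x (x - h)

/-- The translation `u ↦ u(· + h)` of `H^{s₁,s₂}`, transported to `L²`. -/
noncomputable def sobTranslate (s h : ℝ) : L2 →L[ℂ] L2 :=
  transposeL2 (weightedTranslate (-s) h).toLinearMap

theorem pairL2_sobTranslate (s h : ℝ) (g : L2) (φ : 𝓢(ℝ, ℂ)) :
    pairL2 (sobTranslate s h g) (toL2 φ) = pairL2 g (toL2 (weightedTranslate (-s) h φ)) :=
  pairL2_transposeL2 (norm_toL2_weightedTranslate_le (-s) h) g φ

theorem norm_sobTranslate_le (s h : ℝ) :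
    ‖sobTranslate s h‖ ≤ 2 ^ (|s| / 2) * (1 + |h|) ^ |s| := by
  rw [← abs_neg s]
  exact norm_transposeL2_le (by positivity) (norm_toL2_weightedTranslate_le (-s) h)

/-- The weights hidden in `sobTranslate` cancel the factor `⟨x⟩^{-s₂}` of the embedding, and
`⟨D⟩^{-s₁}` commutes with translations. One operator on `L²` thus represents the translation for all
`s₁`. -/
theorem sobEmb_sobTranslate (s₁ s₂ h : ℝ) (g : L2) (φ : 𝓢(ℝ, ℂ)) :
    sobEmb s₁ s₂ (sobTranslate s₂ h g) φ = sobEmb s₁ s₂ g (compSubConstCLM ℂ h φ) := by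
  rw [sobEmb_apply, sobEmb_apply, pairL2_sobTranslate, bessel_translate]
  congr 2
  simp only [weightedTranslate, ContinuousLinearMap.comp_apply, mulWt_mulWt, neg_neg,
    add_neg_cancel, mulWt_zero]

theorem sobTranslate_toL2 (s h : ℝ) (φ : 𝓢(ℝ, ℂ)) :
    sobTranslate s h (toL2 φ) = toL2 (weightedTranslate s (-h) φ) := by
  refine pairL2_ext fun χ => ?_
  rw [pairL2_sobTranslate]
  simp only [toL2_apply, pairL2_toLp_toLp]
  rw [← integral_add_right_eq_self _ h]
  congr 1
  ext x
  simp only [weightedTranslate_apply, add_sub_cancel_right, sub_neg_eq_add, neg_neg]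
  ring

/-- The operator norms are bounded for bounded `h`, and the translates of a Schwartz function depend
continuously on `h`. Approximating `g₀` by Schwartz functions gives joint continuity, with four
errors below `ε/4`. -/
theorem continuous_sobTranslate (s : ℝ) :
    Continuous fun z : ℝ × L2 => sobTranslate s z.1 z.2 := by
  rw [continuous_iff_continuousAt]
  rintro ⟨h₀, g₀⟩
  rw [Metric.continuousAt_iff']
  intro ε hε
  have hM : ∃ M : ℝ, 0 < M ∧ ∀ h ∈ Metric.ball h₀ 1, ‖sobTranslate s h‖ ≤ M := by
    refine ⟨2 ^ (|s| / 2) * (1 + (|h₀| + 1)) ^ |s|, by positivity, fun h hh => ?_⟩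
    refine (norm_sobTranslate_le s h).trans ?_
    rw [Metric.mem_ball, Real.dist_eq] at hh
    gcongr
    linarith [abs_sub_abs_le_abs_sub h h₀]
  obtain ⟨M, hM0, hM⟩ := hM
  obtain ⟨ψ, hψ⟩ := denseRange_toL2.exists_dist_lt g₀ (ε := ε / (4 * M)) (by positivity)
  have hc : Continuous fun h => sobTranslate s h (toL2 ψ) := by
    simp only [sobTranslate_toL2]
    exact (continuous_toL2_translate s (mulWt (-s) ψ)).comp continuous_neg
  have h1 : ∀ᶠ z : ℝ × L2 in 𝓝 (h₀, g₀), dist (sobTranslate s z.1 (toL2 ψ))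
      (sobTranslate s h₀ (toL2 ψ)) < ε / 4 :=
    Metric.tendsto_nhds.1 ((hc.comp continuous_fst).tendsto (h₀, g₀)) _ (by positivity)
  have h2 : ∀ᶠ z : ℝ × L2 in 𝓝 (h₀, g₀), z.1 ∈ Metric.ball h₀ 1 :=
    Metric.tendsto_nhds.1 (continuous_fst.tendsto (h₀, g₀)) _ one_pos
  have h3 : ∀ᶠ z : ℝ × L2 in 𝓝 (h₀, g₀), dist z.2 g₀ < ε / (4 * M) :=
    Metric.tendsto_nhds.1 (continuous_snd.tendsto (h₀, g₀)) _ (by positivity)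
  filter_upwards [h1, h2, h3] with z h1 h2 h3
  rw [dist_eq_norm] at h1 h3 hψ ⊢
  have e : sobTranslate s z.1 z.2 - sobTranslate s h₀ g₀ =
      sobTranslate s z.1 (z.2 - g₀) + sobTranslate s z.1 (g₀ - toL2 ψ) +
      (sobTranslate s z.1 (toL2 ψ) - sobTranslate s h₀ (toL2 ψ)) -
      sobTranslate s h₀ (g₀ - toL2 ψ) := by simp only [map_sub]; abel
  have hop : ∀ h ∈ Metric.ball h₀ 1, ∀ g : L2, ‖g‖ < ε / (4 * M) → ‖sobTranslate s h g‖ < ε / 4 :=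
    fun h hh g hg => by
      calc ‖sobTranslate s h g‖ ≤ M * ‖g‖ := (sobTranslate s h).le_of_opNorm_le (hM h hh) g
        _ < M * (ε / (4 * M)) := by gcongr
        _ = ε / 4 := by field_simp
  rw [e]
  have i1 := hop z.1 h2 _ h3
  have i2 := hop z.1 h2 _ hψ
  have i3 := hop h₀ (Metric.mem_ball_self one_pos) _ hψ
  refine (norm_sub_le _ _).trans_lt ?_
  have i4 := norm_add_le (sobTranslate s z.1 (z.2 - g₀)) (sobTranslate s z.1 (g₀ - toL2 ψ))
  have i5 := norm_add_le (sobTranslate s z.1 (z.2 - g₀) + sobTranslate s z.1 (g₀ - toL2 ψ))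
    (sobTranslate s z.1 (toL2 ψ) - sobTranslate s h₀ (toL2 ψ))
  linarith

end Strip

namespace Strip

open SchwartzMap

/-! ### The characteristic integral on the weighted Sobolev spaces -/

/-- The characteristic integral on `H^{s₁,s₂}`-valued functions, transported to `L²`. -/
noncomputable def sobStripInv (p q : Polynomial ℝ) (θ s : ℝ) (G : ℝ → L2) (t : ℝ) : L2 :=
  ∫ τ in θ..t, ((p.eval τ : ℝ) : ℂ)⁻¹ • sobTranslate s (rhoDiff p q t τ) (G τ)

theorem sobEmb_apply_eq_pairL2CLM (s₁ s₂ : ℝ) (g : L2) (φ : 𝓢(ℝ, ℂ)) :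
    sobEmb s₁ s₂ g φ = pairL2CLM (toL2 (mulWt (-s₂) (bessel (-s₁) φ))) g := by
  rw [sobEmb_apply, pairL2_comm]; rfl

theorem hasDerivAt_sobEmb_translate (s₁ s₂ : ℝ) (g : L2) (φ : 𝓢(ℝ, ℂ)) (c y : ℝ) :
    HasDerivAt (fun y => sobEmb s₁ s₂ g (compSubConstCLM ℂ (c + y) φ))
      (-sobEmb s₁ s₂ g (compSubConstCLM ℂ (c + y) (derivCLM ℂ ℂ φ))) y := by
  have h1 := (hasDerivAt_toL2_translate (-s₂) (bessel (-s₁) φ) (c + y)).comp_const_add c y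
  have h2 := ((pairL2CLM g).restrictScalars ℝ).hasFDerivAt.comp_hasDerivAt y h1
  refine (h2.congr_deriv ?_).congr_of_eventuallyEq (Eventually.of_forall fun z => ?_)
  · rw [sobEmb_apply, bessel_translate, bessel_deriv, ContinuousLinearMap.map_neg]
    rfl
  · simp only [sobEmb_apply, bessel_translate]
    rfl

theorem continuousOn_sobTranslate {X : Type*} [TopologicalSpace X] {S : Set X} {f : X → ℝ}
    {g : X → L2} (s : ℝ) (hf : ContinuousOn f S) (hg : ContinuousOn g S) :
    ContinuousOn (fun x => sobTranslate s (f x) (g x)) S := by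
  have h1 : ContinuousOn (fun x => (f x, g x)) S := hf.prodMk hg
  have h2 := (continuous_sobTranslate s).comp_continuousOn h1
  exact h2

namespace IsStrip

variable {p : Polynomial ℝ} {a b θ : ℝ} {G : ℝ → L2}

theorem continuousOn_inv_eval (h : IsStrip p a b θ) :
    ContinuousOn (fun τ => ((p.eval τ : ℝ) : ℂ)⁻¹) (Ioo a b) :=
  (Complex.continuous_ofReal.comp p.continuous).continuousOn.inv₀ fun τ hτ =>
    Complex.ofReal_ne_zero.2 (h.ne_zero τ hτ)

theorem continuousOn_sobTranslate_kernel (h : IsStrip p a b θ) (q : Polynomial ℝ) (s : ℝ)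
    (hG : ContinuousOn G (Ioo a b)) :
    ContinuousOn (fun z : ℝ × ℝ => ((p.eval z.1 : ℝ) : ℂ)⁻¹ •
      sobTranslate s (rhoDiff p q θ z.1 + z.2) (G z.1)) (Ioo a b ×ˢ univ) := by
  have hm : MapsTo Prod.fst (Ioo a b ×ˢ (univ : Set ℝ)) (Ioo a b) := fun z hz => hz.1
  have h1 : ContinuousOn (fun z : ℝ × ℝ => rhoDiff p q θ z.1 + z.2) (Ioo a b ×ˢ univ) :=
    ((h.continuousOn_rhoDiff q).comp continuousOn_fst hm).add continuousOn_snd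
  have h2 : ContinuousOn (fun z : ℝ × ℝ => G z.1) (Ioo a b ×ˢ univ) :=
    hG.comp continuousOn_fst hm
  have h3 : ContinuousOn (fun z : ℝ × ℝ => ((p.eval z.1 : ℝ) : ℂ)⁻¹) (Ioo a b ×ˢ univ) :=
    h.continuousOn_inv_eval.comp continuousOn_fst hm
  exact h3.smul (continuousOn_sobTranslate s h1 h2)

theorem sobStripInv_eq (h : IsStrip p a b θ) (q : Polynomial ℝ) (s : ℝ) {t : ℝ}
    (ht : t ∈ Ioo a b) : sobStripInv p q θ s G t = ∫ τ in θ..t, ((p.eval τ : ℝ) : ℂ)⁻¹ •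
      sobTranslate s (rhoDiff p q θ τ + -rhoDiff p q θ t) (G τ) := by
  refine intervalIntegral.integral_congr fun τ hτ => ?_
  simp only [h.rhoDiff_eq q ht ((convex_Ioo a b).ordConnected.uIcc_subset h.mem ht hτ),
    sub_eq_add_neg]

theorem continuousOn_sobStripInv (h : IsStrip p a b θ) (q : Polynomial ℝ) (s : ℝ)
    (hG : ContinuousOn G (Ioo a b)) : ContinuousOn (sobStripInv p q θ s G) (Ioo a b) := by
  have h1 := continuousOn_parametric_primitive h.mem
    (F := fun τ y => ((p.eval τ : ℝ) : ℂ)⁻¹ • sobTranslate s (rhoDiff p q θ τ + y) (G τ))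
    (h.continuousOn_sobTranslate_kernel q s hG)
  exact (h1.comp (continuousOn_id.prodMk (h.continuousOn_rhoDiff q).neg)
    fun t ht => ⟨ht, mem_univ _⟩).congr fun t ht => h.sobStripInv_eq q s ht

theorem intervalIntegrable_sobTranslate (h : IsStrip p a b θ) (q : Polynomial ℝ) (s : ℝ)
    (hG : ContinuousOn G (Ioo a b)) {t : ℝ} (ht : t ∈ Ioo a b) :
    IntervalIntegrable (fun τ => ((p.eval τ : ℝ) : ℂ)⁻¹ •
      sobTranslate s (rhoDiff p q t τ) (G τ)) volume θ t :=
  h.intervalIntegrable_of_continuousOn (h.continuousOn_inv_eval.smul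
    (continuousOn_sobTranslate s (h.continuousOn_rhoDiff_right q ht) hG)) ht

theorem sobEmb_sobStripInv (h : IsStrip p a b θ) (q : Polynomial ℝ) (s₁ s₂ : ℝ)
    (hG : ContinuousOn G (Ioo a b)) {t : ℝ} (ht : t ∈ Ioo a b) (φ : 𝓢(ℝ, ℂ)) :
    sobEmb s₁ s₂ (sobStripInv p q θ s₂ G t) φ = ∫ τ in θ..t,
      sobEmb s₁ s₂ (G τ) (compSubConstCLM ℂ (rhoDiff p q t τ) φ) / ((p.eval τ : ℝ) : ℂ) := by
  rw [sobEmb_apply_eq_pairL2CLM, sobStripInv, ← ContinuousLinearMap.intervalIntegral_comp_comm _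
    (h.intervalIntegrable_sobTranslate q s₂ hG ht)]
  refine intervalIntegral.integral_congr fun τ _ => ?_
  simp only [map_smul, ← sobEmb_apply_eq_pairL2CLM, sobEmb_sobTranslate, smul_eq_mul]
  rw [div_eq_inv_mul]

theorem sobStripInv_smul_add (h : IsStrip p a b θ) (q : Polynomial ℝ) (s : ℝ) {G' : ℝ → L2}
    (hG : ContinuousOn G (Ioo a b)) (hG' : ContinuousOn G' (Ioo a b)) (c : ℂ) {t : ℝ}
    (ht : t ∈ Ioo a b) : sobStripInv p q θ s (c • G + G') t =
      c • sobStripInv p q θ s G t + sobStripInv p q θ s G' t := by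
  unfold sobStripInv
  have hi : IntervalIntegrable (fun τ => c • ((p.eval τ : ℝ) : ℂ)⁻¹ •
      sobTranslate s (rhoDiff p q t τ) (G τ)) volume θ t :=
    (h.intervalIntegrable_sobTranslate q s hG ht).smul c
  rw [← intervalIntegral.integral_smul, ← intervalIntegral.integral_add hi
    (h.intervalIntegrable_sobTranslate q s hG' ht)]
  refine intervalIntegral.integral_congr fun τ _ => ?_
  simp only [Pi.add_apply, Pi.smul_apply, map_add, map_smul, smul_add]
  rw [smul_comm]

/-- A translation by `h` costs a constant times `(1 + |h|)^{|s|}`, hence a constant times `e^{δ|h|}`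
for any `δ > 0`. Taking `δ` so small that `δ|c| < ν` at both ends makes every `ν > 0` admissible, in
contrast to part i). -/
theorem exists_norm_sobStripInv_le (h : IsStrip p a b θ) (q : Polynomial ℝ) (s : ℝ) {ν : ℝ}
    (hν : 0 < ν) : ∃ C : ℝ, 0 < C ∧ ∀ (G : ℝ → L2) (M : ℝ), 0 ≤ M →
      (∀ τ ∈ Ioo a b, ‖G τ‖ ≤ M * (endWeight a b ν τ)⁻¹) →
      ∀ t ∈ Ioo a b, ‖sobStripInv p q θ s G t‖ ≤ M * C * (endWeight a b ν t)⁻¹ := by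
  obtain ⟨δ, hδ, hδa, hδb⟩ : ∃ δ : ℝ, 0 < δ ∧ δ * |logCoeff p q a| < ν ∧
      δ * |logCoeff p q b| < ν := by
    set A := |logCoeff p q a| + |logCoeff p q b| + 1
    have hA : 0 < A := by positivity
    refine ⟨ν / A, by positivity, ?_, ?_⟩ <;>
    · rw [div_mul_eq_mul_div, div_lt_iff₀ hA]
      gcongr
      linarith [abs_nonneg (logCoeff p q a), abs_nonneg (logCoeff p q b)]
  obtain ⟨C₁, hC₁, h1⟩ := exists_rpow_le_exp |s| hδ
  obtain ⟨C₂, hC₂, h2⟩ := h.exists_abs_integral_exp_le q hδ.le hν hδa hδb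
  refine ⟨2 ^ (|s| / 2) * C₁ * C₂, by positivity, fun G M hM hG t ht => ?_⟩
  refine (h.norm_integral_le q (M := M * (2 ^ (|s| / 2) * C₁)) (h2 t ht) ht (by positivity)
    fun τ hτ => ?_).trans (le_of_eq (by ring))
  rw [norm_smul, norm_inv, Complex.norm_real, Real.norm_eq_abs]
  have h3 := (sobTranslate s (rhoDiff p q t τ)).le_of_opNorm_le_of_le
    ((norm_sobTranslate_le s _).trans (mul_le_mul_of_nonneg_left (h1 _) (by positivity))) (hG τ hτ)
  calc _ ≤ |p.eval τ|⁻¹ * _ := mul_le_mul_of_nonneg_left h3 (by positivity)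
    _ = _ := by ring

/-- Tested on `φ`, the solution is a primitive in time evaluated at the shift parameter `-ρ(t)`. Its
derivative consists of the integrand at `τ = t`, where the translation is trivial, and of the
derivative in the shift, which is the term `-(q/p) ∂_x u`. -/
theorem solvesField_sobStripInv (h : IsStrip p a b θ) (q : Polynomial ℝ) (s₁ s₂ : ℝ)
    (hG : ContinuousOn G (Ioo a b)) :
    SolvesField p q a b (fun t => sobEmb s₁ s₂ (sobStripInv p q θ s₂ G t))
      (fun t => sobEmb s₁ s₂ (G t)) := by
  intro t ht φ
  have hcont : ∀ φ : 𝓢(ℝ, ℂ), ContinuousOn (fun z : ℝ × ℝ => sobEmb s₁ s₂ (G z.1)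
      (compSubConstCLM ℂ (rhoDiff p q θ z.1 + z.2) φ) / ((p.eval z.1 : ℝ) : ℂ))
      (Ioo a b ×ˢ univ) := fun φ => by
    refine ((pairL2CLM (toL2 (mulWt (-s₂) (bessel (-s₁) φ)))).continuous.comp_continuousOn
      (h.continuousOn_sobTranslate_kernel q s₂ hG)).congr fun z _ => ?_
    simp only [Function.comp_apply, map_smul, ← sobEmb_apply_eq_pairL2CLM, sobEmb_sobTranslate,
      smul_eq_mul]
    rw [div_eq_inv_mul]
  have key := hasDerivAt_parametric_primitive_comp h.mem
    (F := fun τ y => sobEmb s₁ s₂ (G τ)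
      (compSubConstCLM ℂ (rhoDiff p q θ τ + y) φ) / ((p.eval τ : ℝ) : ℂ))
    (F' := fun τ y => -(sobEmb s₁ s₂ (G τ)
      (compSubConstCLM ℂ (rhoDiff p q θ τ + y) (derivCLM ℂ ℂ φ)) / ((p.eval τ : ℝ) : ℂ)))
    (hcont φ) (hcont _).neg (fun τ _ y => by
      rw [← neg_div]; exact (hasDerivAt_sobEmb_translate s₁ s₂ (G τ) φ _ y).div_const _) ht
    (h.hasDerivAt_rhoDiff q ht).neg
  have hu : ∀ ψ : 𝓢(ℝ, ℂ), ∀ s ∈ Ioo a b, sobEmb s₁ s₂ (sobStripInv p q θ s₂ G s) ψ =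
      ∫ τ in θ..s, sobEmb s₁ s₂ (G τ) (compSubConstCLM ℂ
        (rhoDiff p q θ τ + -rhoDiff p q θ s) ψ) / ((p.eval τ : ℝ) : ℂ) := fun ψ s hs => by
    rw [h.sobEmb_sobStripInv q s₁ s₂ hG hs]
    refine intervalIntegral.integral_congr fun τ hτ => ?_
    simp only [h.rhoDiff_eq q hs ((convex_Ioo a b).ordConnected.uIcc_subset h.mem hs hτ),
      sub_eq_add_neg]
  refine ⟨_, key.congr_of_eventuallyEq ?_, ?_⟩
  · filter_upwards [isOpen_Ioo.mem_nhds ht] with s hs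
    exact hu φ s hs
  · have hp : ((p.eval t : ℝ) : ℂ) ≠ 0 := Complex.ofReal_ne_zero.2 (h.ne_zero t ht)
    have hd : TemperedDistribution.derivCLM ℂ (sobEmb s₁ s₂ (sobStripInv p q θ s₂ G t)) φ =
        -sobEmb s₁ s₂ (sobStripInv p q θ s₂ G t) (derivCLM ℂ ℂ φ) := by
      rw [TemperedDistribution.derivCLM_apply_apply, map_neg]
    rw [hd, hu _ t ht, intervalIntegral.integral_neg, Pi.neg_apply, add_neg_cancel,
      compSubConstCLM_zero]
    simp only [ContinuousLinearMap.id_apply, Complex.real_smul]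
    push_cast
    field_simp
    ring

theorem lintegral_enorm_le {ν M : ℝ} {E : Type*} [NormedAddCommGroup E] {u : ℝ → E} (hM : 0 ≤ M)
    (hu : ∀ t ∈ Ioo a b, ‖u t‖ ≤ M * (endWeight a b ν t)⁻¹) :
    ∫⁻ t in Ioo a b, ‖u t‖ₑ ≤
      ENNReal.ofReal M * ∫⁻ t in Ioo a b, ENNReal.ofReal (endWeight a b ν t)⁻¹ := by
  rw [← lintegral_const_mul' _ _ ENNReal.ofReal_ne_top]
  refine setLIntegral_mono' measurableSet_Ioo fun t ht => ?_
  rw [← ENNReal.ofReal_mul hM, ← ofReal_norm]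
  exact ENNReal.ofReal_le_ofReal (hu t ht)

end IsStrip

end Strip

/-! ### Part ii): conclusion in the weighted Sobolev spaces -/

namespace Strip

open SchwartzMap

theorem exists_norm_le_sobSupNorm {s₁ s₂ a b : ℝ} {f : ℝ → 𝓢'(ℝ, ℂ)} {G : ℝ → L2}
    (hG : ContinuousOn G (Icc a b)) (hf : ∀ t ∈ Icc a b, f t = sobEmb s₁ s₂ (G t)) :
    ∃ M : ℝ, 0 ≤ M ∧ ENNReal.ofReal M = sobSupNorm s₁ s₂ a b f ∧ ∀ t ∈ Icc a b, ‖G t‖ ≤ M := by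
  have e : sobSupNorm s₁ s₂ a b f = ⨆ t ∈ Icc a b, ‖G t‖ₑ := by
    unfold sobSupNorm
    refine iSup_congr fun t => iSup_congr fun ht => ?_
    rw [hf t ht, sobNorm_sobEmb]
  obtain ⟨C, hC⟩ := isCompact_Icc.exists_bound_of_continuousOn hG
  have hfin : sobSupNorm s₁ s₂ a b f ≠ ⊤ := by
    rw [e]
    refine ne_top_of_le_ne_top ENNReal.ofReal_ne_top (iSup₂_le fun t ht => ?_) (b := ENNReal.ofReal C)
    rw [← ofReal_norm]
    exact ENNReal.ofReal_le_ofReal (hC t ht)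
  refine ⟨_, ENNReal.toReal_nonneg, ENNReal.ofReal_toReal hfin, fun t ht => ?_⟩
  rw [← toReal_enorm]
  refine ENNReal.toReal_mono hfin ?_
  rw [e]
  exact le_iSup₂ (f := fun t (_ : t ∈ Icc a b) => ‖G t‖ₑ) t ht

theorem norm_le_mul_inv_endWeight {E : Type*} [NormedAddCommGroup E] {a b ν M : ℝ} {G : ℝ → E}
    (hν : 0 ≤ ν) (hM : 0 ≤ M) (hG : ∀ t ∈ Icc a b, ‖G t‖ ≤ M) (t : ℝ) (ht : t ∈ Ioo a b) :
    ‖G t‖ ≤ M * ((b - a) ^ ν * (b - a) ^ ν) * (endWeight a b ν t)⁻¹ := by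
  rw [← div_eq_mul_inv, le_div_iff₀ (endWeight_pos ν ht)]
  have ht' := Ioo_subset_Icc_self ht
  exact mul_le_mul (hG t ht') (endWeight_le hν ht') (endWeight_pos ν ht).le hM

theorem SolvesField.congr {p q : Polynomial ℝ} {a b : ℝ} {u f g : ℝ → 𝓢'(ℝ, ℂ)}
    (hu : SolvesField p q a b u f) (h : ∀ t ∈ Ioo a b, g t = f t) : SolvesField p q a b u g :=
  fun t ht φ => by rw [h t ht]; exact hu t ht φ

namespace IsStrip

variable {p : Polynomial ℝ} {a b θ : ℝ}

theorem eq_sobEmb_sobStripInv (h : IsStrip p a b θ) (q : Polynomial ℝ) {s₁ s₂ : ℝ}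
    {f u : ℝ → 𝓢'(ℝ, ℂ)} {G : ℝ → L2} (hG : ContinuousOn G (Ioo a b))
    (hf : ∀ t ∈ Ioo a b, f t = sobEmb s₁ s₂ (G t)) :
    IsStripInv p q a b θ f u ↔ ∀ t ∈ Ioo a b, u t = sobEmb s₁ s₂ (sobStripInv p q θ s₂ G t) := by
  have key : ∀ t ∈ Ioo a b, ∀ φ : 𝓢(ℝ, ℂ), sobEmb s₁ s₂ (sobStripInv p q θ s₂ G t) φ =
      ∫ τ in θ..t, f τ (compSubConstCLM ℂ (rhoDiff p q t τ) φ) / ((p.eval τ : ℝ) : ℂ) :=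
    fun t ht φ => by
      rw [h.sobEmb_sobStripInv q s₁ s₂ hG ht]
      refine intervalIntegral.integral_congr fun τ hτ => ?_
      simp only [hf τ ((convex_Ioo a b).ordConnected.uIcc_subset h.mem ht hτ)]
  constructor
  · intro H t ht
    ext φ
    rw [H t ht, key t ht]
  · intro H t ht φ
    rw [H t ht, key t ht]

/-- The characteristic integral on the weighted Sobolev spaces. -/
theorem sobolev (h : IsStrip p a b θ) (q : Polynomial ℝ) (s₁ s₂ : ℝ) :
    (∀ f, ContinuousIntoSob s₁ s₂ (Icc a b) f →
      ∃ u, IsStripInv p q a b θ f u ∧ sobL1Norm s₁ s₂ a b u < ⊤ ∧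
        ContinuousIntoSob s₁ s₂ (Ioo a b) u ∧ SolvesField p q a b u f) ∧
    ∀ ε : ℝ, 0 < ε → ∃ C : ℝ≥0, ∀ f u, ContinuousIntoSob s₁ s₂ (Icc a b) f →
      IsStripInv p q a b θ f u → ∀ s ∈ Ioo a b,
        ENNReal.ofReal (|s - a| ^ ε * |s - b| ^ ε) * sobNorm s₁ s₂ (u s) ≤
          C * sobSupNorm s₁ s₂ a b f := by
  have hab : 0 < b - a := by linarith [h.mem.1, h.mem.2]
  constructor
  · intro f hf
    obtain ⟨G, hG, hfG⟩ := hf.exists_continuousOn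
    obtain ⟨M, hM, -, hGM⟩ := exists_norm_le_sobSupNorm hG hfG
    have hG' := hG.mono Ioo_subset_Icc_self
    have hfG' : ∀ t ∈ Ioo a b, f t = sobEmb s₁ s₂ (G t) := fun t ht =>
      hfG t (Ioo_subset_Icc_self ht)
    refine ⟨fun t => sobEmb s₁ s₂ (sobStripInv p q θ s₂ G t),
      (h.eq_sobEmb_sobStripInv q hG' hfG').2 fun _ _ => rfl, ?_,
      continuousIntoSob_sobEmb (h.continuousOn_sobStripInv q s₂ hG'),
      (h.solvesField_sobStripInv q s₁ s₂ hG').congr hfG'⟩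
    -- Any exponent in `]0, 1[` would do: positive for the kernel estimate, below `1` for
    -- integrability.
    obtain ⟨C, hC, hb⟩ := h.exists_norm_sobStripInv_le q s₂ (ν := 1 / 2) (by norm_num)
    simp only [sobL1Norm, sobNorm_sobEmb]
    refine (lintegral_enorm_le (by positivity) (hb G _ (by positivity)
      (norm_le_mul_inv_endWeight (by norm_num) hM hGM))).trans_lt ?_
    exact ENNReal.mul_lt_top ENNReal.ofReal_lt_top
      (lintegral_inv_endWeight_lt_top (by norm_num) (by norm_num))
  · intro ε hε
    obtain ⟨C, hC, hb⟩ := h.exists_norm_sobStripInv_le q s₂ hε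
    refine ⟨Real.toNNReal ((b - a) ^ ε * (b - a) ^ ε * C), fun f u hf hu s hs => ?_⟩
    obtain ⟨G, hG, hfG⟩ := hf.exists_continuousOn
    obtain ⟨M, hM, hMe, hGM⟩ := exists_norm_le_sobSupNorm hG hfG
    change ENNReal.ofReal (endWeight a b ε s) * _ ≤ _
    rw [(h.eq_sobEmb_sobStripInv q (hG.mono Ioo_subset_Icc_self) fun t ht =>
      hfG t (Ioo_subset_Icc_self ht)).1 hu s hs, sobNorm_sobEmb, ← hMe, ← ofReal_norm,
      ← ENNReal.ofReal_mul (endWeight_pos ε hs).le, ← ENNReal.ofReal,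
      ← ENNReal.ofReal_mul (by positivity)]
    refine ENNReal.ofReal_le_ofReal ?_
    have h1 := hb G _ (by positivity) (norm_le_mul_inv_endWeight hε.le hM hGM) s hs
    rw [← div_eq_mul_inv, le_div_iff₀ (endWeight_pos ε hs)] at h1
    rw [mul_comm]
    exact h1.trans (le_of_eq (by ring))

end IsStrip

end Strip

namespace Strip

open SchwartzMap

/-! ### Functions of polynomial growth and jets -/

/-- A function of at most polynomial growth. -/
def PolyBdd (c : ℝ → ℂ) : Prop := ∃ C s : ℝ, 0 ≤ C ∧ ∀ x, ‖c x‖ ≤ C * ‖wt s x‖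

theorem norm_wt_le_of_le {s t : ℝ} (h : s ≤ t) (x : ℝ) : ‖wt s x‖ ≤ ‖wt t x‖ := by
  rw [norm_wt, norm_wt]
  exact Real.rpow_le_rpow_of_exponent_le (by nlinarith [sq_nonneg x]) (by linarith)

theorem PolyBdd.of_bound {c : ℝ → ℂ} {C : ℝ} (h : ∀ x, ‖c x‖ ≤ C) : PolyBdd c :=
  ⟨C, 0, (norm_nonneg _).trans (h 0), fun x => by simpa [wt_zero] using h x⟩

theorem PolyBdd.add {c d : ℝ → ℂ} (hc : PolyBdd c) (hd : PolyBdd d) :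
    PolyBdd fun x => c x + d x := by
  obtain ⟨C, s, hC, h1⟩ := hc
  obtain ⟨D, t, hD, h2⟩ := hd
  refine ⟨C + D, max s t, by positivity, fun x => (norm_add_le _ _).trans ?_⟩
  rw [add_mul]
  exact add_le_add
    ((h1 x).trans (mul_le_mul_of_nonneg_left (norm_wt_le_of_le (le_max_left s t) x) hC))
    ((h2 x).trans (mul_le_mul_of_nonneg_left (norm_wt_le_of_le (le_max_right s t) x) hD))

theorem PolyBdd.mul {c d : ℝ → ℂ} (hc : PolyBdd c) (hd : PolyBdd d) :
    PolyBdd fun x => c x * d x := by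
  obtain ⟨C, s, hC, h1⟩ := hc
  obtain ⟨D, t, hD, h2⟩ := hd
  refine ⟨C * D, s + t, by positivity, fun x => ?_⟩
  rw [norm_mul, ← wt_mul_wt, norm_mul]
  calc _ ≤ (C * ‖wt s x‖) * (D * ‖wt t x‖) := by gcongr; exacts [h1 x, h2 x]
    _ = _ := by ring

theorem PolyBdd.integrable_mul {c : ℝ → ℂ} (hc : PolyBdd c) (hc' : Continuous c) (φ : 𝓢(ℝ, ℂ)) :
    Integrable fun x => φ x * c x := by
  obtain ⟨C, s, hC, h1⟩ := hc
  refine ((mulWt s φ).integrable.norm.const_mul C).mono'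
    (φ.continuous.mul hc').aestronglyMeasurable (Eventually.of_forall fun x => ?_)
  rw [norm_mul, mulWt_apply, norm_mul]
  calc _ ≤ ‖φ x‖ * (C * ‖wt s x‖) := by gcongr; exact h1 x
    _ = _ := by ring

/-- A jet of a function on `ℝ`: the sequence of its derivatives, all of polynomial growth. -/
structure IsJet (c : ℕ → ℝ → ℂ) : Prop where
  hasDerivAt : ∀ k x, HasDerivAt (c k) (c (k + 1) x) x
  polyBdd : ∀ k, PolyBdd (c k)

theorem IsJet.continuous {c : ℕ → ℝ → ℂ} (hc : IsJet c) (k : ℕ) : Continuous (c k) :=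
  continuous_iff_continuousAt.2 fun x => (hc.hasDerivAt k x).continuousAt

/-- The jet of `c + c'`. -/
def jetStep (c : ℕ → ℝ → ℂ) : ℕ → ℝ → ℂ := fun k x => c k x + c (k + 1) x

theorem IsJet.jetStep {c : ℕ → ℝ → ℂ} (hc : IsJet c) : IsJet (jetStep c) :=
  ⟨fun k x => (hc.hasDerivAt k x).add (hc.hasDerivAt (k + 1) x),
    fun k => (hc.polyBdd k).add (hc.polyBdd (k + 1))⟩

theorem norm_iterate_jetStep_le {c : ℕ → ℝ → ℂ} {N k : ℕ} {x B : ℝ}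
    (h : ∀ i ≤ N, ‖c (k + i) x‖ ≤ B) : ‖(jetStep^[N] c) k x‖ ≤ 2 ^ N * B := by
  induction N generalizing c B with
  | zero => simpa using h 0 le_rfl
  | succ N ih =>
    rw [Function.iterate_succ_apply]
    refine (ih (B := B + B) fun i hi => ?_).trans (le_of_eq (by ring))
    exact (norm_add_le _ _).trans (add_le_add (h i (by omega)) (h (i + 1) (by omega)))

/-- The jet of a product. -/
def jetMul : ℕ → (ℕ → ℝ → ℂ) → (ℕ → ℝ → ℂ) → ℝ → ℂ
  | 0, c, d => fun x => c 0 x * d 0 x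
  | n + 1, c, d => fun x => jetMul n (fun k => c (k + 1)) d x + jetMul n c (fun k => d (k + 1)) x

theorem hasDerivAt_jetMul {c d : ℕ → ℝ → ℂ} (hc : ∀ k x, HasDerivAt (c k) (c (k + 1) x) x)
    (hd : ∀ k x, HasDerivAt (d k) (d (k + 1) x) x) (n : ℕ) (x : ℝ) :
    HasDerivAt (jetMul n c d) (jetMul (n + 1) c d x) x := by
  induction n generalizing c d with
  | zero => exact (hc 0 x).mul (hd 0 x)
  | succ n ih => exact (ih (fun k => hc (k + 1)) hd).add (ih hc fun k => hd (k + 1))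

theorem polyBdd_jetMul {c d : ℕ → ℝ → ℂ} (hc : ∀ k, PolyBdd (c k)) (hd : ∀ k, PolyBdd (d k))
    (n : ℕ) : PolyBdd (jetMul n c d) := by
  induction n generalizing c d with
  | zero => exact (hc 0).mul (hd 0)
  | succ n ih => exact (ih (fun k => hc (k + 1)) hd).add (ih hc fun k => hd (k + 1))

theorem IsJet.jetMul {c d : ℕ → ℝ → ℂ} (hc : IsJet c) (hd : IsJet d) :
    IsJet fun n => Strip.jetMul n c d :=
  ⟨hasDerivAt_jetMul hc.hasDerivAt hd.hasDerivAt, polyBdd_jetMul hc.polyBdd hd.polyBdd⟩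

theorem norm_jetMul_le {c d : ℕ → ℝ → ℂ} {n : ℕ} {x B D : ℝ} (hB : ∀ i ≤ n, ‖c i x‖ ≤ B)
    (hD : ∀ i ≤ n, ‖d i x‖ ≤ D) : ‖jetMul n c d x‖ ≤ 2 ^ n * (B * D) := by
  have hB0 : 0 ≤ B := (norm_nonneg _).trans (hB 0 n.zero_le)
  induction n generalizing c d with
  | zero =>
    simp only [jetMul, norm_mul, pow_zero, one_mul]
    gcongr
    exacts [hB 0 le_rfl, hD 0 le_rfl]
  | succ n ih =>
    refine (norm_add_le _ _).trans ?_
    have h1 := ih (c := fun k => c (k + 1)) (d := d) (fun i hi => hB _ (by omega))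
      fun i hi => hD _ (by omega)
    have h2 := ih (c := c) (d := fun k => d (k + 1)) (fun i hi => hB _ (by omega))
      fun i hi => hD _ (by omega)
    rw [pow_succ]
    linarith

/-! ### Jets of powers -/

theorem one_add_I_mul_mem_slitPlane (c x : ℝ) : 1 + Complex.I * (c * x) ∈ Complex.slitPlane := by
  left; simp

/-- The jet of `(1 + i c x)^σ`. -/
noncomputable def powJet (c σ : ℝ) : ℕ → ℝ → ℂ := fun k x =>
  (∏ i ∈ Finset.range k, ((σ : ℂ) - i) * (Complex.I * c)) *
    (1 + Complex.I * (c * x)) ^ (((σ - k : ℝ)) : ℂ)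

theorem hasDerivAt_powJet (c σ : ℝ) (k : ℕ) (x : ℝ) :
    HasDerivAt (powJet c σ k) (powJet c σ (k + 1) x) x := by
  have h0 : HasDerivAt (fun z : ℂ => 1 + Complex.I * ((c : ℂ) * z)) (Complex.I * c) (x : ℂ) := by
    simpa using (((hasDerivAt_id (x : ℂ)).const_mul (c : ℂ)).const_mul Complex.I).const_add 1
  have h1 := (h0.cpow_const (c := ((σ - k : ℝ) : ℂ))
    (one_add_I_mul_mem_slitPlane c x)).comp_ofReal.const_mul (∏ i ∈ Finset.range k, ((σ : ℂ) - i) * (Complex.I * c))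
  refine h1.congr_deriv ?_
  rw [powJet, Finset.prod_range_succ]
  have e : ((σ - (k + 1 : ℕ) : ℝ) : ℂ) = ((σ - k : ℝ) : ℂ) - 1 := by push_cast; ring
  rw [e]
  push_cast
  ring

theorem norm_one_add_I_mul (c x : ℝ) :
    ‖(1 + Complex.I * (c * x) : ℂ)‖ = (1 + (c * x) ^ 2) ^ (1 / 2 : ℝ) := by
  rw [← Real.sqrt_eq_rpow, Complex.norm_def, Complex.normSq_apply]
  congr 1
  simp
  ring

theorem norm_one_add_I_mul_cpow (c σ x : ℝ) :
    ‖(1 + Complex.I * (c * x) : ℂ) ^ ((σ : ℝ) : ℂ)‖ = ‖wt σ (c * x)‖ := by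
  have h0 : (1 + Complex.I * (c * x) : ℂ) ≠ 0 :=
    Complex.slitPlane_ne_zero (one_add_I_mul_mem_slitPlane c x)
  rw [Complex.norm_cpow_of_ne_zero h0, Complex.ofReal_im, mul_zero, Real.exp_zero, div_one,
    Complex.ofReal_re, norm_one_add_I_mul, norm_wt, ← Real.rpow_mul (by positivity)]
  congr 1
  ring

theorem exists_norm_powJet_le (c σ : ℝ) (k : ℕ) :
    ∃ C : ℝ, 0 ≤ C ∧ ∀ x, ‖powJet c σ k x‖ ≤ C * ‖wt σ (c * x)‖ := by
  refine ⟨‖∏ i ∈ Finset.range k, ((σ : ℂ) - i) * (Complex.I * c)‖, norm_nonneg _, fun x => ?_⟩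
  rw [powJet, norm_mul, norm_one_add_I_mul_cpow]
  gcongr
  exact norm_wt_le_of_le (by linarith [(Nat.cast_nonneg k : (0 : ℝ) ≤ k)]) _

/-- The two factors are complex conjugates of each other, so their product is a power of `|1 + icx|²
= 1 + (cx)²`. Each factor is a power of an affine function with explicit derivatives of every order,
and Leibniz' rule then handles the weight. -/
theorem powJet_mul_powJet_neg (c s x : ℝ) :
    powJet c (s / 2) 0 x * powJet (-c) (s / 2) 0 x = wt s (c * x) := by
  have h0 := Complex.slitPlane_arg_ne_pi (one_add_I_mul_mem_slitPlane c x)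
  have e : (1 + Complex.I * (((-c : ℝ) : ℂ) * x) : ℂ) =
      (starRingEnd ℂ) (1 + Complex.I * (c * x)) := by simp
  have e2 : ((s / 2 : ℝ) : ℂ) = (starRingEnd ℂ) ((s / 2 : ℝ) : ℂ) := (Complex.conj_ofReal _).symm
  simp only [powJet, Finset.range_zero, Finset.prod_empty, one_mul, Nat.cast_zero, sub_zero]
  rw [e, e2, Complex.conj_cpow _ _ h0, Complex.conj_conj, ← e2, Complex.mul_conj,
    Complex.normSq_eq_norm_sq, norm_one_add_I_mul_cpow, norm_wt, wt, ← Real.rpow_natCast,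
    ← Real.rpow_mul (by positivity)]
  congr 2
  push_cast
  ring

/-- The jet of the symbol of `⟨D⟩^s`. -/
noncomputable def wtDJet (s : ℝ) : ℕ → ℝ → ℂ := fun n =>
  jetMul n (powJet (2 * Real.pi) (s / 2)) (powJet (-(2 * Real.pi)) (s / 2))

theorem wtDJet_zero (s x : ℝ) : wtDJet s 0 x = wtD s x := powJet_mul_powJet_neg _ s x

theorem hasDerivAt_wtDJet (s : ℝ) (k : ℕ) (x : ℝ) :
    HasDerivAt (wtDJet s k) (wtDJet s (k + 1) x) x :=
  hasDerivAt_jetMul (hasDerivAt_powJet _ _) (hasDerivAt_powJet _ _) k x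

/-- Differentiating either factor lowers its exponent, so up to a constant its size does not grow;
Leibniz' rule does the rest. Derivatives of the weight are thus absorbed by the weight itself. -/
theorem exists_norm_wtDJet_le (s : ℝ) (n : ℕ) :
    ∃ C : ℝ, 0 ≤ C ∧ ∀ k ≤ n, ∀ x, ‖wtDJet s k x‖ ≤ C * ‖wtD s x‖ := by
  choose C hC h1 using exists_norm_powJet_le (2 * Real.pi) (s / 2)
  choose D hD h2 using exists_norm_powJet_le (-(2 * Real.pi)) (s / 2)
  have hsum : ∀ {F : ℕ → ℝ}, (∀ i, 0 ≤ F i) → ∀ i ≤ n, F i ≤ ∑ j ∈ Finset.range (n + 1), F j :=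
    fun hF i hi => Finset.single_le_sum (fun j _ => hF j) (Finset.mem_range.2 (by omega))
  refine ⟨2 ^ n * ((∑ j ∈ Finset.range (n + 1), C j) * ∑ j ∈ Finset.range (n + 1), D j),
    mul_nonneg (by positivity) (mul_nonneg (Finset.sum_nonneg fun i _ => hC i)
      (Finset.sum_nonneg fun i _ => hD i)), fun k hk x => ?_⟩
  have e : ‖wtD s x‖ = ‖wt (s / 2) (2 * Real.pi * x)‖ * ‖wt (s / 2) (2 * Real.pi * x)‖ := by
    rw [wtD_eq, ← norm_mul, wt_mul_wt, add_halves]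
  have e2 : ‖wt (s / 2) (-(2 * Real.pi) * x)‖ = ‖wt (s / 2) (2 * Real.pi * x)‖ := by
    rw [norm_wt, norm_wt, neg_mul, neg_sq]
  refine (norm_jetMul_le (B := (∑ j ∈ Finset.range (n + 1), C j) * ‖wt (s / 2) (2 * Real.pi * x)‖)
    (D := (∑ j ∈ Finset.range (n + 1), D j) * ‖wt (s / 2) (2 * Real.pi * x)‖) ?_ ?_).trans ?_
  · exact fun i hi => (h1 i x).trans (mul_le_mul_of_nonneg_right (hsum hC i (by omega))
      (norm_nonneg _))
  · exact fun i hi => (h2 i x).trans (by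
      rw [e2]; exact mul_le_mul_of_nonneg_right (hsum hD i (by omega)) (norm_nonneg _))
  · rw [e]
    have h3 : (2 : ℝ) ^ k ≤ 2 ^ n := pow_le_pow_right₀ (by norm_num) hk
    have h4 : 0 ≤ (∑ j ∈ Finset.range (n + 1), C j) := Finset.sum_nonneg fun i _ => hC i
    have h5 : 0 ≤ (∑ j ∈ Finset.range (n + 1), D j) := Finset.sum_nonneg fun i _ => hD i
    calc _ ≤ 2 ^ n * _ := mul_le_mul_of_nonneg_right h3 (by positivity)
      _ = _ := by ring

theorem polyBdd_wtD (s : ℝ) : PolyBdd (wtD s) := by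
  refine ⟨((2 * Real.pi) ^ 2) ^ (|s| / 2), |s|, by positivity, fun x => ?_⟩
  rw [wtD_eq]
  refine (norm_wt_le_of_le (le_abs_self s) _).trans ?_
  rw [norm_wt, norm_wt, ← Real.mul_rpow (by positivity) (by positivity)]
  refine Real.rpow_le_rpow (by positivity) ?_ (by positivity)
  have : 1 ≤ (2 * Real.pi) ^ 2 := by nlinarith [Real.pi_gt_three]
  nlinarith

theorem isJet_wtDJet (s : ℝ) : IsJet (wtDJet s) := by
  refine ⟨hasDerivAt_wtDJet s, fun k => ?_⟩
  obtain ⟨C, hC, h⟩ := exists_norm_wtDJet_le s k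
  obtain ⟨D, t, hD, h'⟩ := polyBdd_wtD s
  refine ⟨C * D, t, by positivity, fun x => (h k le_rfl x).trans ?_⟩
  rw [mul_assoc]
  exact mul_le_mul_of_nonneg_left (h' x) hC

end Strip

namespace Strip

open SchwartzMap

/-! ### Windows -/

theorem one_sub_ne_zero (x y : ℝ) : (1 - 2 * Real.pi * Complex.I * (x - y) : ℂ) ≠ 0 := fun h => by
  have := congrArg Complex.re h
  simp at this

/-- The window `(1 - 2πi (x - y))^{-N}`. -/
noncomputable def win (N : ℕ) (x y : ℝ) : ℂ := ((1 - 2 * Real.pi * Complex.I * (x - y) : ℂ)⁻¹) ^ N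

theorem norm_win (N : ℕ) (x y : ℝ) : ‖win N x y‖ = ‖wtD (-N) (x - y)‖ := by
  have e : (1 - 2 * Real.pi * Complex.I * (x - y) : ℂ) =
      1 + Complex.I * ((-(2 * Real.pi) : ℝ) * (x - y : ℝ)) := by push_cast; ring
  rw [win, norm_pow, norm_inv, e, norm_one_add_I_mul, wtD_eq, norm_wt, ← Real.rpow_neg_one,
    ← Real.rpow_mul (by positivity), ← Real.rpow_natCast, ← Real.rpow_mul (by positivity)]
  congr 1
  · ring
  · ring

theorem win_add (N M : ℕ) (x y : ℝ) : win (N + M) x y = win N x y * win M x y := pow_add _ _ _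

theorem norm_win_le_one (N : ℕ) (x y : ℝ) : ‖win N x y‖ ≤ 1 := by
  rw [norm_win, wtD_eq]
  refine (norm_wt_le_of_le (t := 0) (by simp) _).trans ?_
  simp [wt_zero]

theorem norm_win_add_le (N k : ℕ) (x y : ℝ) : ‖win (N + k) x y‖ ≤ ‖win N x y‖ := by
  rw [win_add, norm_mul]
  exact mul_le_of_le_one_right (norm_nonneg _) (norm_win_le_one k x y)

theorem hasDerivAt_win_left (N : ℕ) (x y : ℝ) :
    HasDerivAt (fun x => win N x y) (2 * Real.pi * Complex.I * N * win (N + 1) x y) x := by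
  have h0 : HasDerivAt (fun z : ℂ => 1 - 2 * Real.pi * Complex.I * (z - y))
      (-(2 * Real.pi * Complex.I)) (x : ℂ) := by
    simpa using (((hasDerivAt_id (x : ℂ)).sub_const (y : ℂ)).const_mul
      (2 * Real.pi * Complex.I)).const_sub 1
  have h1 := ((h0.inv (one_sub_ne_zero x y)).pow N).comp_ofReal
  refine h1.congr_deriv ?_
  rcases N with - | N
  · simp
  · simp only [Pi.inv_apply, neg_neg, Nat.add_sub_cancel, win]
    rw [div_eq_mul_inv, ← inv_pow]
    ring

theorem hasDerivAt_win_right (N : ℕ) (x y : ℝ) :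
    HasDerivAt (win N x) (-(2 * Real.pi * Complex.I * N * win (N + 1) x y)) y := by
  have e : win N x = fun y' => (fun x' => win N x' 0) (x - y') := by
    ext y'; simp [win]
  rw [e]
  have h1 := (hasDerivAt_win_left N (x - y) 0).scomp y ((hasDerivAt_id y).const_sub x)
  refine h1.congr_deriv ?_
  simp [win]

theorem continuous_win_left (N : ℕ) (y : ℝ) : Continuous fun x => win N x y :=
  continuous_iff_continuousAt.2 fun x => (hasDerivAt_win_left N x y).continuousAt

theorem continuous_win_right (N : ℕ) (x : ℝ) : Continuous (win N x) :=
  continuous_iff_continuousAt.2 fun y => (hasDerivAt_win_right N x y).continuousAt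

/-- With `z = 2π(x - y)`, the identity `1/(1 - iz) = (1 + iz)/(1 + z²)` writes the window as a
polynomial times the weight of exponent `-2`; powers follow. -/
theorem hasTemperateGrowth_win (N : ℕ) (x : ℝ) : (win N x).HasTemperateGrowth := by
  have h1 : (fun y : ℝ => (1 - 2 * Real.pi * Complex.I * (x - y) : ℂ)⁻¹).HasTemperateGrowth := by
    have e : (fun y : ℝ => (1 - 2 * Real.pi * Complex.I * (x - y) : ℂ)⁻¹) = fun y : ℝ =>
        (1 + 2 * Real.pi * Complex.I * (x - y) : ℂ) * wtD (-2) (y - x) := by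
      ext y
      have h0 := one_sub_ne_zero x y
      have h2 : wtD (-2) (y - x) = (1 + (2 * Real.pi * (x - y) : ℂ) ^ 2)⁻¹ := by
        rw [wtD_eq, wt, show (-2 / 2 : ℝ) = -1 by norm_num, Real.rpow_neg_one]
        push_cast
        ring
      have h3 : (1 + (2 * Real.pi * (x - y) : ℂ) ^ 2) = (1 + 2 * Real.pi * Complex.I * (x - y)) *
          (1 - 2 * Real.pi * Complex.I * (x - y)) := by
        ring_nf
        rw [Complex.I_sq]
        ring
      have h4 : (1 + 2 * Real.pi * Complex.I * (x - y) : ℂ) ≠ 0 := by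
        have := one_sub_ne_zero y x
        convert this using 1
        ring
      rw [h2, h3, mul_inv, ← mul_assoc, mul_inv_cancel₀ h4, one_mul]
    rw [e]
    refine Function.HasTemperateGrowth.mul ?_ ?_
    · have h2 : (fun _ : ℝ => (1 + 2 * Real.pi * Complex.I * x : ℂ)).HasTemperateGrowth :=
        Function.HasTemperateGrowth.const _
      have h3 : (fun y : ℝ => (2 * Real.pi * Complex.I : ℂ) * (y : ℂ)).HasTemperateGrowth :=
        (Function.HasTemperateGrowth.const _).mul Complex.ofRealCLM.hasTemperateGrowth
      have e2 : (fun y : ℝ => (1 + 2 * Real.pi * Complex.I * (x - y) : ℂ)) =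
          (fun _ => (1 + 2 * Real.pi * Complex.I * x : ℂ)) -
            fun y : ℝ => (2 * Real.pi * Complex.I : ℂ) * (y : ℂ) := by
        ext y
        simp only [Pi.sub_apply]
        ring
      rw [e2]
      exact h2.sub h3
    · exact (hasTemperateGrowth_wtD (-2)).comp
        ((Function.HasTemperateGrowth.id').sub (Function.HasTemperateGrowth.const x))
  exact h1.pow N

/-- Multiplication by a window. -/
noncomputable def mulWin (N : ℕ) (x : ℝ) : 𝓢(ℝ, ℂ) →L[ℂ] 𝓢(ℝ, ℂ) := smulLeftCLM ℂ (win N x)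

theorem mulWin_apply (N : ℕ) (x : ℝ) (h : 𝓢(ℝ, ℂ)) (y : ℝ) : mulWin N x h y = win N x y * h y :=
  smulLeftCLM_apply_apply (hasTemperateGrowth_win N x) h y

theorem mulWin_mulWin (N M : ℕ) (x : ℝ) (h : 𝓢(ℝ, ℂ)) :
    mulWin N x (mulWin M x h) = mulWin (N + M) x h := by
  ext y
  simp only [mulWin_apply, win_add, mul_assoc]

theorem mulWin_zero (x : ℝ) (h : 𝓢(ℝ, ℂ)) : mulWin 0 x h = h := by
  ext y
  simp [mulWin_apply, win]

/-- The coefficients of the derivatives of windows. -/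
noncomputable def winCoeff (N k : ℕ) : ℂ := ∏ i ∈ Finset.range k, (2 * Real.pi * Complex.I * (N + i))

theorem winCoeff_zero (N : ℕ) : winCoeff N 0 = 1 := by simp [winCoeff]

theorem winCoeff_succ (N k : ℕ) :
    winCoeff N (k + 1) = winCoeff N k * (2 * Real.pi * Complex.I * ((N + k : ℕ) : ℂ)) := by
  rw [winCoeff, Finset.prod_range_succ]
  push_cast
  rfl

theorem exists_norm_winCoeff_le (N n : ℕ) : ∃ C : ℝ, 0 ≤ C ∧ ∀ k ≤ n, ‖winCoeff N k‖ ≤ C :=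
  ⟨∑ j ∈ Finset.range (n + 1), ‖winCoeff N j‖, Finset.sum_nonneg fun _ _ => norm_nonneg _,
    fun k hk => Finset.single_le_sum (f := fun j => ‖winCoeff N j‖) (fun _ _ => norm_nonneg _)
      (Finset.mem_range.2 (by omega))⟩

/-- The jet of a window. -/
noncomputable def winJet (N : ℕ) (x : ℝ) : ℕ → ℝ → ℂ := fun k y =>
  (-1) ^ k * winCoeff N k * win (N + k) x y

theorem isJet_winJet (N : ℕ) (x : ℝ) : IsJet (winJet N x) := by
  refine ⟨fun k y => ?_, fun k => ?_⟩
  · refine ((hasDerivAt_win_right (N + k) x y).const_mul ((-1) ^ k * winCoeff N k)).congr_deriv ?_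
    rw [winJet, winCoeff_succ, pow_succ, add_assoc]
    ring
  · refine PolyBdd.of_bound (C := ‖winCoeff N k‖) fun y => ?_
    rw [winJet, norm_mul, norm_mul, norm_pow, norm_neg, norm_one, one_pow, one_mul]
    exact mul_le_of_le_one_right (norm_nonneg _) (norm_win_le_one _ _ _)

/-! ### Integration by parts in oscillatory integrals -/

/-- The oscillating factor `e^{2πi x ξ}`. -/
noncomputable def osc (x ξ : ℝ) : ℂ := Complex.exp (2 * Real.pi * Complex.I * x * ξ)

theorem norm_osc (x ξ : ℝ) : ‖osc x ξ‖ = 1 := by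
  rw [osc, Complex.norm_exp]
  simp

theorem continuous_osc : Continuous fun z : ℝ × ℝ => osc z.1 z.2 := by
  unfold osc; fun_prop

theorem continuous_osc_right (x : ℝ) : Continuous (osc x) := by
  unfold osc; fun_prop

theorem osc_comm (x ξ : ℝ) : osc x ξ = osc ξ x := by
  unfold osc; ring_nf

theorem hasDerivAt_osc (x ξ : ℝ) :
    HasDerivAt (osc x) (2 * Real.pi * Complex.I * x * osc x ξ) ξ := by
  have h0 : HasDerivAt (fun z : ℂ => 2 * Real.pi * Complex.I * x * z)
      (2 * Real.pi * Complex.I * x) (ξ : ℂ) := by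
    simpa using (hasDerivAt_id (ξ : ℂ)).const_mul (2 * Real.pi * Complex.I * x)
  refine h0.cexp.comp_ofReal.congr_deriv ?_
  rw [osc]
  ring

theorem fourier_eq_integral_osc (h : 𝓢(ℝ, ℂ)) (x : ℝ) : 𝓕 h x = ∫ y, osc (-x) y * h y := by
  rw [fourier_coe, Real.fourier_eq']
  congr 1
  ext y
  rw [smul_eq_mul, osc]
  congr 2
  simp
  ring

theorem hasDerivAt_fourier (h : 𝓢(ℝ, ℂ)) (ξ : ℝ) :
    HasDerivAt (𝓕 h : 𝓢(ℝ, ℂ)) (𝓕 (-(2 * Real.pi * Complex.I) • mulX h) ξ) ξ := by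
  rw [← deriv_fourier, derivCLM_apply]
  exact (𝓕 h : 𝓢(ℝ, ℂ)).differentiableAt.hasDerivAt

/-- This is the factorization `h = (1 - 2πi(x - y)) · win · h` after Fourier transformation, where
multiplication by `2πi y` becomes `-d/dξ`. -/
theorem fourier_eq_sub_deriv (h : 𝓢(ℝ, ℂ)) (x ξ : ℝ) :
    𝓕 h ξ = (1 - 2 * Real.pi * Complex.I * x) * 𝓕 (mulWin 1 x h) ξ -
      𝓕 (-(2 * Real.pi * Complex.I) • mulX (mulWin 1 x h)) ξ := by
  have e : h = (1 - 2 * Real.pi * Complex.I * x : ℂ) • mulWin 1 x h -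
      (-(2 * Real.pi * Complex.I) : ℂ) • mulX (mulWin 1 x h) := by
    ext y
    have h0 := one_sub_ne_zero x y
    simp only [sub_apply, smul_apply, mulX_apply, mulWin_apply, win, pow_one, smul_eq_mul]
    field_simp
    ring
  have h2 : 𝓕 h = (1 - 2 * Real.pi * Complex.I * x : ℂ) • 𝓕 (mulWin 1 x h) -
      𝓕 (-(2 * Real.pi * Complex.I) • mulX (mulWin 1 x h)) := by
    conv_lhs => rw [e]
    rw [← FourierTransform.fourierCLM_apply (R := ℂ), map_sub, map_smul]
    rfl
  rw [h2]
  rfl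

/-- By `fourier_eq_sub_deriv`, `e^{2πixξ} 𝓕h` equals `1 - d/dξ` applied to `e^{2πixξ} 𝓕(win · h)`.
Moving the operator onto the amplitude gives `c + c'`: one derivative of the amplitude is exchanged
for one power of decay away from `x`. -/
theorem integral_osc_fourier_mul {c c' : ℝ → ℂ} (hd : ∀ ξ, HasDerivAt c (c' ξ) ξ)
    (hc : PolyBdd c) (hc' : PolyBdd c') (hcont : Continuous c') (x : ℝ) (h : 𝓢(ℝ, ℂ)) :
    ∫ ξ, osc x ξ * 𝓕 h ξ * c ξ = ∫ ξ, osc x ξ * 𝓕 (mulWin 1 x h) ξ * (c ξ + c' ξ) := by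
  have hcc : Continuous c := continuous_iff_continuousAt.2 fun ξ => (hd ξ).continuousAt
  set g : 𝓢(ℝ, ℂ) := 𝓕 (mulWin 1 x h) with hg
  set g' : 𝓢(ℝ, ℂ) := 𝓕 (-(2 * Real.pi * Complex.I) • mulX (mulWin 1 x h)) with hg'
  have hI : ∀ (φ : 𝓢(ℝ, ℂ)) {d : ℝ → ℂ}, PolyBdd d → Continuous d →
      Integrable fun ξ => osc x ξ * φ ξ * d ξ := fun φ d hd hdc => by
    have h1 := hd.integrable_mul hdc φ
    refine h1.norm.mono' (((continuous_osc_right x).mul φ.continuous).mul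
      hdc).aestronglyMeasurable (Eventually.of_forall fun ξ => ?_)
    rw [norm_mul, norm_mul, norm_osc, one_mul, norm_mul]
  have hv : ∀ ξ, HasDerivAt (fun ξ => osc x ξ * g ξ)
      (2 * Real.pi * Complex.I * x * osc x ξ * g ξ + osc x ξ * g' ξ) ξ := fun ξ =>
    (hasDerivAt_osc x ξ).mul (hasDerivAt_fourier (mulWin 1 x h) ξ)
  have key := integral_mul_deriv_eq_deriv_mul_of_integrable (u := c) (u' := c')
    (v := fun ξ => osc x ξ * g ξ)
    (v' := fun ξ => 2 * Real.pi * Complex.I * x * osc x ξ * g ξ + osc x ξ * g' ξ)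
    (fun ξ _ => hd ξ) (fun ξ _ => hv ξ)
    (by
      refine (((hI g hc hcc).const_mul (2 * Real.pi * Complex.I * x)).add (hI g' hc hcc)).congr
        (Eventually.of_forall fun ξ => ?_)
      simp only [Pi.add_apply, Pi.mul_apply]
      ring)
    ((hI g hc' hcont).congr (Eventually.of_forall fun ξ => by simp only [Pi.mul_apply]; ring))
    ((hI g hc hcc).congr (Eventually.of_forall fun ξ => by simp only [Pi.mul_apply]; ring))
  have e1 : ∫ ξ, osc x ξ * 𝓕 h ξ * c ξ = (∫ ξ, osc x ξ * g ξ * c ξ) -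
      ∫ ξ, c ξ * (2 * Real.pi * Complex.I * x * osc x ξ * g ξ + osc x ξ * g' ξ) := by
    rw [← integral_sub (hI g hc hcc)]
    · congr 1
      ext ξ
      rw [fourier_eq_sub_deriv h x ξ]
      ring
    · refine (((hI g hc hcc).const_mul (2 * Real.pi * Complex.I * x)).add (hI g' hc hcc)).congr
        (Eventually.of_forall fun ξ => ?_)
      simp only [Pi.add_apply]
      ring
  rw [e1, key, sub_neg_eq_add]
  have e2 : ∀ ξ, osc x ξ * g ξ * (c ξ + c' ξ) = osc x ξ * g ξ * c ξ + osc x ξ * g ξ * c' ξ :=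
    fun ξ => by ring
  simp only [e2]
  rw [integral_add (hI g hc hcc) (hI g hc' hcont)]
  congr 2
  ext ξ
  ring

/-- Integration by parts against a jet. -/
theorem IsJet.integral_osc_fourier_mul {c : ℕ → ℝ → ℂ} (hc : IsJet c) (N : ℕ) (x : ℝ)
    (h : 𝓢(ℝ, ℂ)) : ∫ ξ, osc x ξ * 𝓕 h ξ * c 0 ξ =
      ∫ ξ, osc x ξ * 𝓕 (mulWin N x h) ξ * (Strip.jetStep^[N] c) 0 ξ := by
  induction N generalizing c h with
  | zero => simp [mulWin_zero]
  | succ N ih =>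
    rw [Strip.integral_osc_fourier_mul (hc.hasDerivAt 0) (hc.polyBdd 0) (hc.polyBdd 1)
      (hc.continuous 1), Function.iterate_succ_apply, ← mulWin_mulWin]
    exact ih hc.jetStep (mulWin 1 x h)

end Strip

namespace Strip

open SchwartzMap

/-! ### Symbols and their operators on `𝓢(ℝ)` -/

/-- The family of the mixed derivatives `∂_x^α ∂_ξ^β` of a symbol, all of them bounded. -/
structure IsSymbolJet (a : ℕ → ℕ → ℝ → ℝ → ℂ) : Prop where
  hasDerivAt_left : ∀ α β x ξ, HasDerivAt (fun x => a α β x ξ) (a (α + 1) β x ξ) x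
  hasDerivAt_right : ∀ α β x ξ, HasDerivAt (a α β x) (a α (β + 1) x ξ) ξ
  bounded : ∀ α β, ∃ C : ℝ, ∀ x ξ, ‖a α β x ξ‖ ≤ C
  continuous : ∀ α β, Continuous fun z : ℝ × ℝ => a α β z.1 z.2

/-- `∫ e^{2πi x ξ} σ(x, ξ) φ(x) dx`. -/
noncomputable def pseudoFun (σ : ℝ → ℝ → ℂ) (φ : 𝓢(ℝ, ℂ)) (ξ : ℝ) : ℂ :=
  ∫ x, osc x ξ * σ x ξ * φ x

namespace IsSymbolJet

variable {a : ℕ → ℕ → ℝ → ℝ → ℂ}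

theorem continuous_left (ha : IsSymbolJet a) (α β : ℕ) (ξ : ℝ) :
    Continuous fun x => a α β x ξ :=
  continuous_iff_continuousAt.2 fun x => (ha.hasDerivAt_left α β x ξ).continuousAt

theorem continuous_integrand (ha : IsSymbolJet a) (α β : ℕ) (φ : 𝓢(ℝ, ℂ)) (ξ : ℝ) :
    Continuous fun x => osc x ξ * a α β x ξ * φ x := by
  have h1 : Continuous fun x => osc x ξ := by simp only [osc_comm _ ξ]; exact continuous_osc_right ξ
  exact (h1.mul (ha.continuous_left α β ξ)).mul φ.continuous

theorem norm_integrand_le {C : ℝ} {α β : ℕ} (hC : ∀ x ξ, ‖a α β x ξ‖ ≤ C) (φ : 𝓢(ℝ, ℂ)) (x ξ : ℝ) :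
    ‖osc x ξ * a α β x ξ * φ x‖ ≤ C * ‖φ x‖ := by
  rw [norm_mul, norm_mul, norm_osc, one_mul]
  gcongr
  exact hC x ξ

theorem integrable_integrand (ha : IsSymbolJet a) (α β : ℕ) (φ : 𝓢(ℝ, ℂ)) (ξ : ℝ) :
    Integrable fun x => osc x ξ * a α β x ξ * φ x := by
  obtain ⟨C, hC⟩ := ha.bounded α β
  exact (φ.integrable.norm.const_mul C).mono' (ha.continuous_integrand α β φ ξ).aestronglyMeasurable
    (Eventually.of_forall fun x => norm_integrand_le hC φ x ξ)

theorem exists_norm_pseudoFun_le (ha : IsSymbolJet a) (α β : ℕ) (φ : 𝓢(ℝ, ℂ)) :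
    ∃ C : ℝ, ∀ ξ, ‖pseudoFun (a α β) φ ξ‖ ≤ C := by
  obtain ⟨C, hC⟩ := ha.bounded α β
  exact ⟨∫ x, C * ‖φ x‖, fun ξ => norm_integral_le_of_norm_le (φ.integrable.norm.const_mul C)
    (Eventually.of_forall fun x => norm_integrand_le hC φ x ξ)⟩

theorem hasDerivAt_pseudoFun (ha : IsSymbolJet a) (α β : ℕ) (φ : 𝓢(ℝ, ℂ)) (ξ : ℝ) :
    HasDerivAt (pseudoFun (a α β) φ) (pseudoFun (a α β) ((2 * Real.pi * Complex.I : ℂ) • mulX φ) ξ +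
      pseudoFun (a α (β + 1)) φ ξ) ξ := by
  obtain ⟨C, hC⟩ := ha.bounded α β
  obtain ⟨D, hD⟩ := ha.bounded α (β + 1)
  set φ₁ : 𝓢(ℝ, ℂ) := (2 * Real.pi * Complex.I : ℂ) • mulX φ with hφ₁
  have key := hasDerivAt_integral_of_dominated_loc_of_deriv_le (μ := volume) (s := univ) (x₀ := ξ)
    (F := fun ξ x => osc x ξ * a α β x ξ * φ x)
    (F' := fun ξ x => osc x ξ * a α β x ξ * φ₁ x + osc x ξ * a α (β + 1) x ξ * φ x)
    (bound := fun x => C * ‖φ₁ x‖ + D * ‖φ x‖) univ_mem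
    (Eventually.of_forall fun ξ => (ha.continuous_integrand α β φ ξ).aestronglyMeasurable)
    (ha.integrable_integrand α β φ ξ)
    ((ha.continuous_integrand α β φ₁ ξ).add
      (ha.continuous_integrand α (β + 1) φ ξ)).aestronglyMeasurable
    (Eventually.of_forall fun x ξ _ => (norm_add_le _ _).trans
      (add_le_add (norm_integrand_le hC φ₁ x ξ) (norm_integrand_le hD φ x ξ)))
    ((φ₁.integrable.norm.const_mul C).add (φ.integrable.norm.const_mul D))
    (Eventually.of_forall fun x ξ _ => by
      refine (((hasDerivAt_osc x ξ).mul (ha.hasDerivAt_right α β x ξ)).mul_const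
        (φ x)).congr_deriv ?_
      simp only [hφ₁, smul_apply, mulX_apply, smul_eq_mul]
      ring)
  refine key.2.congr_deriv ?_
  rw [integral_add (ha.integrable_integrand α β φ₁ ξ) (ha.integrable_integrand α (β + 1) φ ξ)]
  rfl

theorem mul_pseudoFun (ha : IsSymbolJet a) (α β : ℕ) (φ : 𝓢(ℝ, ℂ)) (ξ : ℝ) :
    2 * Real.pi * Complex.I * ξ * pseudoFun (a α β) φ ξ =
      -(pseudoFun (a (α + 1) β) φ ξ + pseudoFun (a α β) (derivCLM ℂ ℂ φ) ξ) := by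
  have hφ : ∀ x, HasDerivAt φ (derivCLM ℂ ℂ φ x) x := fun x => by
    rw [derivCLM_apply]; exact φ.differentiableAt.hasDerivAt
  have hv : ∀ x, HasDerivAt (fun x => osc x ξ) (2 * Real.pi * Complex.I * ξ * osc x ξ) x :=
    fun x => by simp only [osc_comm _ ξ]; exact hasDerivAt_osc ξ x
  have key := integral_mul_deriv_eq_deriv_mul_of_integrable (u := fun x => a α β x ξ * φ x)
    (u' := fun x => a (α + 1) β x ξ * φ x + a α β x ξ * derivCLM ℂ ℂ φ x)
    (v := fun x => osc x ξ) (v' := fun x => 2 * Real.pi * Complex.I * ξ * osc x ξ)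
    (fun x _ => (ha.hasDerivAt_left α β x ξ).mul (hφ x)) (fun x _ => hv x)
    (((ha.integrable_integrand α β φ ξ).const_mul (2 * Real.pi * Complex.I * ξ)).congr
      (Eventually.of_forall fun x => by simp only [Pi.mul_apply]; ring))
    (((ha.integrable_integrand (α + 1) β φ ξ).add
      (ha.integrable_integrand α β (derivCLM ℂ ℂ φ) ξ)).congr
      (Eventually.of_forall fun x => by simp only [Pi.mul_apply, Pi.add_apply]; ring))
    ((ha.integrable_integrand α β φ ξ).congr
      (Eventually.of_forall fun x => by simp only [Pi.mul_apply]; ring))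
  rw [pseudoFun, pseudoFun, pseudoFun, ← integral_const_mul, ← integral_add
    (ha.integrable_integrand (α + 1) β φ ξ) (ha.integrable_integrand α β (derivCLM ℂ ℂ φ) ξ)]
  calc _ = _ := by congr 1; ext x; ring
    _ = _ := key
    _ = _ := by congr 2; ext x; ring

theorem contDiff_pseudoFun (ha : IsSymbolJet a) (n : ℕ) (α β : ℕ) (φ : 𝓢(ℝ, ℂ)) :
    ContDiff ℝ n (pseudoFun (a α β) φ) := by
  induction n generalizing β φ with
  | zero =>
    exact contDiff_zero.2 (continuous_iff_continuousAt.2 fun ξ =>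
      (ha.hasDerivAt_pseudoFun α β φ ξ).continuousAt)
  | succ n ih =>
    have h1 : deriv (pseudoFun (a α β) φ) = fun ξ =>
        pseudoFun (a α β) ((2 * Real.pi * Complex.I : ℂ) • mulX φ) ξ +
          pseudoFun (a α (β + 1)) φ ξ := funext fun ξ => (ha.hasDerivAt_pseudoFun α β φ ξ).deriv
    push_cast
    refine contDiff_succ_iff_deriv.2 ⟨fun ξ =>
      (ha.hasDerivAt_pseudoFun α β φ ξ).differentiableAt, by simp, ?_⟩
    rw [h1]
    exact (ih _ _).add (ih _ _)

/-- A `ξ`-derivative produces a factor `x` on `φ` or a derivative of the symbol, and a factor `ξ` is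
removed by integrating by parts in `x`. Both operations stay in the same family of integrals, so the
induction runs over all `α`, `β`, `φ`; it makes `op` preserve `𝓢(ℝ)`. -/
theorem exists_decay_pseudoFun (ha : IsSymbolJet a) (k n α β : ℕ) (φ : 𝓢(ℝ, ℂ)) :
    ∃ C : ℝ, ∀ ξ : ℝ, ‖ξ‖ ^ k * ‖iteratedDeriv n (pseudoFun (a α β) φ) ξ‖ ≤ C := by
  induction n generalizing α β φ with
  | zero =>
    simp only [iteratedDeriv_zero]
    induction k generalizing α φ with
    | zero => simpa using ha.exists_norm_pseudoFun_le α β φ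
    | succ k ih =>
      obtain ⟨C, hC⟩ := ih (α + 1) φ
      obtain ⟨D, hD⟩ := ih α (derivCLM ℂ ℂ φ)
      refine ⟨C + D, fun ξ => ?_⟩
      have h1 := congrArg norm (ha.mul_pseudoFun α β φ ξ)
      rw [norm_neg, norm_mul] at h1
      have h2 : ‖(2 * Real.pi * Complex.I * ξ : ℂ)‖ = 2 * Real.pi * ‖ξ‖ := by
        simp [abs_of_pos Real.pi_pos]
      rw [h2] at h1
      have h3 : ‖ξ‖ * ‖pseudoFun (a α β) φ ξ‖ ≤ 2 * Real.pi * ‖ξ‖ * ‖pseudoFun (a α β) φ ξ‖ := by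
        have : 0 ≤ ‖ξ‖ * ‖pseudoFun (a α β) φ ξ‖ := by positivity
        nlinarith [Real.pi_gt_three]
      rw [h1] at h3
      calc _ = ‖ξ‖ ^ k * (‖ξ‖ * ‖pseudoFun (a α β) φ ξ‖) := by ring
        _ ≤ ‖ξ‖ ^ k * (‖pseudoFun (a (α + 1) β) φ ξ‖ + ‖pseudoFun (a α β) (derivCLM ℂ ℂ φ) ξ‖) := by
          gcongr
          exact h3.trans (norm_add_le _ _)
        _ ≤ _ := by rw [mul_add]; exact add_le_add (hC ξ) (hD ξ)
  | succ n ih =>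
    obtain ⟨C, hC⟩ := ih α β ((2 * Real.pi * Complex.I : ℂ) • mulX φ)
    obtain ⟨D, hD⟩ := ih α (β + 1) φ
    refine ⟨C + D, fun ξ => ?_⟩
    have h1 : deriv (pseudoFun (a α β) φ) =
        pseudoFun (a α β) ((2 * Real.pi * Complex.I : ℂ) • mulX φ) +
          pseudoFun (a α (β + 1)) φ := funext fun ξ => (ha.hasDerivAt_pseudoFun α β φ ξ).deriv
    rw [iteratedDeriv_succ', h1, iteratedDeriv_add (ha.contDiff_pseudoFun n _ _ _).contDiffAt
      (ha.contDiff_pseudoFun n _ _ _).contDiffAt]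
    calc _ ≤ ‖ξ‖ ^ k * (_ + _) := mul_le_mul_of_nonneg_left (norm_add_le _ _) (by positivity)
      _ ≤ _ := by rw [mul_add]; exact add_le_add (hC ξ) (hD ξ)

/-- The operator `φ ↦ ∫ e^{2πi x ξ} a(x, ξ) φ(x) dx` on `𝓢(ℝ)`. -/
noncomputable def op (ha : IsSymbolJet a) : 𝓢(ℝ, ℂ) →ₗ[ℂ] 𝓢(ℝ, ℂ) where
  toFun φ :=
    { toFun := pseudoFun (a 0 0) φ
      smooth' := contDiff_infty.2 fun n => ha.contDiff_pseudoFun n 0 0 φ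
      decay' := fun k n => by
        simp only [norm_iteratedFDeriv_eq_norm_iteratedDeriv]
        exact ha.exists_decay_pseudoFun k n 0 0 φ }
  map_add' φ ψ := by
    ext ξ
    change pseudoFun (a 0 0) (φ + ψ) ξ = pseudoFun (a 0 0) φ ξ + pseudoFun (a 0 0) ψ ξ
    rw [pseudoFun, pseudoFun, pseudoFun, ← integral_add (ha.integrable_integrand 0 0 φ ξ)
      (ha.integrable_integrand 0 0 ψ ξ)]
    congr 1
    ext x
    rw [add_apply, mul_add]
  map_smul' c φ := by
    ext ξ
    change pseudoFun (a 0 0) (c • φ) ξ = c * pseudoFun (a 0 0) φ ξ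
    rw [pseudoFun, pseudoFun, ← integral_const_mul]
    congr 1
    ext x
    rw [smul_apply, smul_eq_mul]
    ring

theorem op_apply (ha : IsSymbolJet a) (φ : 𝓢(ℝ, ℂ)) (ξ : ℝ) :
    ha.op φ ξ = ∫ x, osc x ξ * a 0 0 x ξ * φ x := rfl

end IsSymbolJet

end Strip

namespace Strip

open SchwartzMap

/-! ### Windowed Fourier transforms -/

/-- The windowed Fourier transform `∫ e^{-2πi x y} (1 - 2πi (ξ - y))^{-N} h(y) dy`. -/
noncomputable def winFourier (N : ℕ) (h : 𝓢(ℝ, ℂ)) (ξ x : ℝ) : ℂ := 𝓕 (mulWin N ξ h) x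

theorem winFourier_eq (N : ℕ) (h : 𝓢(ℝ, ℂ)) (ξ x : ℝ) :
    winFourier N h ξ x = ∫ y, osc (-x) y * (win N ξ y * h y) := by
  rw [winFourier, fourier_eq_integral_osc]
  simp only [mulWin_apply]

theorem norm_fourier_le (h : 𝓢(ℝ, ℂ)) (x : ℝ) : ‖𝓕 h x‖ ≤ ∫ y, ‖h y‖ := by
  rw [fourier_eq_integral_osc]
  refine (norm_integral_le_integral_norm _).trans (le_of_eq ?_)
  simp only [norm_mul, norm_osc, one_mul]

theorem norm_mulWin_apply_le (N : ℕ) (ξ : ℝ) (h : 𝓢(ℝ, ℂ)) (y : ℝ) : ‖mulWin N ξ h y‖ ≤ ‖h y‖ := by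
  rw [mulWin_apply, norm_mul]
  exact mul_le_of_le_one_left (norm_nonneg _) (norm_win_le_one N ξ y)

theorem norm_winFourier_le (N : ℕ) (h : 𝓢(ℝ, ℂ)) (ξ x : ℝ) : ‖winFourier N h ξ x‖ ≤ ∫ y, ‖h y‖ :=
  (norm_fourier_le _ x).trans (integral_mono (mulWin N ξ h).integrable.norm h.integrable.norm
    fun y => norm_mulWin_apply_le N ξ h y)

theorem deriv_mulWin (N : ℕ) (ξ : ℝ) (h : 𝓢(ℝ, ℂ)) :
    derivCLM ℂ ℂ (mulWin N ξ h) = mulWin N ξ (derivCLM ℂ ℂ h) -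
      (2 * Real.pi * Complex.I * N : ℂ) • mulWin (N + 1) ξ h := by
  ext y
  have h1 : HasDerivAt h (derivCLM ℂ ℂ h y) y := by
    rw [derivCLM_apply]; exact h.differentiableAt.hasDerivAt
  have h2 : HasDerivAt (mulWin N ξ h) _ y :=
    ((hasDerivAt_win_right N ξ y).mul h1).congr_of_eventuallyEq
      (Eventually.of_forall fun z => mulWin_apply N ξ h z)
  rw [derivCLM_apply, h2.deriv]
  simp only [sub_apply, smul_apply, mulWin_apply, smul_eq_mul]
  ring

/-- Two derivatives of the windowed function control `x²` times its transform, uniformly in `ξ`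
because windows are at most `1` in modulus. The bound is qualitative and serves to justify Fubini's
theorem in `integral_op_eq`. -/
theorem exists_norm_winFourier_le_inv (N : ℕ) (h : 𝓢(ℝ, ℂ)) :
    ∃ C : ℝ, ∀ ξ x, ‖winFourier N h ξ x‖ ≤ C * (1 + x ^ 2)⁻¹ := by
  set D := derivCLM ℂ ℂ with hD
  set n : 𝓢(ℝ, ℂ) → ℝ := fun h => ∫ y, ‖h y‖ with hn
  set c : ℕ → ℂ := fun N => 2 * Real.pi * Complex.I * N with hc
  refine ⟨n h + (n (D (D h)) + ‖c N‖ * n (D h) + ‖c N‖ * n (D h) + ‖c N * c (N + 1)‖ * n h),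
    fun ξ x => ?_⟩
  have e : D (D (mulWin N ξ h)) = mulWin N ξ (D (D h)) - c N • mulWin (N + 1) ξ (D h) -
      c N • mulWin (N + 1) ξ (D h) + (c N * c (N + 1)) • mulWin (N + 2) ξ h := by
    simp only [hD, deriv_mulWin, map_sub, map_smul, smul_sub, smul_smul, hc]
    abel
  have h1 : 𝓕 (D (D (mulWin N ξ h))) x = -(2 * Real.pi * x) ^ 2 * 𝓕 (mulWin N ξ h) x := by
    rw [hD, fourier_deriv, smul_apply, mulX_apply, fourier_deriv, smul_apply, mulX_apply,
      smul_eq_mul, smul_eq_mul]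
    ring_nf
    rw [Complex.I_sq]
    ring
  have h2 : ‖𝓕 (D (D (mulWin N ξ h))) x‖ ≤
      n (D (D h)) + ‖c N‖ * n (D h) + ‖c N‖ * n (D h) + ‖c N * c (N + 1)‖ * n h := by
    have e2 : 𝓕 (D (D (mulWin N ξ h))) x = winFourier N (D (D h)) ξ x -
        c N * winFourier (N + 1) (D h) ξ x - c N * winFourier (N + 1) (D h) ξ x +
        c N * c (N + 1) * winFourier (N + 2) h ξ x := by
      rw [e, ← FourierTransform.fourierCLM_apply (R := ℂ), map_add, map_sub, map_sub, map_smul,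
        map_smul]
      rfl
    rw [e2]
    refine (norm_add_le _ _).trans (add_le_add ((norm_sub_le _ _).trans (add_le_add
      ((norm_sub_le _ _).trans (add_le_add (norm_winFourier_le _ _ _ _) ?_)) ?_)) ?_) <;>
    · rw [norm_mul]
      exact mul_le_mul_of_nonneg_left (norm_winFourier_le _ _ _ _) (norm_nonneg _)
  have h3 : (1 + (2 * Real.pi * x) ^ 2) * ‖winFourier N h ξ x‖ =
      ‖winFourier N h ξ x - 𝓕 (D (D (mulWin N ξ h))) x‖ := by
    rw [h1, winFourier, neg_mul, sub_neg_eq_add, ← one_add_mul, norm_mul]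
    congr 1
    rw [← Complex.ofReal_one, ← Complex.ofReal_ofNat, ← Complex.ofReal_mul, ← Complex.ofReal_mul,
      ← Complex.ofReal_pow, ← Complex.ofReal_add, Complex.norm_real, Real.norm_of_nonneg]
    positivity
  rw [← div_eq_mul_inv, le_div_iff₀ (by positivity), mul_comm]
  calc _ ≤ (1 + (2 * Real.pi * x) ^ 2) * ‖winFourier N h ξ x‖ := by
        gcongr (1 + ?_) * _
        have : 1 ≤ (2 * Real.pi) ^ 2 := by nlinarith [Real.pi_gt_three]
        rw [mul_pow]
        nlinarith [sq_nonneg x]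
    _ ≤ _ := by
      rw [h3]
      exact (norm_sub_le _ _).trans (add_le_add (norm_winFourier_le _ _ _ _) h2)

theorem continuous_winFourier (N : ℕ) (h : 𝓢(ℝ, ℂ)) :
    Continuous fun z : ℝ × ℝ => winFourier N h z.1 z.2 := by
  simp only [winFourier_eq]
  refine continuous_of_dominated (bound := fun y => ‖h y‖) (fun z => ?_) (fun z => ?_)
    h.integrable.norm (Eventually.of_forall fun y => ?_)
  · exact ((continuous_osc_right _).mul ((continuous_win_right _ _).mul h.continuous)).aestronglyMeasurable
  · refine Eventually.of_forall fun y => ?_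
    rw [norm_mul, norm_osc, one_mul, ← mulWin_apply]
    exact norm_mulWin_apply_le N z.1 h y
  · have h1 : Continuous fun z : ℝ × ℝ => osc (-z.2) y := by unfold osc; fun_prop
    have h2 : Continuous fun z : ℝ × ℝ => win N z.1 y :=
      (continuous_win_left N y).comp continuous_fst
    exact h1.mul (h2.mul continuous_const)

theorem hasDerivAt_winFourier (N : ℕ) (h : 𝓢(ℝ, ℂ)) (ξ x : ℝ) :
    HasDerivAt (fun ξ => winFourier N h ξ x)
      (2 * Real.pi * Complex.I * N * winFourier (N + 1) h ξ x) ξ := by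
  simp only [winFourier_eq]
  have hi : ∀ N ξ, Continuous fun y => osc (-x) y * (win N ξ y * h y) := fun N ξ =>
    (continuous_osc_right _).mul ((continuous_win_right N ξ).mul h.continuous)
  have hb : ∀ N ξ y, ‖osc (-x) y * (win N ξ y * h y)‖ ≤ ‖h y‖ := fun N ξ y => by
    rw [norm_mul, norm_osc, one_mul, ← mulWin_apply]
    exact norm_mulWin_apply_le N ξ h y
  have key := hasDerivAt_integral_of_dominated_loc_of_deriv_le (μ := volume) (s := univ) (x₀ := ξ)
    (F := fun ξ y => osc (-x) y * (win N ξ y * h y))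
    (F' := fun ξ y => 2 * Real.pi * Complex.I * N * (osc (-x) y * (win (N + 1) ξ y * h y)))
    (bound := fun y => ‖(2 * Real.pi * Complex.I * N : ℂ)‖ * ‖h y‖) univ_mem
    (Eventually.of_forall fun ξ => (hi N ξ).aestronglyMeasurable)
    (h.integrable.norm.mono' (hi N ξ).aestronglyMeasurable (Eventually.of_forall (hb N ξ)))
    (continuous_const.mul (hi (N + 1) ξ)).aestronglyMeasurable
    (Eventually.of_forall fun y ξ _ => by
      rw [norm_mul]; exact mul_le_mul_of_nonneg_left (hb (N + 1) ξ y) (norm_nonneg _))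
    (h.integrable.norm.const_mul _)
    (Eventually.of_forall fun y ξ _ => by
      refine (((hasDerivAt_win_left N ξ y).mul_const (h y)).const_mul (osc (-x) y)).congr_deriv ?_
      ring)
  refine key.2.congr_deriv ?_
  rw [integral_const_mul]

/-- The jet in `ξ` of a windowed Fourier transform. -/
noncomputable def winFourierJet (N : ℕ) (h : 𝓢(ℝ, ℂ)) (x : ℝ) : ℕ → ℝ → ℂ := fun k ξ =>
  winCoeff N k * winFourier (N + k) h ξ x

theorem isJet_winFourierJet (N : ℕ) (h : 𝓢(ℝ, ℂ)) (x : ℝ) : IsJet (winFourierJet N h x) := by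
  refine ⟨fun k ξ => ?_, fun k => ?_⟩
  · refine ((hasDerivAt_winFourier (N + k) h ξ x).const_mul (winCoeff N k)).congr_deriv ?_
    rw [winFourierJet, winCoeff_succ, add_assoc]
    ring
  · refine PolyBdd.of_bound (C := ‖winCoeff N k‖ * ∫ y, ‖h y‖) fun ξ => ?_
    rw [winFourierJet, norm_mul]
    exact mul_le_mul_of_nonneg_left (norm_winFourier_le _ _ _ _) (norm_nonneg _)

/-! ### The bound for windowed Fourier transforms in weighted norms -/

theorem enorm_toL2_sq (φ : 𝓢(ℝ, ℂ)) : ‖toL2 φ‖ₑ ^ 2 = ∫⁻ x, ‖φ x‖ₑ ^ 2 := by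
  rw [← ofReal_norm, ← ENNReal.ofReal_pow (norm_nonneg _), norm_toL2_sq,
    ofReal_integral_eq_lintegral_ofReal]
  · simp only [ENNReal.ofReal_pow (norm_nonneg _), ofReal_norm]
  · exact (φ.memLp 2).integrable_norm_pow (by simp)
  · exact Eventually.of_forall fun x => by positivity

theorem exists_one_add_abs_rpow_le (s : ℝ) (hs : 0 ≤ s) (r : ℝ) :
    (1 + |r|) ^ s ≤ 2 ^ (s / 2) * (1 + r ^ 2) ^ (s / 2) := by
  rw [← Real.mul_rpow (by norm_num) (by positivity)]
  have h1 : (1 + |r|) ^ 2 ≤ 2 * (1 + r ^ 2) := by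
    rw [← sq_abs r]; nlinarith [sq_nonneg (1 - |r|)]
  calc (1 + |r|) ^ s = ((1 + |r|) ^ 2) ^ (s / 2) := by
        rw [← Real.rpow_natCast, ← Real.rpow_mul (by positivity)]; congr 1; push_cast; ring
    _ ≤ _ := Real.rpow_le_rpow (by positivity) h1 (by positivity)

/-- Peetre's inequality in the form of a product of weights. -/
theorem norm_wt_mul_wt_le (s x y : ℝ) :
    ‖wt s x‖ * ‖wt (-s) y‖ ≤ 2 ^ |s| * ‖wt |s| (x - y)‖ := by
  rw [← norm_mul]
  refine (norm_wt_mul_le s x y).trans ?_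
  rw [norm_wt]
  calc _ ≤ 2 ^ (|s| / 2) * (2 ^ (|s| / 2) * (1 + (x - y) ^ 2) ^ (|s| / 2)) := by
        gcongr; exact exists_one_add_abs_rpow_le _ (abs_nonneg s) _
    _ = _ := by
      rw [← mul_assoc, ← Real.rpow_add (by norm_num), add_halves]

theorem lt_floor_add_two (s : ℝ) : |s| + 1 < (⌊|s|⌋₊ + 2 : ℕ) := by
  push_cast
  linarith [Nat.lt_floor_add_one |s|]

/-- Peetre's inequality moves the weight from `x` to `y` at the cost of `⟨x - y⟩^{|s|}`; a window of
order `N ≥ |s| + 1` pays for this and leaves `⟨x - y⟩⁻¹`, which is square integrable. -/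
theorem norm_wt_mul_win_le (s : ℝ) {N : ℕ} (hN : |s| + 1 ≤ N) (x y : ℝ) :
    ‖wt s x‖ * ‖win N x y‖ ≤ 2 ^ |s| * ‖wt s y‖ * ‖wt (-1) (x - y)‖ := by
  have h1 : ‖win N x y‖ ≤ ‖wt (-N) (x - y)‖ := by
    rw [norm_win, wtD_eq, norm_wt, norm_wt]
    refine Real.rpow_le_rpow_of_nonpos (by positivity) ?_ (by
      have : (0 : ℝ) ≤ N := N.cast_nonneg
      linarith)
    have : 1 ≤ (2 * Real.pi) ^ 2 := by nlinarith [Real.pi_gt_three]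
    rw [mul_pow]
    nlinarith [sq_nonneg (x - y)]
  have h2 := norm_wt_mul_wt_le s x y
  have h3 : ‖wt (-s) y‖ * ‖wt s y‖ = 1 := by
    rw [← norm_mul, wt_mul_wt, neg_add_cancel, wt_zero, norm_one]
  have h4 : ‖wt |s| (x - y)‖ * ‖wt (-N) (x - y)‖ ≤ ‖wt (-1) (x - y)‖ := by
    rw [← norm_mul, wt_mul_wt]
    exact norm_wt_le_of_le (by linarith) _
  calc ‖wt s x‖ * ‖win N x y‖ ≤ ‖wt s x‖ * ‖wt (-N) (x - y)‖ := by gcongr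
    _ = (‖wt s x‖ * ‖wt (-s) y‖) * ‖wt s y‖ * ‖wt (-N) (x - y)‖ := by
      linear_combination (-(‖wt s x‖ * ‖wt (-N) (x - y)‖)) * h3
    _ ≤ (2 ^ |s| * ‖wt |s| (x - y)‖) * ‖wt s y‖ * ‖wt (-N) (x - y)‖ := by gcongr
    _ = 2 ^ |s| * ‖wt s y‖ * (‖wt |s| (x - y)‖ * ‖wt (-N) (x - y)‖) := by ring
    _ ≤ _ := by gcongr

theorem continuous_wt (s : ℝ) : Continuous (wt s) := (hasTemperateGrowth_wt s).1.continuous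

/-- Plancherel's theorem in `ξ` replaces the transform by `win · h`. The pointwise bound
`norm_wt_mul_win_le` and Tonelli's theorem then leave `∫ (1 + x²)⁻¹ = π`. -/
theorem lintegral_wt_mul_winFourier_le (s : ℝ) {N : ℕ} (hN : |s| + 1 ≤ N) (h : 𝓢(ℝ, ℂ)) :
    ∫⁻ x, ‖wt s x‖ₑ ^ 2 * ∫⁻ ξ, ‖winFourier N h x ξ‖ₑ ^ 2 ≤
      ENNReal.ofReal ((2 ^ |s|) ^ 2 * Real.pi) * ‖toL2 (mulWt s h)‖ₑ ^ 2 := by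
  have h1 : ∀ x, ‖wt s x‖ₑ ^ 2 * ∫⁻ ξ, ‖winFourier N h x ξ‖ₑ ^ 2 =
      ∫⁻ y, ‖wt s x‖ₑ ^ 2 * (‖win N x y‖ₑ ^ 2 * ‖h y‖ₑ ^ 2) := fun x => by
    rw [lintegral_const_mul' _ _ (by simp)]
    congr 1
    simp only [winFourier]
    rw [← enorm_toL2_sq, ← ofReal_norm, norm_toL2_fourier, ofReal_norm, enorm_toL2_sq]
    simp only [mulWin_apply, enorm_mul, mul_pow]
  have hp : ∀ x y, ‖wt s x‖ₑ ^ 2 * (‖win N x y‖ₑ ^ 2 * ‖h y‖ₑ ^ 2) ≤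
      ENNReal.ofReal ((2 ^ |s|) ^ 2) * ENNReal.ofReal (1 + (x - y) ^ 2)⁻¹ *
        ‖mulWt s h y‖ₑ ^ 2 := fun x y => by
    have h2 := norm_wt_mul_win_le s hN x y
    have h3 : ‖wt (-1) (x - y)‖ ^ 2 = (1 + (x - y) ^ 2)⁻¹ := by
      rw [norm_wt, ← Real.rpow_natCast, ← Real.rpow_mul (by positivity), ← Real.rpow_neg_one]
      norm_num
    rw [← ENNReal.ofReal_mul (by positivity), ← h3]
    simp only [← ofReal_norm]
    simp only [← ENNReal.ofReal_pow (norm_nonneg _)]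
    rw [← ENNReal.ofReal_mul (by positivity), ← ENNReal.ofReal_mul (by positivity),
      ← ENNReal.ofReal_mul (by positivity)]
    refine ENNReal.ofReal_le_ofReal ?_
    rw [mulWt_apply, norm_mul]
    calc _ = (‖wt s x‖ * ‖win N x y‖) ^ 2 * ‖h y‖ ^ 2 := by ring
      _ ≤ (2 ^ |s| * ‖wt s y‖ * ‖wt (-1) (x - y)‖) ^ 2 * ‖h y‖ ^ 2 := by gcongr
      _ = _ := by ring
  simp only [h1]
  refine (lintegral_mono fun x => lintegral_mono fun y => hp x y).trans ?_
  have hc1 : Continuous fun x : ℝ => ENNReal.ofReal (1 + x ^ 2)⁻¹ :=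
    ENNReal.continuous_ofReal.comp (Continuous.inv₀ (by fun_prop) fun x => by positivity)
  have hc2 : Continuous fun y => ‖mulWt s h y‖ₑ ^ 2 :=
    (ENNReal.continuous_pow 2).comp (continuous_enorm.comp (mulWt s h).continuous)
  rw [lintegral_lintegral_swap]
  · have h4 : ∀ y, ∫⁻ x, ENNReal.ofReal ((2 ^ |s|) ^ 2) * ENNReal.ofReal (1 + (x - y) ^ 2)⁻¹ *
        ‖mulWt s h y‖ₑ ^ 2 = ENNReal.ofReal ((2 ^ |s|) ^ 2 * Real.pi) * ‖mulWt s h y‖ₑ ^ 2 :=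
      fun y => by
        rw [lintegral_mul_const' _ _ (by simp), lintegral_const_mul' _ _ (by simp)]
        rw [lintegral_sub_right_eq_self (fun x => ENNReal.ofReal (1 + x ^ 2)⁻¹) y,
          ← ofReal_integral_eq_lintegral_ofReal integrable_inv_one_add_sq
            (Eventually.of_forall fun x => by positivity), integral_univ_inv_one_add_sq,
          ENNReal.ofReal_mul (by positivity)]
    simp only [h4]
    rw [lintegral_const_mul' _ _ (by simp), enorm_toL2_sq]
  · have hm1 : Measurable fun z : ℝ × ℝ => ENNReal.ofReal (1 + (z.1 - z.2) ^ 2)⁻¹ :=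
      (hc1.comp (continuous_fst.sub continuous_snd)).measurable
    have hm2 : Measurable fun z : ℝ × ℝ => ‖mulWt s h z.2‖ₑ ^ 2 :=
      (hc2.comp continuous_snd).measurable
    exact ((hm1.const_mul _).mul hm2).aemeasurable

end Strip

namespace Strip

open SchwartzMap

/-! ### The bilinear estimate -/

/-- `(1 + ∂_x)^N ∂_x^k ∂_ξ^l a`. -/
def symStep (a : ℕ → ℕ → ℝ → ℝ → ℂ) (N k l : ℕ) (x ξ : ℝ) : ℂ :=
  (jetStep^[N] fun k x => a k l x ξ) k x

theorem symStep_succ (a : ℕ → ℕ → ℝ → ℝ → ℂ) (N k l : ℕ) (x ξ : ℝ) :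
    symStep a (N + 1) k l x ξ = symStep a N k l x ξ + symStep a N (k + 1) l x ξ := by
  rw [symStep, Function.iterate_succ_apply']
  rfl

theorem norm_symStep_le {a : ℕ → ℕ → ℝ → ℝ → ℂ} {N l : ℕ} {D : ℝ} {x ξ : ℝ}
    (hD : ∀ k ≤ N, ‖a k l x ξ‖ ≤ D) : ‖symStep a N 0 l x ξ‖ ≤ 2 ^ N * D :=
  norm_iterate_jetStep_le fun i hi => by rw [zero_add]; exact hD i hi

/-- Opposite weights at `ξ` and `η` nearly cancel across the window. What remains depends on `ξ - η`
alone, and it is an integrable convolution kernel when `N > |s| + 1`. -/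
theorem norm_wtD_mul_le (s : ℝ) (N : ℕ) (ξ η : ℝ) :
    ‖wtD (-s) ξ‖ * (‖win N ξ η‖ * ‖wtD s η‖) ≤ 2 ^ |s| * ‖wtD (|s| - N) (ξ - η)‖ := by
  have h1 := norm_wt_mul_wt_le (-s) (2 * Real.pi * ξ) (2 * Real.pi * η)
  rw [neg_neg, abs_neg, ← mul_sub] at h1
  rw [norm_win]
  simp only [wtD_eq]
  rw [sub_eq_add_neg |s| (N : ℝ), ← wt_mul_wt, norm_mul, ← mul_assoc (2 ^ |s|)]
  calc _ = (‖wt (-s) (2 * Real.pi * ξ)‖ * ‖wt s (2 * Real.pi * η)‖) *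
        ‖wt (-N) (2 * Real.pi * (ξ - η))‖ := by ring
    _ ≤ _ := by gcongr

theorem lintegral_wtD_lt_top {r : ℝ} (hr : r < -1) : ∫⁻ ξ, ‖wtD r ξ‖ₑ < ⊤ := by
  have h1 : Integrable fun ξ : ℝ => (1 + ‖ξ‖ ^ 2) ^ (-(-r) / 2 : ℝ) :=
    integrable_rpow_neg_one_add_norm_sq (by simp; linarith)
  refine Integrable.hasFiniteIntegral (h1.mono' ?_ (Eventually.of_forall fun ξ => ?_))
  · exact ((hasTemperateGrowth_wtD r).1.continuous).aestronglyMeasurable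
  · rw [wtD_eq, norm_wt, neg_neg, Real.norm_eq_abs, sq_abs]
    refine Real.rpow_le_rpow_of_nonpos (by positivity) ?_ (by linarith)
    have : 1 ≤ (2 * Real.pi) ^ 2 := by nlinarith [Real.pi_gt_three]
    rw [mul_pow]
    nlinarith [sq_nonneg ξ]

/-- The windowed transform of `⟨2πη⟩^s 𝓕g` is itself an oscillatory integral against `𝓕g`.
Integrating by parts `M` times localizes `g` near `-x`, and the derivatives fall on the window and
the weight, which control their own derivatives. -/
theorem exists_norm_winFourier_le_integral (s : ℝ) (N M : ℕ) :
    ∃ C : ℝ, 0 ≤ C ∧ ∀ k ≤ M, ∀ (g : 𝓢(ℝ, ℂ)) (x ξ : ℝ),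
      ‖winFourier (N + k) (mulWtD s (𝓕 g)) ξ x‖ ≤
        C * ∫ η, ‖winFourier M g (-x) η‖ * (‖win N ξ η‖ * ‖wtD s η‖) := by
  obtain ⟨Cw, hCw, hw⟩ := exists_norm_wtDJet_le s M
  have hk : ∀ k, ∃ C : ℝ, 0 ≤ C ∧ ∀ (g : 𝓢(ℝ, ℂ)) (x ξ : ℝ),
      ‖winFourier (N + k) (mulWtD s (𝓕 g)) ξ x‖ ≤
        C * ∫ η, ‖winFourier M g (-x) η‖ * (‖win N ξ η‖ * ‖wtD s η‖) := fun k => by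
    obtain ⟨Cn, hCn, hn⟩ := exists_norm_winCoeff_le (N + k) M
    refine ⟨2 ^ M * (2 ^ M * (Cn * Cw)), by positivity, fun g x ξ => ?_⟩
    have hJ := (isJet_winJet (N + k) ξ).jetMul (isJet_wtDJet s)
    have e : winFourier (N + k) (mulWtD s (𝓕 g)) ξ x =
        ∫ η, osc (-x) η * 𝓕 g η * jetMul 0 (winJet (N + k) ξ) (wtDJet s) η := by
      rw [winFourier_eq]
      congr 1
      ext η
      simp only [jetMul, winJet, wtDJet_zero, winCoeff_zero, mulWtD_apply, pow_zero, one_mul,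
        add_zero]
      ring
    rw [e, hJ.integral_osc_fourier_mul M, ← integral_const_mul]
    have hb : ∀ η, ‖(jetStep^[M] fun n => jetMul n (winJet (N + k) ξ) (wtDJet s)) 0 η‖ ≤
        2 ^ M * (2 ^ M * (Cn * Cw)) * (‖win N ξ η‖ * ‖wtD s η‖) := fun η => by
      have h1 : ∀ i ≤ M, ‖winJet (N + k) ξ i η‖ ≤ Cn * ‖win N ξ η‖ := fun i hi => by
        rw [winJet, norm_mul, norm_mul, norm_pow, norm_neg, norm_one, one_pow, one_mul, add_assoc]
        exact mul_le_mul (hn i hi) (norm_win_add_le N _ ξ η) (norm_nonneg _) hCn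
      refine (norm_iterate_jetStep_le (B := 2 ^ M * ((Cn * ‖win N ξ η‖) * (Cw * ‖wtD s η‖)))
        fun i hi => ?_).trans (le_of_eq (by ring))
      rw [zero_add]
      refine (norm_jetMul_le (fun j hj => h1 j (hj.trans hi))
        fun j hj => hw j (hj.trans hi) η).trans ?_
      gcongr
      exact one_le_two
    refine norm_integral_le_of_norm_le ?_ (Eventually.of_forall fun η => ?_)
    · refine Integrable.const_mul ?_ _
      have h2 : PolyBdd fun η => win N ξ η * wtD s η :=
        (PolyBdd.of_bound (norm_win_le_one N ξ)).mul (polyBdd_wtD s)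
      refine ((h2.integrable_mul ((continuous_win_right N ξ).mul
        (hasTemperateGrowth_wtD s).1.continuous) (𝓕 (mulWin M (-x) g))).norm).congr
        (Eventually.of_forall fun η => ?_)
      simp only [norm_mul]
      rfl
    · rw [norm_mul, norm_mul, norm_osc, one_mul]
      calc _ ≤ ‖winFourier M g (-x) η‖ * _ := mul_le_mul_of_nonneg_left (hb η) (norm_nonneg _)
        _ = _ := by ring
  choose C hC h using hk
  refine ⟨∑ k ∈ Finset.range (M + 1), C k, Finset.sum_nonneg fun i _ => hC i,
    fun k hkM g x ξ => (h k g x ξ).trans ?_⟩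
  refine mul_le_mul_of_nonneg_right ?_ (integral_nonneg fun η => by positivity)
  exact Finset.single_le_sum (fun i _ => hC i) (Finset.mem_range.2 (by omega))

namespace IsSymbolJet

variable {a : ℕ → ℕ → ℝ → ℝ → ℂ}

theorem hasDerivAt_symStep (ha : IsSymbolJet a) (N k l : ℕ) (x ξ : ℝ) :
    HasDerivAt (symStep a N k l x) (symStep a N k (l + 1) x ξ) ξ := by
  induction N generalizing k with
  | zero => exact ha.hasDerivAt_right k l x ξ
  | succ N ih =>
    rw [symStep_succ]
    exact ((ih k).add (ih (k + 1))).congr_of_eventuallyEq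
      (Eventually.of_forall fun ξ => symStep_succ a N k l x ξ)

theorem continuous_symStep (ha : IsSymbolJet a) (N k l : ℕ) :
    Continuous fun z : ℝ × ℝ => symStep a N k l z.1 z.2 := by
  induction N generalizing k with
  | zero => exact ha.continuous k l
  | succ N ih =>
    simp only [symStep_succ]
    exact (ih k).add (ih (k + 1))

theorem exists_norm_symStep_le (ha : IsSymbolJet a) (N k l : ℕ) :
    ∃ C : ℝ, ∀ x ξ, ‖symStep a N k l x ξ‖ ≤ C := by
  induction N generalizing k with
  | zero => exact ha.bounded k l
  | succ N ih =>
    obtain ⟨C, hC⟩ := ih k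
    obtain ⟨C', hC'⟩ := ih (k + 1)
    refine ⟨C + C', fun x ξ => ?_⟩
    rw [symStep_succ]
    exact (norm_add_le _ _).trans (add_le_add (hC x ξ) (hC' x ξ))

theorem isJet_symStep (ha : IsSymbolJet a) (N : ℕ) (x : ℝ) :
    IsJet fun l ξ => symStep a N 0 l x ξ :=
  ⟨fun l ξ => ha.hasDerivAt_symStep N 0 l x ξ, fun l => by
    obtain ⟨C, hC⟩ := ha.exists_norm_symStep_le N 0 l
    exact PolyBdd.of_bound (hC x)⟩

theorem op_fourier_eq (ha : IsSymbolJet a) (N : ℕ) (h : 𝓢(ℝ, ℂ)) (ξ : ℝ) :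
    ha.op (𝓕 h) ξ = ∫ x, osc ξ x * winFourier N h ξ x * symStep a N 0 0 x ξ := by
  have hc : IsJet fun k x => a k 0 x ξ := ⟨fun k x => ha.hasDerivAt_left k 0 x ξ, fun k => by
    obtain ⟨C, hC⟩ := ha.bounded k 0
    exact PolyBdd.of_bound fun x => hC x ξ⟩
  rw [op_apply]
  calc _ = ∫ x, osc ξ x * 𝓕 h x * a 0 0 x ξ := by
        congr 1; ext x; rw [osc_comm]; ring
    _ = _ := hc.integral_osc_fourier_mul N ξ h

/-- The jet in `ξ` of the amplitude of the bilinear form of a symbol. -/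
noncomputable def _root_.Strip.ampJet (a : ℕ → ℕ → ℝ → ℝ → ℂ) (s : ℝ) (N : ℕ) (h : 𝓢(ℝ, ℂ)) (x : ℝ) :
    ℕ → ℝ → ℂ := fun n => jetMul n (wtDJet (-s)) fun m =>
  jetMul m (fun l ξ => symStep a N 0 l x ξ) (winFourierJet N h x)

theorem isJet_ampJet (ha : IsSymbolJet a) (s : ℝ) (N : ℕ) (h : 𝓢(ℝ, ℂ)) (x : ℝ) :
    IsJet (ampJet a s N h x) :=
  (isJet_wtDJet (-s)).jetMul ((ha.isJet_symStep N x).jetMul (isJet_winFourierJet N h x))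

/-- Two rounds of integration by parts. The one in `x`, through `op_fourier_eq`, uses `N`
derivatives of the symbol and localizes `h` near `ξ`; after Fubini, the one in `ξ` uses `M`
derivatives and localizes `f` near `x`. -/
theorem integral_op_eq (ha : IsSymbolJet a) (s : ℝ) (N M : ℕ) (f h : 𝓢(ℝ, ℂ)) :
    ∫ ξ, wtD (-s) ξ * 𝓕 f ξ * ha.op (𝓕 h) ξ =
      ∫ x, ∫ ξ, osc x ξ * winFourier M f x ξ * (jetStep^[M] (ampJet a s N h x)) 0 ξ := by
  have e1 : ∀ ξ, wtD (-s) ξ * 𝓕 f ξ * ha.op (𝓕 h) ξ = ∫ x, mulWtD (-s) (𝓕 f) ξ *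
      (osc ξ x * winFourier N h ξ x * symStep a N 0 0 x ξ) := fun ξ => by
    rw [integral_const_mul, ← ha.op_fourier_eq N h ξ, mulWtD_apply]
  simp only [e1]
  rw [integral_integral_swap]
  · congr 1
    ext x
    have h2 := (ha.isJet_ampJet s N h x).integral_osc_fourier_mul M x f
    refine Eq.trans ?_ h2
    congr 1
    ext ξ
    simp only [ampJet, jetMul, wtDJet_zero, winFourierJet, winCoeff_zero, mulWtD_apply, one_mul,
      add_zero, osc_comm ξ x]
    ring
  -- Absolute integrability of the double integral; these constants do not enter the final estimate.
  · obtain ⟨C, hC⟩ := exists_norm_winFourier_le_inv N h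
    obtain ⟨D, hD⟩ := ha.exists_norm_symStep_le N 0 0
    have hint : Integrable (fun z : ℝ × ℝ => mulWtD (-s) (𝓕 f) z.1 * ((C * D * (1 + z.2 ^ 2)⁻¹ : ℝ) : ℂ))
        (volume.prod volume) :=
      Integrable.mul_prod (mulWtD (-s) (𝓕 f)).integrable
        (integrable_inv_one_add_sq.const_mul (C * D)).ofReal
    have hcont : Continuous fun z : ℝ × ℝ => mulWtD (-s) (𝓕 f) z.1 *
        (osc z.1 z.2 * winFourier N h z.1 z.2 * symStep a N 0 0 z.2 z.1) :=
      ((mulWtD (-s) (𝓕 f)).continuous.comp continuous_fst).mul ((continuous_osc.mul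
        (continuous_winFourier N h)).mul ((ha.continuous_symStep N 0 0).comp continuous_swap))
    refine hint.norm.mono' hcont.aestronglyMeasurable (Eventually.of_forall fun z => ?_)
    change ‖mulWtD (-s) (𝓕 f) z.1 *
        (osc z.1 z.2 * winFourier N h z.1 z.2 * symStep a N 0 0 z.2 z.1)‖ ≤ _
    rw [norm_mul, norm_mul, norm_mul, norm_mul, norm_osc, one_mul, Complex.norm_real]
    refine mul_le_mul_of_nonneg_left ?_ (norm_nonneg _)
    calc _ ≤ (C * (1 + z.2 ^ 2)⁻¹) * D :=
          mul_le_mul (hC _ _) (hD _ _) (norm_nonneg _) ((norm_nonneg _).trans (hC z.1 z.2))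
      _ = C * D * (1 + z.2 ^ 2)⁻¹ := by ring
      _ ≤ _ := Real.le_norm_self _

end IsSymbolJet

/-- Each factor of the amplitude controls its own `ξ`-derivatives, so applying `1 + ∂_ξ` repeatedly
costs only constants. The weight `⟨2πξ⟩^{-s}` then meets `⟨2πη⟩^s` through the window, as in
`norm_wtD_mul_le`. -/
theorem exists_norm_ampJet_le (s : ℝ) (N M : ℕ) :
    ∃ C : ℝ, 0 ≤ C ∧ ∀ (a : ℕ → ℕ → ℝ → ℝ → ℂ) (D : ℝ),
      (∀ α ≤ N, ∀ β ≤ M, ∀ x ξ, ‖a α β x ξ‖ ≤ D) → ∀ (g : 𝓢(ℝ, ℂ)) (x ξ : ℝ),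
        ‖(jetStep^[M] (ampJet a s N (mulWtD s (𝓕 g)) x)) 0 ξ‖ ≤
          C * D * ∫ η, ‖winFourier M g (-x) η * wtD (|s| - N) (ξ - η)‖ := by
  obtain ⟨Cw, hCw, hw⟩ := exists_norm_wtDJet_le (-s) M
  obtain ⟨Cn, hCn, hn⟩ := exists_norm_winCoeff_le N M
  obtain ⟨Cf, hCf, hf⟩ := exists_norm_winFourier_le_integral s N M
  refine ⟨2 ^ M * (2 ^ M * (Cw * (2 ^ M * (2 ^ N * (Cn * (Cf * 2 ^ |s|)))))), by positivity,
    fun a D hD g x ξ => ?_⟩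
  have hD0 : 0 ≤ D := (norm_nonneg _).trans (hD 0 N.zero_le 0 M.zero_le 0 0)
  set E := ∫ η, ‖winFourier M g (-x) η‖ * (‖win N ξ η‖ * ‖wtD s η‖) with hE
  have h1 : ‖(jetStep^[M] (ampJet a s N (mulWtD s (𝓕 g)) x)) 0 ξ‖ ≤
      2 ^ M * (2 ^ M * ((Cw * ‖wtD (-s) ξ‖) * (2 ^ M * ((2 ^ N * D) * (Cn * (Cf * E)))))) := by
    have hE0 : 0 ≤ E := integral_nonneg fun η => by positivity
    refine norm_iterate_jetStep_le fun i hi => ?_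
    rw [zero_add]
    refine (norm_jetMul_le (B := Cw * ‖wtD (-s) ξ‖)
      (D := 2 ^ M * ((2 ^ N * D) * (Cn * (Cf * E)))) (fun j hj => hw j (hj.trans hi) ξ)
      fun j hj => ?_).trans ?_
    · refine (norm_jetMul_le (B := 2 ^ N * D) (D := Cn * (Cf * E)) (fun l hl =>
        norm_symStep_le fun k hk => hD k hk l (by omega) x ξ) fun l hl => ?_).trans ?_
      · rw [winFourierJet, norm_mul]
        exact mul_le_mul (hn l (by omega)) (hf l (by omega) g x ξ) (norm_nonneg _) hCn
      · gcongr
        exacts [one_le_two, by omega]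
    · gcongr
      exact one_le_two
  refine h1.trans ?_
  have h2 : ‖wtD (-s) ξ‖ * E ≤ 2 ^ |s| *
      ∫ η, ‖winFourier M g (-x) η * wtD (|s| - N) (ξ - η)‖ := by
    rw [hE, ← integral_const_mul, ← integral_const_mul]
    refine integral_mono_of_nonneg (Eventually.of_forall fun η => by positivity) ?_
      (Eventually.of_forall fun η => ?_)
    · refine Integrable.const_mul (Integrable.norm ?_) _
      have hb : PolyBdd fun η => wtD (|s| - N) (ξ - η) := by
        obtain ⟨C, t, hC, h⟩ := polyBdd_wtD (|s| - N)
        refine ⟨C * (2 ^ |t| * ‖wt |t| ξ‖), |t|, by positivity, fun η => (h _).trans ?_⟩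
        have h5 := norm_wt_mul_wt_le |t| (ξ - η) ξ
        rw [abs_abs, sub_sub_cancel_left] at h5
        have h6 : ‖wt (-|t|) ξ‖ * ‖wt |t| ξ‖ = 1 := by
          rw [← norm_mul, wt_mul_wt, neg_add_cancel, wt_zero, norm_one]
        have h7 : ‖wt |t| (-η)‖ = ‖wt |t| η‖ := by rw [norm_wt, norm_wt, neg_sq]
        rw [h7] at h5
        rw [mul_assoc]
        refine mul_le_mul_of_nonneg_left ?_ hC
        calc ‖wt t (ξ - η)‖ ≤ ‖wt |t| (ξ - η)‖ := norm_wt_le_of_le (le_abs_self t) _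
          _ = (‖wt |t| (ξ - η)‖ * ‖wt (-|t|) ξ‖) * ‖wt |t| ξ‖ := by rw [mul_assoc, h6, mul_one]
          _ ≤ (2 ^ |t| * ‖wt |t| η‖) * ‖wt |t| ξ‖ := by gcongr
          _ = _ := by ring
      exact hb.integrable_mul ((hasTemperateGrowth_wtD (|s| - N)).1.continuous.comp
        (continuous_const.sub continuous_id)) (𝓕 (mulWin M (-x) g))
    · dsimp only
      rw [norm_mul]
      calc _ = ‖winFourier M g (-x) η‖ * (‖wtD (-s) ξ‖ * (‖win N ξ η‖ * ‖wtD s η‖)) := by ring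
        _ ≤ ‖winFourier M g (-x) η‖ * (2 ^ |s| * ‖wtD (|s| - N) (ξ - η)‖) :=
          mul_le_mul_of_nonneg_left (norm_wtD_mul_le s N ξ η) (norm_nonneg _)
        _ = _ := by ring
  calc _ = (2 ^ M * (2 ^ M * (Cw * (2 ^ M * (2 ^ N * (Cn * Cf)))))) * D * (‖wtD (-s) ξ‖ * E) := by
        ring
    _ ≤ (2 ^ M * (2 ^ M * (Cw * (2 ^ M * (2 ^ N * (Cn * Cf)))))) * D *
        (2 ^ |s| * ∫ η, ‖winFourier M g (-x) η * wtD (|s| - N) (ξ - η)‖) := by gcongr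
    _ = _ := by ring

end Strip

/-! ### Young's inequality and the weighted bilinear estimate -/

namespace Strip

open SchwartzMap

theorem mul_le_sq_add_sq_ennreal (x y : ℝ≥0∞) : x * y ≤ x ^ 2 + y ^ 2 := by
  rcases le_total x y with h | h
  · calc x * y ≤ y * y := by gcongr
      _ = y ^ 2 := (sq y).symm
      _ ≤ _ := le_add_self
  · calc x * y ≤ x * x := by gcongr
      _ = x ^ 2 := (sq x).symm
      _ ≤ _ := le_self_add

/-- A form of Young's inequality. -/
theorem lintegral_lintegral_conv_le {F G k : ℝ → ℝ≥0∞} (hF : Measurable F) (hG : Measurable G)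
    (hk : Measurable k) {r r' : ℝ≥0∞} (hr : r * r' = 1) :
    ∫⁻ ξ, F ξ * ∫⁻ η, G η * k (ξ - η) ≤
      (∫⁻ ζ, k ζ) * (r ^ 2 * (∫⁻ ξ, F ξ ^ 2) + r' ^ 2 * ∫⁻ η, G η ^ 2) := by
  have hm : Measurable fun z : ℝ × ℝ => k (z.1 - z.2) := hk.comp (measurable_fst.sub measurable_snd)
  have hp : ∀ ξ η, F ξ * (G η * k (ξ - η)) ≤
      r ^ 2 * F ξ ^ 2 * k (ξ - η) + r' ^ 2 * G η ^ 2 * k (ξ - η) := fun ξ η => by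
    -- Since `r r' = 1`, reciprocal factors can be inserted before the product is split into
    -- squares.
    have h1 := mul_le_sq_add_sq_ennreal (r * F ξ) (r' * G η)
    calc F ξ * (G η * k (ξ - η)) = (r * r') * (F ξ * (G η * k (ξ - η))) := by rw [hr, one_mul]
      _ = (r * F ξ * (r' * G η)) * k (ξ - η) := by ring
      _ ≤ ((r * F ξ) ^ 2 + (r' * G η) ^ 2) * k (ξ - η) := by gcongr
      _ = _ := by ring
  have hk1 : ∀ ξ, ∫⁻ η, k (ξ - η) = ∫⁻ ζ, k ζ := fun ξ => lintegral_sub_left_eq_self k ξ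
  have hk2 : ∀ η, ∫⁻ ξ, k (ξ - η) = ∫⁻ ζ, k ζ := fun η => lintegral_sub_right_eq_self k η
  have hkm : ∀ ξ, Measurable fun η => k (ξ - η) := fun ξ => hk.comp (measurable_const.sub measurable_id)
  have hkm' : ∀ η, Measurable fun ξ => k (ξ - η) := fun η => hk.comp (measurable_id.sub measurable_const)
  have hA : Measurable fun z : ℝ × ℝ => r ^ 2 * F z.1 ^ 2 * k (z.1 - z.2) :=
    (((hF.comp measurable_fst).pow_const 2).const_mul _).mul hm
  have hB : Measurable fun z : ℝ × ℝ => r' ^ 2 * G z.2 ^ 2 * k (z.1 - z.2) :=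
    (((hG.comp measurable_snd).pow_const 2).const_mul _).mul hm
  calc ∫⁻ ξ, F ξ * ∫⁻ η, G η * k (ξ - η) = ∫⁻ ξ, ∫⁻ η, F ξ * (G η * k (ξ - η)) := by
        refine lintegral_congr fun ξ => ?_
        exact (lintegral_const_mul (F ξ) (hG.mul (hkm ξ))).symm
    _ ≤ ∫⁻ ξ, ∫⁻ η, (r ^ 2 * F ξ ^ 2 * k (ξ - η) + r' ^ 2 * G η ^ 2 * k (ξ - η)) :=
        lintegral_mono fun ξ => lintegral_mono fun η => hp ξ η
    _ = (∫⁻ ξ, ∫⁻ η, r ^ 2 * F ξ ^ 2 * k (ξ - η)) + ∫⁻ ξ, ∫⁻ η, r' ^ 2 * G η ^ 2 * k (ξ - η) := by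
        rw [← lintegral_add_left hA.lintegral_prod_right']
        refine lintegral_congr fun ξ => ?_
        rw [lintegral_add_left ((hkm ξ).const_mul _)]
    _ = (∫⁻ ξ, r ^ 2 * F ξ ^ 2 * ∫⁻ ζ, k ζ) + ∫⁻ η, r' ^ 2 * G η ^ 2 * ∫⁻ ζ, k ζ := by
        rw [lintegral_lintegral_swap (f := fun ξ η => r' ^ 2 * G η ^ 2 * k (ξ - η)) hB.aemeasurable]
        congr 1
        · refine lintegral_congr fun ξ => ?_
          rw [lintegral_const_mul _ (hkm ξ), hk1]
        · refine lintegral_congr fun η => ?_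
          rw [lintegral_const_mul _ (hkm' η), hk2]
    _ = _ := by
        rw [lintegral_mul_const _ ((hF.pow_const 2).const_mul _),
          lintegral_mul_const _ ((hG.pow_const 2).const_mul _),
          lintegral_const_mul _ (hF.pow_const 2), lintegral_const_mul _ (hG.pow_const 2)]
        ring

theorem measurable_winFourier (N : ℕ) (h : 𝓢(ℝ, ℂ)) :
    Measurable fun z : ℝ × ℝ => ‖winFourier N h z.1 z.2‖ₑ :=
  (continuous_enorm.comp (continuous_winFourier N h)).measurable

theorem continuous_winFourier_right (N : ℕ) (h : 𝓢(ℝ, ℂ)) (x : ℝ) :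
    Continuous (winFourier N h x) := (𝓕 (mulWin N x h) : 𝓢(ℝ, ℂ)).continuous

/-- The bilinear form of a symbol in weighted norms. -/
theorem exists_norm_integral_op_le (s₁ s₂ : ℝ) {N M : ℕ} (hN : |s₁| + 1 < N) (hM : |s₂| + 1 ≤ M) :
    ∃ C : ℝ, 0 ≤ C ∧ ∀ (a : ℕ → ℕ → ℝ → ℝ → ℂ) (ha : IsSymbolJet a) (D : ℝ),
      (∀ α ≤ N, ∀ β ≤ M, ∀ x ξ, ‖a α β x ξ‖ ≤ D) → ∀ f g : 𝓢(ℝ, ℂ),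
        ‖∫ ξ, wtD (-s₁) ξ * 𝓕 f ξ * ha.op (𝓕 (mulWtD s₁ (𝓕 g))) ξ‖ ≤
          C * D * (‖toL2 (mulWt s₂ f)‖ ^ 2 + ‖toL2 (mulWt (-s₂) g)‖ ^ 2) := by
  obtain ⟨C, hC, hamp⟩ := exists_norm_ampJet_le s₁ N M
  set κ := ∫⁻ ξ, ‖wtD (|s₁| - N) ξ‖ₑ with hκ
  have hκt : κ < ⊤ := lintegral_wtD_lt_top (by linarith)
  set B : ℝ := (2 ^ |s₂|) ^ 2 * Real.pi with hB
  have hB0 : 0 ≤ B := by positivity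
  refine ⟨C * (κ.toReal * B), by positivity, fun a ha D hD f g => ?_⟩
  have hD0 : 0 ≤ D := (norm_nonneg _).trans (hD 0 N.zero_le 0 M.zero_le 0 0)
  have hk : Measurable fun ζ => ‖wtD (|s₁| - N) ζ‖ₑ :=
    (continuous_enorm.comp (hasTemperateGrowth_wtD (|s₁| - N)).1.continuous).measurable
  -- At each `x` these reciprocals are the factors in Young's inequality: they give `f` the weight
  -- `⟨x⟩^{s₂}` and `g` the dual weight `⟨x⟩^{-s₂}`.
  have hr : ∀ x, ‖wt s₂ x‖ₑ * ‖wt (-s₂) x‖ₑ = 1 := fun x => by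
    rw [← enorm_mul, wt_mul_wt, add_neg_cancel, wt_zero, enorm_one]
  have hmW : ∀ s, Measurable fun x => ‖wt s x‖ₑ := fun s =>
    (continuous_enorm.comp (continuous_wt s)).measurable
  have hF := lintegral_wt_mul_winFourier_le s₂ hM f
  have hG := lintegral_wt_mul_winFourier_le (-s₂) (by rwa [abs_neg]) g (N := M)
  rw [abs_neg] at hG
  -- The function `g` is localized near `-x`; the weight is even, so reflection does not change the
  -- bound.
  have hG' : ∫⁻ x, ‖wt (-s₂) x‖ₑ ^ 2 * ∫⁻ ξ, ‖winFourier M g (-x) ξ‖ₑ ^ 2 ≤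
      ENNReal.ofReal B * ‖toL2 (mulWt (-s₂) g)‖ₑ ^ 2 := by
    refine le_trans (le_of_eq ?_) hG
    rw [← (Measure.measurePreserving_neg (volume : Measure ℝ)).lintegral_comp_emb
      (MeasurableEquiv.neg ℝ).measurableEmbedding]
    refine lintegral_congr fun x => ?_
    congr 2
    · rw [← ofReal_norm, ← ofReal_norm, norm_wt, norm_wt, neg_sq]
    · simp only [neg_neg]
  have hm1 : Measurable fun x => ‖wt s₂ x‖ₑ ^ 2 * ∫⁻ ξ, ‖winFourier M f x ξ‖ₑ ^ 2 :=
    ((hmW s₂).pow_const 2).mul ((measurable_winFourier M f).pow_const 2).lintegral_prod_right'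
  have key : ‖∫ ξ, wtD (-s₁) ξ * 𝓕 f ξ * ha.op (𝓕 (mulWtD s₁ (𝓕 g))) ξ‖ₑ ≤
      ENNReal.ofReal (C * D) * (κ * (ENNReal.ofReal B * ‖toL2 (mulWt s₂ f)‖ₑ ^ 2 +
        ENNReal.ofReal B * ‖toL2 (mulWt (-s₂) g)‖ₑ ^ 2)) := by
    rw [ha.integral_op_eq s₁ N M f]
    calc _ ≤ ∫⁻ x, ‖∫ ξ, osc x ξ * winFourier M f x ξ *
          (jetStep^[M] (ampJet a s₁ N (mulWtD s₁ (𝓕 g)) x)) 0 ξ‖ₑ :=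
          enorm_integral_le_lintegral_enorm _
      _ ≤ ∫⁻ x, ENNReal.ofReal (C * D) * (κ * (‖wt s₂ x‖ₑ ^ 2 * (∫⁻ ξ, ‖winFourier M f x ξ‖ₑ ^ 2) +
          ‖wt (-s₂) x‖ₑ ^ 2 * ∫⁻ ξ, ‖winFourier M g (-x) ξ‖ₑ ^ 2)) := by
        refine lintegral_mono fun x => (enorm_integral_le_lintegral_enorm _).trans ?_
        have h1 : ∀ ξ, ‖osc x ξ * winFourier M f x ξ *
            (jetStep^[M] (ampJet a s₁ N (mulWtD s₁ (𝓕 g)) x)) 0 ξ‖ₑ ≤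
            ENNReal.ofReal (C * D) * (‖winFourier M f x ξ‖ₑ *
              ∫⁻ η, ‖winFourier M g (-x) η‖ₑ * ‖wtD (|s₁| - N) (ξ - η)‖ₑ) := fun ξ => by
          have h2 := ENNReal.ofReal_le_ofReal (hamp a D hD g x ξ)
          rw [ENNReal.ofReal_mul (by positivity), ofReal_norm] at h2
          have h3 : ENNReal.ofReal (∫ η, ‖winFourier M g (-x) η * wtD (|s₁| - N) (ξ - η)‖) ≤
              ∫⁻ η, ‖winFourier M g (-x) η‖ₑ * ‖wtD (|s₁| - N) (ξ - η)‖ₑ := by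
            simp only [← enorm_mul]
            rw [← Real.enorm_eq_ofReal (integral_nonneg fun η => norm_nonneg _)]
            refine (enorm_integral_le_lintegral_enorm _).trans (le_of_eq ?_)
            simp only [enorm_norm]
          rw [enorm_mul, enorm_mul, ← ofReal_norm (osc x ξ), norm_osc, ENNReal.ofReal_one, one_mul]
          calc _ ≤ ‖winFourier M f x ξ‖ₑ * (ENNReal.ofReal (C * D) *
                ∫⁻ η, ‖winFourier M g (-x) η‖ₑ * ‖wtD (|s₁| - N) (ξ - η)‖ₑ) := by
                gcongr
                exact h2.trans (by gcongr)
            _ = _ := by ring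
        refine (lintegral_mono h1).trans ?_
        rw [lintegral_const_mul' _ _ ENNReal.ofReal_ne_top]
        refine mul_le_mul_right (lintegral_lintegral_conv_le
          (continuous_enorm.comp (continuous_winFourier_right M f x)).measurable
          (continuous_enorm.comp (continuous_winFourier_right M g (-x))).measurable hk (hr x)) _
      _ = ENNReal.ofReal (C * D) * (κ * ((∫⁻ x, ‖wt s₂ x‖ₑ ^ 2 *
            ∫⁻ ξ, ‖winFourier M f x ξ‖ₑ ^ 2) +
          ∫⁻ x, ‖wt (-s₂) x‖ₑ ^ 2 * ∫⁻ ξ, ‖winFourier M g (-x) ξ‖ₑ ^ 2)) := by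
        rw [lintegral_const_mul' _ _ ENNReal.ofReal_ne_top, lintegral_const_mul' _ _ hκt.ne,
          lintegral_add_left hm1]
      _ ≤ _ := by gcongr
  have h4 : ENNReal.ofReal (C * D) * (κ * (ENNReal.ofReal B * ‖toL2 (mulWt s₂ f)‖ₑ ^ 2 +
        ENNReal.ofReal B * ‖toL2 (mulWt (-s₂) g)‖ₑ ^ 2)) =
      ENNReal.ofReal (C * (κ.toReal * B) * D *
        (‖toL2 (mulWt s₂ f)‖ ^ 2 + ‖toL2 (mulWt (-s₂) g)‖ ^ 2)) := by
    have e : C * (κ.toReal * B) * D * (‖toL2 (mulWt s₂ f)‖ ^ 2 + ‖toL2 (mulWt (-s₂) g)‖ ^ 2) =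
        (C * D) * (κ.toReal * (B * ‖toL2 (mulWt s₂ f)‖ ^ 2 + B * ‖toL2 (mulWt (-s₂) g)‖ ^ 2)) := by
      ring
    rw [e, ENNReal.ofReal_mul (p := C * D) (by positivity), ENNReal.ofReal_mul ENNReal.toReal_nonneg,
      ENNReal.ofReal_toReal hκt.ne, ENNReal.ofReal_add (by positivity) (by positivity),
      ENNReal.ofReal_mul hB0, ENNReal.ofReal_mul hB0, ENNReal.ofReal_pow (norm_nonneg _),
      ENNReal.ofReal_pow (norm_nonneg _), ofReal_norm, ofReal_norm]
  rw [h4, ← ofReal_norm] at key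
  exact (ENNReal.ofReal_le_ofReal_iff (by positivity)).1 key

end Strip

namespace Strip

open SchwartzMap

/-! ### Pseudodifferential operators on the weighted Sobolev spaces -/

theorem norm_le_of_norm_pairL2_le {g : L2} {C : ℝ} (hC : 0 ≤ C)
    (h : ∀ φ : 𝓢(ℝ, ℂ), ‖pairL2 g (toL2 φ)‖ ≤ C * ‖toL2 φ‖) : ‖g‖ ≤ C := by
  have h1 : ∀ y : L2, ‖pairL2CLM g y‖ ≤ C * ‖y‖ := fun y =>
    denseRange_toL2.induction_on y
      (isClosed_le (pairL2CLM g).continuous.norm (continuous_const.mul continuous_norm)) h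
  -- Testing with the conjugate of `g` yields `‖g‖² ≤ C ‖g‖`.
  have h2 := h1 (conjL2 g)
  rw [pairL2CLM_apply, pairL2, inner_self_eq_norm_sq_to_K, norm_conjL2] at h2
  simp only [Complex.coe_algebraMap, norm_pow, Complex.norm_real, norm_norm] at h2
  rcases (norm_nonneg g).eq_or_lt with h0 | h0
  · rwa [← h0]
  · nlinarith

theorem le_two_mul_of_forall_le {P c A B : ℝ} (hA : 0 ≤ A) (hB : 0 ≤ B) (hc : 0 ≤ c)
    (h : ∀ l : ℝ, 0 < l → P ≤ c * ((l⁻¹ * B) ^ 2 + (l * A) ^ 2)) : P ≤ 2 * c * (A * B) := by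
  have h1 : ∀ ε : ℝ, 0 < ε → P ≤ 2 * c * ((A + ε) * (B + ε)) := fun ε hε => by
    have hA' : 0 < A + ε := by linarith
    have hB' : 0 < B + ε := by linarith
    -- This `l` balances the two squares and turns their sum into a product; `ε` keeps the quotient
    -- meaningful when `A` or `B` vanishes, and then tends to `0`.
    have h2 := h (√((B + ε) / (A + ε))) (by positivity)
    rw [mul_pow, mul_pow, inv_pow, Real.sq_sqrt (by positivity)] at h2
    refine h2.trans ?_
    have h3 : ((B + ε) / (A + ε))⁻¹ * B ^ 2 ≤ ((B + ε) / (A + ε))⁻¹ * (B + ε) ^ 2 := by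
      gcongr; linarith
    have h4 : (B + ε) / (A + ε) * A ^ 2 ≤ (B + ε) / (A + ε) * (A + ε) ^ 2 := by
      gcongr; linarith
    have h5 : ((B + ε) / (A + ε))⁻¹ * (B + ε) ^ 2 + (B + ε) / (A + ε) * (A + ε) ^ 2 =
        2 * ((A + ε) * (B + ε)) := by field_simp; ring
    calc _ ≤ c * (2 * ((A + ε) * (B + ε))) := by
          rw [← h5]; gcongr
      _ = _ := by ring
  have h2 : Tendsto (fun ε : ℝ => 2 * c * ((A + ε) * (B + ε))) (𝓝[>] 0) (𝓝 (2 * c * (A * B))) := by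
    have : Continuous fun ε : ℝ => 2 * c * ((A + ε) * (B + ε)) := by fun_prop
    simpa using (this.tendsto 0).mono_left nhdsWithin_le_nhds
  exact ge_of_tendsto h2 (by filter_upwards [self_mem_nhdsWithin] with ε hε using h1 ε hε)

theorem fourierInv_fourierInv_apply (g : 𝓢(ℝ, ℂ)) (x : ℝ) :
    𝓕⁻ (𝓕⁻ g : 𝓢(ℝ, ℂ)) x = g (-x) := by
  have h1 : 𝓕⁻ (𝓕⁻ g : 𝓢(ℝ, ℂ)) x = 𝓕 (𝓕⁻ g : 𝓢(ℝ, ℂ)) (-x) := by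
    rw [fourierInv_coe, fourier_coe, Real.fourierInv_eq_fourier_neg]
  rw [h1, FourierTransform.fourier_fourierInv_eq]

theorem norm_toL2_mulWt_fourierInv_fourierInv (s : ℝ) (g : 𝓢(ℝ, ℂ)) :
    ‖toL2 (mulWt s (𝓕⁻ (𝓕⁻ g : 𝓢(ℝ, ℂ))))‖ = ‖toL2 (mulWt s g)‖ := by
  refine (sq_eq_sq₀ (norm_nonneg _) (norm_nonneg _)).1 ?_
  rw [norm_toL2_sq, norm_toL2_sq, ← integral_neg_eq_self]
  congr 1
  ext x
  rw [mulWt_apply, mulWt_apply, fourierInv_fourierInv_apply, neg_neg, norm_mul, norm_mul, norm_wt,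
    norm_wt, neg_sq]

namespace IsSymbolJet

variable {a b : ℕ → ℕ → ℝ → ℝ → ℂ}

/-- The action of a symbol on test functions, conjugated by the weights of `H^{s₁,s₂}`. -/
noncomputable def conjOp (ha : IsSymbolJet a) (s₁ s₂ : ℝ) : 𝓢(ℝ, ℂ) →ₗ[ℂ] 𝓢(ℝ, ℂ) :=
  (mulWt (-s₂)).toLinearMap ∘ₗ (FourierTransform.fourierCLM ℂ 𝓢(ℝ, ℂ)).toLinearMap ∘ₗ
    (mulWtD (-s₁)).toLinearMap ∘ₗ ha.op ∘ₗ (bessel s₁).toLinearMap ∘ₗ (mulWt s₂).toLinearMap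

theorem conjOp_apply (ha : IsSymbolJet a) (s₁ s₂ : ℝ) (χ : 𝓢(ℝ, ℂ)) :
    ha.conjOp s₁ s₂ χ =
      mulWt (-s₂) (𝓕 (mulWtD (-s₁) (ha.op (bessel s₁ (mulWt s₂ χ))))) := rfl

/-- The outer `𝓕` is moved onto `ψ`, being its own transpose. The inner `bessel` involves `𝓕⁻¹`
whereas the bilinear estimate is stated with `𝓕 g`, so `g` is taken to be `𝓕⁻¹ 𝓕⁻¹` of the given
function, a reflection that preserves weighted norms. -/
theorem pairL2_conjOp (ha : IsSymbolJet a) (s₁ s₂ : ℝ) (χ ψ : 𝓢(ℝ, ℂ)) :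
    pairL2 (toL2 (ha.conjOp s₁ s₂ χ)) (toL2 ψ) =
      ∫ ξ, wtD (-s₁) ξ * 𝓕 (mulWt (-s₂) ψ) ξ *
        ha.op (𝓕 (mulWtD s₁ (𝓕 (𝓕⁻ (𝓕⁻ (mulWt s₂ χ) : 𝓢(ℝ, ℂ)))))) ξ := by
  rw [toL2_apply, toL2_apply, pairL2_toLp_toLp, conjOp_apply]
  set u := mulWtD (-s₁) (ha.op (bessel s₁ (mulWt s₂ χ))) with hu
  have h1 := integral_fourier_mul_eq (mulWt (-s₂) ψ) u
  calc ∫ x, ψ x * mulWt (-s₂) (𝓕 u) x = ∫ x, mulWt (-s₂) ψ x * 𝓕 u x := by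
        congr 1; ext x; rw [mulWt_apply, mulWt_apply]; ring
    _ = ∫ x, 𝓕 (mulWt (-s₂) ψ) x * u x := h1.symm
    _ = _ := by
        congr 1
        ext ξ
        rw [hu, mulWtD_apply, FourierTransform.fourier_fourierInv_eq, bessel_apply]
        ring

end IsSymbolJet

/-- Zero-order operators are bounded on the weighted Sobolev spaces. -/
theorem exists_norm_conjOp_le (s₁ s₂ : ℝ) :
    ∃ C : ℝ, 0 ≤ C ∧ ∀ (a : ℕ → ℕ → ℝ → ℝ → ℂ) (ha : IsSymbolJet a) (D : ℝ),
      (∀ α ≤ ⌊|s₁|⌋₊ + 2, ∀ β ≤ ⌊|s₂|⌋₊ + 2, ∀ x ξ, ‖a α β x ξ‖ ≤ D) → ∀ χ : 𝓢(ℝ, ℂ),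
        ‖toL2 (ha.conjOp s₁ s₂ χ)‖ ≤ C * D * ‖toL2 χ‖ := by
  obtain ⟨C, hC, h⟩ := exists_norm_integral_op_le s₁ s₂ (lt_floor_add_two s₁)
    (lt_floor_add_two s₂).le
  refine ⟨2 * C, by positivity, fun a ha D hD χ => ?_⟩
  have hD0 : 0 ≤ D := (norm_nonneg _).trans (hD 0 (Nat.zero_le _) 0 (Nat.zero_le _) 0 0)
  refine norm_le_of_norm_pairL2_le (by positivity) fun ψ => ?_
  have key : ∀ χ ψ : 𝓢(ℝ, ℂ), ‖pairL2 (toL2 (ha.conjOp s₁ s₂ χ)) (toL2 ψ)‖ ≤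
      C * D * (‖toL2 ψ‖ ^ 2 + ‖toL2 χ‖ ^ 2) := fun χ ψ => by
    rw [ha.pairL2_conjOp]
    refine (h a ha D hD _ _).trans (le_of_eq ?_)
    rw [norm_toL2_mulWt_fourierInv_fourierInv, mulWt_mulWt, mulWt_mulWt, add_neg_cancel,
      neg_add_cancel, mulWt_zero, mulWt_zero]
  -- The pairing is unchanged when `χ` is multiplied by `l` and `ψ` by `l⁻¹`; optimizing over `l`
  -- turns the sum of squares into a product of norms.
  have h1 := le_two_mul_of_forall_le (P := ‖pairL2 (toL2 (ha.conjOp s₁ s₂ χ)) (toL2 ψ)‖)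
    (c := C * D) (A := ‖toL2 χ‖) (B := ‖toL2 ψ‖) (norm_nonneg _) (norm_nonneg _) (by positivity)
    fun l hl => by
      have h2 := key ((l : ℂ) • χ) (((l⁻¹ : ℝ) : ℂ) • ψ)
      rw [map_smul, map_smul, map_smul, map_smul, norm_smul, norm_smul, Complex.norm_real,
        Complex.norm_real, Real.norm_of_nonneg hl.le, Real.norm_of_nonneg (by positivity)] at h2
      refine le_trans (le_of_eq ?_) h2
      rw [pairL2, pairL2, map_smulₛₗ, inner_smul_left, inner_smul_right]
      simp only [Complex.conj_ofReal]
      rw [← mul_assoc, ← Complex.ofReal_mul, mul_inv_cancel₀ hl.ne', Complex.ofReal_one, one_mul]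
  calc _ ≤ _ := h1
    _ = _ := by ring

namespace IsSymbolJet

variable {a b : ℕ → ℕ → ℝ → ℝ → ℂ}

/-- The operator of a symbol on `H^{s₁,s₂}`, transported to `L²`. -/
noncomputable def sobOp (ha : IsSymbolJet a) (s₁ s₂ : ℝ) : L2 →L[ℂ] L2 :=
  transposeL2 (ha.conjOp s₁ s₂)

theorem exists_bound (ha : IsSymbolJet a) (N M : ℕ) :
    ∃ D : ℝ, ∀ α ≤ N, ∀ β ≤ M, ∀ x ξ, ‖a α β x ξ‖ ≤ D := by
  choose C hC using ha.bounded
  have h0 : ∀ α β, 0 ≤ C α β := fun α β => (norm_nonneg _).trans (hC α β 0 0)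
  refine ⟨∑ α ∈ Finset.range (N + 1), ∑ β ∈ Finset.range (M + 1), C α β,
    fun α hα β hβ x ξ => (hC α β x ξ).trans ?_⟩
  refine (Finset.single_le_sum (f := fun β => C α β) (fun i _ => h0 α i)
    (Finset.mem_range.2 (by omega : β < M + 1))).trans ?_
  exact Finset.single_le_sum (f := fun α => ∑ β ∈ Finset.range (M + 1), C α β)
    (fun i _ => Finset.sum_nonneg fun j _ => h0 i j) (Finset.mem_range.2 (by omega : α < N + 1))

theorem pairL2_sobOp (ha : IsSymbolJet a) (s₁ s₂ : ℝ) (g : L2) (φ : 𝓢(ℝ, ℂ)) :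
    pairL2 (ha.sobOp s₁ s₂ g) (toL2 φ) = pairL2 g (toL2 (ha.conjOp s₁ s₂ φ)) := by
  obtain ⟨C, -, hC⟩ := exists_norm_conjOp_le s₁ s₂
  obtain ⟨D, hD⟩ := ha.exists_bound (⌊|s₁|⌋₊ + 2) (⌊|s₂|⌋₊ + 2)
  exact pairL2_transposeL2 (hC a ha D hD) g φ

/-- The weights in `conjOp` cancel those of the embedding, so `sobOp` acts on distributions as the
operator of the symbol, in the form demanded by `IsPseudoDiff`. -/
theorem sobEmb_sobOp (ha : IsSymbolJet a) (s₁ s₂ : ℝ) (g : L2) (φ : 𝓢(ℝ, ℂ)) :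
    sobEmb s₁ s₂ (ha.sobOp s₁ s₂ g) φ = (𝓕 (sobEmb s₁ s₂ g)) (ha.op φ) := by
  rw [TemperedDistribution.fourier_apply, sobEmb_apply, sobEmb_apply, ha.pairL2_sobOp,
    conjOp_apply, mulWt_mulWt, add_neg_cancel, mulWt_zero, bessel_bessel, add_neg_cancel,
    bessel_zero, bessel_apply, FourierTransform.fourierInv_fourier_eq]

theorem sub (ha : IsSymbolJet a) (hb : IsSymbolJet b) :
    IsSymbolJet fun α β x ξ => a α β x ξ - b α β x ξ where
  hasDerivAt_left α β x ξ := (ha.hasDerivAt_left α β x ξ).sub (hb.hasDerivAt_left α β x ξ)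
  hasDerivAt_right α β x ξ := (ha.hasDerivAt_right α β x ξ).sub (hb.hasDerivAt_right α β x ξ)
  bounded α β := by
    obtain ⟨C, hC⟩ := ha.bounded α β
    obtain ⟨D, hD⟩ := hb.bounded α β
    exact ⟨C + D, fun x ξ => (norm_sub_le _ _).trans (add_le_add (hC x ξ) (hD x ξ))⟩
  continuous α β := (ha.continuous α β).sub (hb.continuous α β)

theorem op_sub (ha : IsSymbolJet a) (hb : IsSymbolJet b) (φ : 𝓢(ℝ, ℂ)) :
    (ha.sub hb).op φ = ha.op φ - hb.op φ := by
  ext ξ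
  rw [sub_apply, op_apply, op_apply, op_apply, ← integral_sub (ha.integrable_integrand 0 0 φ ξ)
    (hb.integrable_integrand 0 0 φ ξ)]
  congr 1
  ext x
  ring

theorem sobOp_sub (ha : IsSymbolJet a) (hb : IsSymbolJet b) (s₁ s₂ : ℝ) :
    (ha.sub hb).sobOp s₁ s₂ = ha.sobOp s₁ s₂ - hb.sobOp s₁ s₂ := by
  ext1 g
  refine pairL2_ext fun φ => ?_
  have e : (ha.sub hb).conjOp s₁ s₂ φ = ha.conjOp s₁ s₂ φ - hb.conjOp s₁ s₂ φ := by
    rw [conjOp_apply, conjOp_apply, conjOp_apply, ha.op_sub hb,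
      ← FourierTransform.fourierCLM_apply (R := ℂ), map_sub, map_sub, map_sub]
    rfl
  have e2 : ∀ g h k : L2, pairL2 (g - h) k = pairL2 g k - pairL2 h k := fun g h k => by
    rw [pairL2, map_sub, inner_sub_left]; rfl
  rw [_root_.sub_apply, e2, pairL2_sobOp, pairL2_sobOp, pairL2_sobOp, e, map_sub]
  rw [pairL2, inner_sub_right]
  rfl

end IsSymbolJet

theorem exists_norm_sobOp_le (s₁ s₂ : ℝ) :
    ∃ C : ℝ, 0 ≤ C ∧ ∀ (a : ℕ → ℕ → ℝ → ℝ → ℂ) (ha : IsSymbolJet a) (D : ℝ),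
      (∀ α ≤ ⌊|s₁|⌋₊ + 2, ∀ β ≤ ⌊|s₂|⌋₊ + 2, ∀ x ξ, ‖a α β x ξ‖ ≤ D) →
        ‖ha.sobOp s₁ s₂‖ ≤ C * D := by
  obtain ⟨C, hC0, hC⟩ := exists_norm_conjOp_le s₁ s₂
  refine ⟨C, hC0, fun a ha D hD => norm_transposeL2_le ?_ (hC a ha D hD)⟩
  exact mul_nonneg hC0 ((norm_nonneg _).trans (hD 0 (Nat.zero_le _) 0 (Nat.zero_le _) 0 0))

end Strip

namespace Strip

open SchwartzMap

/-! ### Symbols of order zero as jets -/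

/-- The derivative of `F` in the direction `v`. -/
noncomputable def dirDeriv (v : ℝ × ℝ × ℝ) (F : ℝ × ℝ × ℝ → ℂ) (z : ℝ × ℝ × ℝ) : ℂ :=
  fderiv ℝ F z v

section dirDeriv

variable {F : ℝ × ℝ × ℝ → ℂ}

theorem contDiff_dirDeriv (hF : ContDiff ℝ ∞ F) (v : ℝ × ℝ × ℝ) : ContDiff ℝ ∞ (dirDeriv v F) :=
  (hF.fderiv_right (m := ∞) (by simp)).clm_apply contDiff_const

theorem contDiff_iterate_dirDeriv (hF : ContDiff ℝ ∞ F) (v : ℝ × ℝ × ℝ) (n : ℕ) :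
    ContDiff ℝ ∞ ((dirDeriv v)^[n] F) := by
  induction n with
  | zero => exact hF
  | succ n ih => rw [Function.iterate_succ_apply']; exact contDiff_dirDeriv ih v

theorem dirDeriv_comm (hF : ContDiff ℝ ∞ F) (v w : ℝ × ℝ × ℝ) :
    dirDeriv v (dirDeriv w F) = dirDeriv w (dirDeriv v F) := by
  ext z
  have h2 : DifferentiableAt ℝ (fderiv ℝ F) z :=
    (hF.fderiv_right (m := ∞) (by simp)).differentiable (by simp) z
  have key : ∀ v w : ℝ × ℝ × ℝ, dirDeriv v (dirDeriv w F) z = fderiv ℝ (fderiv ℝ F) z v w := by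
    intro v w
    have h := (h2.hasFDerivAt.clm_apply (hasFDerivAt_const w z)).fderiv
    rw [dirDeriv]
    change fderiv ℝ (fun y => fderiv ℝ F y w) z v = _
    rw [h]
    simp
  rw [key, key]
  exact (hF.contDiffAt.isSymmSndFDerivAt (by
    simpa using WithTop.coe_le_coe.2 (le_top : (2 : ℕ∞) ≤ ⊤))).eq v w

theorem dirDeriv_iterate_comm (hF : ContDiff ℝ ∞ F) (v w : ℝ × ℝ × ℝ) (n : ℕ) :
    dirDeriv v ((dirDeriv w)^[n] F) = (dirDeriv w)^[n] (dirDeriv v F) := by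
  induction n with
  | zero => rfl
  | succ n ih =>
    rw [Function.iterate_succ_apply', dirDeriv_comm (contDiff_iterate_dirDeriv hF w n), ih,
      Function.iterate_succ_apply']

theorem hasDerivAt_dirDeriv (hF : ContDiff ℝ ∞ F) {γ : ℝ → ℝ × ℝ × ℝ} {v : ℝ × ℝ × ℝ} {s : ℝ}
    (hγ : HasDerivAt γ v s) : HasDerivAt (fun s => F (γ s)) (dirDeriv v F (γ s)) s :=
  (hF.differentiable (by simp) (γ s)).hasFDerivAt.comp_hasDerivAt s hγ

theorem iteratedDeriv_eq_iterate_dirDeriv (hF : ContDiff ℝ ∞ F) {γ : ℝ → ℝ × ℝ × ℝ}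
    {v : ℝ × ℝ × ℝ} (hγ : ∀ s, HasDerivAt γ v s) (n : ℕ) :
    iteratedDeriv n (fun s => F (γ s)) = fun s => (dirDeriv v)^[n] F (γ s) := by
  induction n with
  | zero => simp
  | succ n ih =>
    rw [iteratedDeriv_succ, ih]
    ext s
    rw [Function.iterate_succ_apply']
    exact (hasDerivAt_dirDeriv (contDiff_iterate_dirDeriv hF v n) (hγ s)).deriv

end dirDeriv

theorem hasDerivAt_line_fst (t x ξ : ℝ) :
    HasDerivAt (fun t : ℝ => (t, x, ξ)) ((1, 0, 0) : ℝ × ℝ × ℝ) t :=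
  (hasDerivAt_id t).prodMk ((hasDerivAt_const t x).prodMk (hasDerivAt_const t ξ))

theorem hasDerivAt_line_snd (t x ξ : ℝ) :
    HasDerivAt (fun x : ℝ => (t, x, ξ)) ((0, 1, 0) : ℝ × ℝ × ℝ) x :=
  (hasDerivAt_const x t).prodMk ((hasDerivAt_id x).prodMk (hasDerivAt_const x ξ))

theorem hasDerivAt_line_trd (t x ξ : ℝ) :
    HasDerivAt (fun ξ : ℝ => (t, x, ξ)) ((0, 0, 1) : ℝ × ℝ × ℝ) ξ :=
  (hasDerivAt_const ξ t).prodMk ((hasDerivAt_const ξ x).prodMk (hasDerivAt_id ξ))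

section symbolDeriv

variable {B : ℝ → ℝ → ℝ → ℂ}

/-- Iterated partial derivatives become iterates of directional derivatives of one smooth function
on `ℝ³`. These commute, so a `ξ`-derivative can be taken after the `x`-derivatives. -/
theorem symbolDeriv_eq (hB : ContDiff ℝ ∞ fun z : ℝ × ℝ × ℝ => B z.1 z.2.1 z.2.2)
    (m α β : ℕ) (t x ξ : ℝ) :
    symbolDeriv m α β B t x ξ = (dirDeriv (1, 0, 0))^[m] ((dirDeriv (0, 1, 0))^[α]
      ((dirDeriv (0, 0, 1))^[β] fun z : ℝ × ℝ × ℝ => B z.1 z.2.1 z.2.2)) (t, x, ξ) := by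
  have h1 : ∀ t x, iteratedDeriv β (B t x) = fun ξ => (dirDeriv (0, 0, 1))^[β]
      (fun z : ℝ × ℝ × ℝ => B z.1 z.2.1 z.2.2) (t, x, ξ) := fun t x =>
    iteratedDeriv_eq_iterate_dirDeriv hB (hasDerivAt_line_trd t x) β
  have h2 := contDiff_iterate_dirDeriv hB (0, 0, 1) β
  have h3 := fun t => iteratedDeriv_eq_iterate_dirDeriv h2 (fun x => hasDerivAt_line_snd t x ξ) α
  have h4 := iteratedDeriv_eq_iterate_dirDeriv (contDiff_iterate_dirDeriv h2 (0, 1, 0) α)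
    (fun t => hasDerivAt_line_fst t x ξ) m
  simp only [symbolDeriv, h1, h3, h4]

theorem continuous_symbolDeriv (hB : ContDiff ℝ ∞ fun z : ℝ × ℝ × ℝ => B z.1 z.2.1 z.2.2)
    (m α β : ℕ) : Continuous fun z : ℝ × ℝ × ℝ => symbolDeriv m α β B z.1 z.2.1 z.2.2 := by
  simp only [symbolDeriv_eq hB]
  exact (contDiff_iterate_dirDeriv (contDiff_iterate_dirDeriv (contDiff_iterate_dirDeriv hB _ _)
    _ _) _ _).continuous

theorem hasDerivAt_symbolDeriv_fst (hB : ContDiff ℝ ∞ fun z : ℝ × ℝ × ℝ => B z.1 z.2.1 z.2.2)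
    (m α β : ℕ) (t x ξ : ℝ) :
    HasDerivAt (fun t => symbolDeriv m α β B t x ξ) (symbolDeriv (m + 1) α β B t x ξ) t := by
  simp only [symbolDeriv_eq hB, Function.iterate_succ_apply']
  exact hasDerivAt_dirDeriv (contDiff_iterate_dirDeriv (contDiff_iterate_dirDeriv
    (contDiff_iterate_dirDeriv hB _ _) _ _) _ _) (hasDerivAt_line_fst t x ξ)

theorem hasDerivAt_symbolDeriv_snd (hB : ContDiff ℝ ∞ fun z : ℝ × ℝ × ℝ => B z.1 z.2.1 z.2.2)
    (α β : ℕ) (t x ξ : ℝ) :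
    HasDerivAt (fun x => symbolDeriv 0 α β B t x ξ) (symbolDeriv 0 (α + 1) β B t x ξ) x := by
  simp only [symbolDeriv_eq hB, Function.iterate_succ_apply', Function.iterate_zero, id]
  exact hasDerivAt_dirDeriv (contDiff_iterate_dirDeriv
    (contDiff_iterate_dirDeriv hB _ _) _ _) (hasDerivAt_line_snd t x ξ)

theorem hasDerivAt_symbolDeriv_trd (hB : ContDiff ℝ ∞ fun z : ℝ × ℝ × ℝ => B z.1 z.2.1 z.2.2)
    (α β : ℕ) (t x ξ : ℝ) :
    HasDerivAt (fun ξ => symbolDeriv 0 α β B t x ξ) (symbolDeriv 0 α (β + 1) B t x ξ) ξ := by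
  simp only [symbolDeriv_eq hB, Function.iterate_succ_apply' _ β, Function.iterate_zero, id]
  have h := contDiff_iterate_dirDeriv hB (0, 0, 1) β
  rw [← dirDeriv_iterate_comm h]
  exact hasDerivAt_dirDeriv (contDiff_iterate_dirDeriv h _ _) (hasDerivAt_line_trd t x ξ)

theorem one_le_japanese (x : ℝ) : 1 ≤ japanese x :=
  Real.one_le_sqrt.2 (by nlinarith [sq_nonneg x])

/-- The weights in the seminorm are at least `1`, so it dominates the plain supremum, and the
operator bounds need no more than that. -/
theorem norm_symbolDeriv_le {a b : ℝ} {m α β : ℕ} {C : ℝ} (hC : 0 ≤ C)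
    (h : symbolSeminorm a b m α β B ≤ ENNReal.ofReal C) {t : ℝ} (ht : t ∈ Icc a b) (x ξ : ℝ) :
    ‖symbolDeriv m α β B t x ξ‖ ≤ C := by
  have h1 : ENNReal.ofReal (japanese x ^ α * japanese ξ ^ β * ‖symbolDeriv m α β B t x ξ‖) ≤
      symbolSeminorm a b m α β B :=
    le_iSup₂_of_le t ht (le_iSup_of_le x (le_iSup_of_le ξ le_rfl))
  have h2 := (ENNReal.ofReal_le_ofReal_iff hC).1 (h1.trans h)
  refine le_trans ?_ h2
  refine le_mul_of_one_le_left (norm_nonneg _) ?_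
  exact one_le_mul_of_one_le_of_one_le (one_le_pow₀ (one_le_japanese x))
    (one_le_pow₀ (one_le_japanese ξ))

end symbolDeriv

/-- The derivatives of `(x, ξ) ↦ B(t, x, 2πξ)`. -/
noncomputable def symbolJet (B : ℝ → ℝ → ℝ → ℂ) (t : ℝ) (α β : ℕ) (x ξ : ℝ) : ℂ :=
  (2 * Real.pi : ℂ) ^ β * symbolDeriv 0 α β B t x (2 * Real.pi * ξ)

theorem norm_symbolJet_sub (B : ℝ → ℝ → ℝ → ℂ) (t s : ℝ) (α β : ℕ) (x ξ : ℝ) :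
    ‖symbolJet B t α β x ξ - symbolJet B s α β x ξ‖ = (2 * Real.pi) ^ β *
      ‖symbolDeriv 0 α β B t x (2 * Real.pi * ξ) - symbolDeriv 0 α β B s x (2 * Real.pi * ξ)‖ := by
  rw [symbolJet, symbolJet, ← mul_sub, norm_mul, norm_pow]
  congr 2
  rw [norm_mul, Complex.norm_real, Real.norm_of_nonneg Real.pi_pos.le]
  simp

theorem norm_symbolJet (B : ℝ → ℝ → ℝ → ℂ) (t : ℝ) (α β : ℕ) (x ξ : ℝ) :
    ‖symbolJet B t α β x ξ‖ =
      (2 * Real.pi) ^ β * ‖symbolDeriv 0 α β B t x (2 * Real.pi * ξ)‖ := by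
  rw [symbolJet, norm_mul, norm_pow]
  congr 2
  rw [norm_mul, Complex.norm_real, Real.norm_of_nonneg Real.pi_pos.le]
  simp

namespace IsZeroOrderSymbol

variable {B : ℝ → ℝ → ℝ → ℂ} {a b : ℝ}

theorem exists_norm_symbolDeriv_le (hB : IsZeroOrderSymbol a b B) (m α β : ℕ) :
    ∃ C : ℝ, 0 ≤ C ∧ ∀ t ∈ Icc a b, ∀ x ξ, ‖symbolDeriv m α β B t x ξ‖ ≤ C :=
  ⟨(symbolSeminorm a b m α β B).toReal, ENNReal.toReal_nonneg, fun _ ht x ξ =>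
    norm_symbolDeriv_le ENNReal.toReal_nonneg
      (by rw [ENNReal.ofReal_toReal (hB.2 m α β).ne]) ht x ξ⟩

theorem isSymbolJet (hB : IsZeroOrderSymbol a b B) {t : ℝ} (ht : t ∈ Icc a b) :
    IsSymbolJet (symbolJet B t) where
  hasDerivAt_left α β x ξ := (hasDerivAt_symbolDeriv_snd hB.1 α β t x _).const_mul _
  hasDerivAt_right α β x ξ := by
    have h1 : HasDerivAt (fun ξ : ℝ => 2 * Real.pi * ξ) (2 * Real.pi) ξ := by
      simpa using (hasDerivAt_id ξ).const_mul (2 * Real.pi)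
    have h2 := ((hasDerivAt_symbolDeriv_trd hB.1 α β t x (2 * Real.pi * ξ)).scomp ξ h1).const_mul
      ((2 * Real.pi : ℂ) ^ β)
    refine h2.congr_deriv ?_
    rw [symbolJet, Complex.real_smul]
    push_cast
    ring
  bounded α β := by
    obtain ⟨C, -, hC⟩ := hB.exists_norm_symbolDeriv_le 0 α β
    refine ⟨(2 * Real.pi) ^ β * C, fun x ξ => ?_⟩
    rw [norm_symbolJet]
    exact mul_le_mul_of_nonneg_left (hC t ht _ _) (by positivity)
  continuous α β := by
    have h := continuous_symbolDeriv hB.1 0 α β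
    have h2 : Continuous fun z : ℝ × ℝ => (t, z.1, 2 * Real.pi * z.2) := by fun_prop
    exact continuous_const.mul (h.comp h2)

theorem exists_norm_symbolJet_sub_le (hB : IsZeroOrderSymbol a b B) (N M : ℕ) :
    ∃ C : ℝ, 0 ≤ C ∧ ∀ α ≤ N, ∀ β ≤ M, ∀ t ∈ Icc a b, ∀ s ∈ Icc a b, ∀ x ξ,
      ‖symbolJet B t α β x ξ - symbolJet B s α β x ξ‖ ≤ C * |t - s| := by
  choose C h0 hC using hB.exists_norm_symbolDeriv_le 1
  refine ⟨∑ α ∈ Finset.range (N + 1), ∑ β ∈ Finset.range (M + 1), (2 * Real.pi) ^ β * C α β,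
    Finset.sum_nonneg fun α _ => Finset.sum_nonneg fun β _ => mul_nonneg (by positivity) (h0 α β),
    fun α hα β hβ t ht s hs x ξ => ?_⟩
  rw [norm_symbolJet_sub]
  have h1 := (convex_Icc a b).norm_image_sub_le_of_norm_hasDerivWithin_le
    (fun r _ => (hasDerivAt_symbolDeriv_fst hB.1 0 α β r x (2 * Real.pi * ξ)).hasDerivWithinAt)
    (fun r hr => hC α β r hr x (2 * Real.pi * ξ)) hs ht
  rw [Real.norm_eq_abs] at h1
  calc (2 * Real.pi) ^ β * _ ≤ (2 * Real.pi) ^ β * (C α β * |t - s|) :=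
        mul_le_mul_of_nonneg_left h1 (by positivity)
    _ = (2 * Real.pi) ^ β * C α β * |t - s| := by ring
    _ ≤ _ := by
      refine mul_le_mul_of_nonneg_right ?_ (abs_nonneg _)
      refine (Finset.single_le_sum (f := fun β => (2 * Real.pi) ^ β * C α β)
        (fun i _ => mul_nonneg (by positivity) (h0 α i))
        (Finset.mem_range.2 (by omega : β < M + 1))).trans ?_
      exact Finset.single_le_sum
        (f := fun α => ∑ β ∈ Finset.range (M + 1), (2 * Real.pi) ^ β * C α β)
        (fun i _ => Finset.sum_nonneg fun j _ => mul_nonneg (by positivity) (h0 i j))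
        (Finset.mem_range.2 (by omega : α < N + 1))

open Classical in
/-- The family of operators `B(t, x, D)` on `H^{s₁,s₂}`, transported to `L²`. -/
noncomputable def sobFamily (hB : IsZeroOrderSymbol a b B) (s₁ s₂ t : ℝ) : L2 →L[ℂ] L2 :=
  if ht : t ∈ Icc a b then (hB.isSymbolJet ht).sobOp s₁ s₂ else 0

theorem sobFamily_of_mem (hB : IsZeroOrderSymbol a b B) (s₁ s₂ : ℝ) {t : ℝ} (ht : t ∈ Icc a b) :
    hB.sobFamily s₁ s₂ t = (hB.isSymbolJet ht).sobOp s₁ s₂ :=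
  dif_pos ht

/-- The derivatives of the difference of the symbols at times `t` and `s` are `O(|t - s|)`, and the
operator norm is linear in their bound, so the family is Lipschitz in operator norm. -/
theorem continuousOn_sobFamily (hB : IsZeroOrderSymbol a b B) (s₁ s₂ : ℝ) :
    ContinuousOn (hB.sobFamily s₁ s₂) (Icc a b) := by
  obtain ⟨C, hC0, hC⟩ := exists_norm_sobOp_le s₁ s₂
  obtain ⟨D, hD0, hD⟩ := hB.exists_norm_symbolJet_sub_le (⌊|s₁|⌋₊ + 2) (⌊|s₂|⌋₊ + 2)
  refine LipschitzOnWith.continuousOn (K := (C * D).toNNReal) ?_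
  refine LipschitzOnWith.of_dist_le_mul fun t ht s hs => ?_
  rw [dist_eq_norm, hB.sobFamily_of_mem _ _ ht, hB.sobFamily_of_mem _ _ hs,
    ← IsSymbolJet.sobOp_sub, Real.coe_toNNReal _ (by positivity), Real.dist_eq, mul_assoc]
  exact hC _ _ _ fun α hα β hβ x ξ => hD α hα β hβ t ht s hs x ξ

theorem isPseudoDiff (hB : IsZeroOrderSymbol a b B) (s₁ s₂ : ℝ) {t : ℝ} (ht : t ∈ Icc a b)
    (g : L2) : IsPseudoDiff (B t) (sobEmb s₁ s₂ g) (sobEmb s₁ s₂ (hB.sobFamily s₁ s₂ t g)) := by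
  intro φ
  refine ⟨(hB.isSymbolJet ht).op φ, fun ξ => ?_, ?_⟩
  · rw [IsSymbolJet.op_apply]
    congr 1
    ext x
    simp [symbolJet, symbolDeriv, osc]
  · rw [hB.sobFamily_of_mem _ _ ht, IsSymbolJet.sobEmb_sobOp]

end IsZeroOrderSymbol

/-- Small symbols give small operators, uniformly in time. -/
theorem exists_norm_sobFamily_le (s₁ s₂ : ℝ) :
    ∃ C : ℝ, 0 ≤ C ∧ ∀ (a b : ℝ) (B : ℝ → ℝ → ℝ → ℂ) (hB : IsZeroOrderSymbol a b B) (ε : ℝ),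
      0 ≤ ε → (∀ α ≤ ⌊|s₁|⌋₊ + 2, ∀ β ≤ ⌊|s₂|⌋₊ + 2,
        symbolSeminorm a b 0 α β B ≤ ENNReal.ofReal ε) →
      ∀ t ∈ Icc a b, ‖hB.sobFamily s₁ s₂ t‖ ≤ C * ε := by
  obtain ⟨C, hC0, hC⟩ := exists_norm_sobOp_le s₁ s₂
  -- The power of `2π` comes from evaluating the symbol at `2πξ` with at most `⌊|s₂|⌋₊ + 2`
  -- derivatives in `ξ`.
  refine ⟨C * (2 * Real.pi) ^ (⌊|s₂|⌋₊ + 2), by positivity, fun a b B hB ε hε h t ht => ?_⟩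
  rw [hB.sobFamily_of_mem _ _ ht, mul_assoc]
  refine hC _ _ _ fun α hα β hβ x ξ => ?_
  rw [norm_symbolJet]
  refine mul_le_mul ?_ (norm_symbolDeriv_le hε (h α hα β hβ) ht _ _) (norm_nonneg _) (by positivity)
  exact pow_le_pow_right₀ (by linarith [Real.pi_gt_three]) hβ

end Strip

namespace Strip

open SchwartzMap BoundedContinuousFunction

/-! ### Perturbations of order zero -/

namespace IsStrip

variable {p q : Polynomial ℝ} {a b θ s ν C δ : ℝ}

/-- A solution of `H = G - T L⁻¹ H` with small `T` is controlled by `G`. -/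
theorem norm_sobStripInv_le_of_norm_le {H : ℝ → L2} {M K : ℝ} (hC : 0 < C) (hδ : 0 ≤ δ)
    (hδC : δ * C ≤ 1 / 2) (hM : 0 ≤ M) (hK : 0 ≤ K)
    (hS : ∀ (G : ℝ → L2) (M : ℝ), 0 ≤ M → (∀ τ ∈ Ioo a b, ‖G τ‖ ≤ M * (endWeight a b ν τ)⁻¹) →
      ∀ t ∈ Ioo a b, ‖sobStripInv p q θ s G t‖ ≤ M * C * (endWeight a b ν t)⁻¹)
    (hH : ∀ τ ∈ Ioo a b, ‖H τ‖ ≤ M * (endWeight a b ν τ)⁻¹ + δ * ‖sobStripInv p q θ s H τ‖)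
    (hb : ∀ τ ∈ Ioo a b, ‖sobStripInv p q θ s H τ‖ ≤ K * (endWeight a b ν τ)⁻¹) :
    ∀ t ∈ Ioo a b, ‖sobStripInv p q θ s H t‖ ≤ 2 * M * C * (endWeight a b ν t)⁻¹ := by
  -- Each pass through the equation and the kernel estimate halves the part of the bound that stems
  -- from the a priori constant `K`; in the limit only `M` remains.
  have key : ∀ n : ℕ, ∀ t ∈ Ioo a b, ‖sobStripInv p q θ s H t‖ ≤
      (2 * M * C + K * (1 / 2) ^ n) * (endWeight a b ν t)⁻¹ := by
    intro n
    induction n with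
    | zero =>
      intro t ht
      refine (hb t ht).trans (mul_le_mul_of_nonneg_right ?_
        (inv_nonneg.2 (endWeight_pos ν ht).le))
      rw [pow_zero, mul_one]
      exact le_add_of_nonneg_left (by positivity)
    | succ n ih =>
      intro t ht
      have h1 := hS H (M + δ * (2 * M * C + K * (1 / 2) ^ n)) (by positivity) (fun τ hτ => by
        refine (hH τ hτ).trans ?_
        rw [add_mul, mul_assoc δ]
        exact add_le_add le_rfl (mul_le_mul_of_nonneg_left (ih τ hτ) hδ)) t ht
      refine h1.trans (mul_le_mul_of_nonneg_right ?_ (inv_nonneg.2 (endWeight_pos ν ht).le))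
      have h2 : δ * C * (2 * M * C + K * (1 / 2) ^ n) ≤ 1 / 2 * (2 * M * C + K * (1 / 2) ^ n) :=
        mul_le_mul_of_nonneg_right hδC (by positivity)
      calc (M + δ * (2 * M * C + K * (1 / 2) ^ n)) * C
          = M * C + δ * C * (2 * M * C + K * (1 / 2) ^ n) := by ring
        _ ≤ M * C + 1 / 2 * (2 * M * C + K * (1 / 2) ^ n) := by linarith
        _ = _ := by ring
  intro t ht
  have h1 : Tendsto (fun n : ℕ => (2 * M * C + K * (1 / 2 : ℝ) ^ n) * (endWeight a b ν t)⁻¹) atTop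
      (𝓝 ((2 * M * C + K * 0) * (endWeight a b ν t)⁻¹)) :=
    (((tendsto_pow_atTop_nhds_zero_of_lt_one (by norm_num) (by norm_num)).const_mul K).const_add
      _).mul_const _
  rw [mul_zero, add_zero] at h1
  exact ge_of_tendsto' h1 fun n => key n t ht

/-- The equation `H = G - T L⁻¹ H` is solvable when `T` is small. -/
theorem exists_eq_sub_sobStripInv (h : IsStrip p a b θ) {G : ℝ → L2} {T : ℝ → L2 →L[ℂ] L2}
    {M : ℝ} (hC : 0 < C) (hδ : 0 ≤ δ) (hδC : δ * C ≤ 1 / 2) (hM : 0 ≤ M)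
    (hS : ∀ (G : ℝ → L2) (M : ℝ), 0 ≤ M → (∀ τ ∈ Ioo a b, ‖G τ‖ ≤ M * (endWeight a b ν τ)⁻¹) →
      ∀ t ∈ Ioo a b, ‖sobStripInv p q θ s G t‖ ≤ M * C * (endWeight a b ν t)⁻¹)
    (hT : ContinuousOn T (Ioo a b)) (hTδ : ∀ t ∈ Ioo a b, ‖T t‖ ≤ δ)
    (hG : ContinuousOn G (Ioo a b)) (hGM : ∀ t ∈ Ioo a b, ‖G t‖ ≤ M * (endWeight a b ν t)⁻¹) :
    ∃ H : ℝ → L2, ContinuousOn H (Ioo a b) ∧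
      (∀ t ∈ Ioo a b, H t = G t - T t (sobStripInv p q θ s H t)) ∧
      ∀ t ∈ Ioo a b, ‖sobStripInv p q θ s H t‖ ≤ 2 * M * C * (endWeight a b ν t)⁻¹ := by
  classical
  set w := endWeight a b ν with hw
  have hwpos : ∀ t ∈ Ioo a b, 0 < w t := fun t ht => endWeight_pos ν ht
  have hwc : ContinuousOn w (Ioo a b) := continuousOn_endWeight a b ν
  -- The unknown is the bounded continuous function `V = w L⁻¹H`, and `ex V` recovers `L⁻¹H` from
  -- it. The value `0` off the strip is a convention.
  let ex : (Ioo a b →ᵇ L2) → ℝ → L2 := fun V t =>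
    if ht : t ∈ Ioo a b then ((w t : ℂ))⁻¹ • V ⟨t, ht⟩ else 0
  have ex_mem : ∀ V t (ht : t ∈ Ioo a b), ex V t = ((w t : ℂ))⁻¹ • V ⟨t, ht⟩ :=
    fun V t ht => dif_pos ht
  have nw : ∀ t ∈ Ioo a b, ‖((w t : ℂ))⁻¹‖ = (w t)⁻¹ := fun t ht => by
    rw [norm_inv, Complex.norm_real, Real.norm_of_nonneg (hwpos t ht).le]
  have ex_cont : ∀ V, ContinuousOn (ex V) (Ioo a b) := fun V => by
    rw [continuousOn_iff_continuous_domRestrict] at hwc ⊢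
    have h1 : Continuous fun t : Ioo a b => ((w t : ℂ))⁻¹ :=
      (Complex.continuous_ofReal.comp hwc).inv₀ fun t => by
        simpa using (hwpos t t.2).ne'
    have h2 := h1.smul V.continuous
    refine h2.congr fun t => ?_
    exact (ex_mem V t t.2).symm
  have ex_dist : ∀ V V' t, t ∈ Ioo a b → ‖ex V t - ex V' t‖ ≤ dist V V' * (w t)⁻¹ := by
    intro V V' t ht
    rw [ex_mem V t ht, ex_mem V' t ht, ← smul_sub, norm_smul, nw t ht, mul_comm, ← dist_eq_norm]
    exact mul_le_mul_of_nonneg_right (dist_coe_le_dist _) (inv_nonneg.2 (hwpos t ht).le)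
  let Hf : (Ioo a b →ᵇ L2) → ℝ → L2 := fun V t => G t - T t (ex V t)
  have Hf_cont : ∀ V, ContinuousOn (Hf V) (Ioo a b) := fun V =>
    hG.sub (hT.clm_apply (ex_cont V))
  have ex_norm : ∀ V t, t ∈ Ioo a b → ‖ex V t‖ ≤ ‖V‖ * (w t)⁻¹ := by
    intro V t ht
    rw [ex_mem V t ht, norm_smul, nw t ht, mul_comm]
    exact mul_le_mul_of_nonneg_right (norm_coe_le_norm _ _) (inv_nonneg.2 (hwpos t ht).le)
  have T_le : ∀ t ∈ Ioo a b, ∀ g : L2, ‖T t g‖ ≤ δ * ‖g‖ := fun t ht g =>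
    ((T t).le_opNorm g).trans (mul_le_mul_of_nonneg_right (hTδ t ht) (norm_nonneg _))
  have Hf_norm : ∀ V t, t ∈ Ioo a b → ‖Hf V t‖ ≤ (M + δ * ‖V‖) * (w t)⁻¹ := by
    intro V t ht
    refine (norm_sub_le _ _).trans ?_
    rw [add_mul, mul_assoc δ]
    exact add_le_add (hGM t ht) ((T_le t ht _).trans (mul_le_mul_of_nonneg_left (ex_norm V t ht) hδ))
  have SH_norm : ∀ V t, t ∈ Ioo a b →
      ‖sobStripInv p q θ s (Hf V) t‖ ≤ (M + δ * ‖V‖) * C * (w t)⁻¹ := fun V =>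
    hS (Hf V) (M + δ * ‖V‖) (by positivity) (Hf_norm V)
  have W_norm : ∀ (t : Ioo a b) (g : L2) (A : ℝ), ‖g‖ ≤ A * (w t)⁻¹ → ‖((w t : ℂ)) • g‖ ≤ A := by
    intro t g A hg
    rw [norm_smul, Complex.norm_real, Real.norm_of_nonneg (hwpos t t.2).le, mul_comm]
    rwa [← div_eq_mul_inv, le_div_iff₀ (hwpos t t.2)] at hg
  let Φ : (Ioo a b →ᵇ L2) → (Ioo a b →ᵇ L2) := fun V =>
    BoundedContinuousFunction.ofNormedAddCommGroup
      (fun t : Ioo a b => ((w t : ℂ)) • sobStripInv p q θ s (Hf V) t)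
      (by
        have h1 := continuousOn_iff_continuous_domRestrict.1 (h.continuousOn_sobStripInv q s (Hf_cont V))
        have h2 := continuousOn_iff_continuous_domRestrict.1 hwc
        have h3 : Continuous fun t : Ioo a b => (w t : ℂ) := Complex.continuous_ofReal.comp h2
        have h4 := h3.smul h1
        exact h4)
      ((M + δ * ‖V‖) * C) fun t => W_norm t _ _ (SH_norm V t t.2)
  have hΦ : ContractingWith (1 / 2 : ℝ≥0) Φ := by
    refine ⟨by
      rw [← NNReal.coe_lt_coe]
      norm_num, LipschitzWith.of_dist_le_mul fun V V' => ?_⟩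
    refine (BoundedContinuousFunction.dist_le (by positivity)).2 fun t => ?_
    rw [dist_eq_norm]
    change ‖((w t : ℂ)) • sobStripInv p q θ s (Hf V) t -
      ((w t : ℂ)) • sobStripInv p q θ s (Hf V') t‖ ≤ _
    rw [← smul_sub]
    refine W_norm t _ _ ?_
    have e : sobStripInv p q θ s (Hf V) t - sobStripInv p q θ s (Hf V') t =
        sobStripInv p q θ s ((-1 : ℂ) • Hf V' + Hf V) t := by
      rw [h.sobStripInv_smul_add q s (Hf_cont V') (Hf_cont V) _ t.2, neg_one_smul]
      abel
    rw [e]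
    refine (hS _ (δ * dist V V') (by positivity) (fun τ hτ => ?_) t t.2).trans ?_
    · have e2 : ((-1 : ℂ) • Hf V' + Hf V) τ = -(T τ (ex V τ - ex V' τ)) := by
        change (-1 : ℂ) • (G τ - T τ (ex V' τ)) + (G τ - T τ (ex V τ)) = _
        rw [neg_one_smul, map_sub]
        abel
      rw [e2, norm_neg, mul_assoc]
      exact (T_le τ hτ _).trans (mul_le_mul_of_nonneg_left (ex_dist V V' τ hτ) hδ)
    · refine mul_le_mul_of_nonneg_right ?_ (inv_nonneg.2 (hwpos t t.2).le)
      calc δ * dist V V' * C = δ * C * dist V V' := by ring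
        _ ≤ 1 / 2 * dist V V' := mul_le_mul_of_nonneg_right hδC dist_nonneg
        _ = _ := by simp
  let V := hΦ.fixedPoint
  have hV : Φ V = V := hΦ.fixedPoint_isFixedPt
  have hS_eq : ∀ t ∈ Ioo a b, ex V t = sobStripInv p q θ s (Hf V) t := fun t ht => by
    have h1 : V ⟨t, ht⟩ = ((w t : ℂ)) • sobStripInv p q θ s (Hf V) t := by
      conv_lhs => rw [← hV]
      rfl
    rw [ex_mem V t ht, h1, smul_smul, inv_mul_cancel₀ (by simpa using (hwpos t ht).ne'), one_smul]
  have hH : ∀ t ∈ Ioo a b, Hf V t = G t - T t (sobStripInv p q θ s (Hf V) t) := fun t ht => by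
    rw [← hS_eq t ht]
  refine ⟨Hf V, Hf_cont V, hH, ?_⟩
  refine norm_sobStripInv_le_of_norm_le hC hδ hδC hM (by positivity : 0 ≤ (M + δ * ‖V‖) * C) hS
    (fun τ hτ => ?_) (SH_norm V)
  rw [hH τ hτ]
  exact (norm_sub_le _ _).trans (add_le_add (hGM τ hτ) (T_le τ hτ _))

/-- Perturbations of `L` by small symbols of order zero have a right inverse. -/
theorem perturbation (h : IsStrip p a b θ) (q : Polynomial ℝ) (s₁ s₂ : ℝ) :
    ∃ ε₀ : ℝ, 0 < ε₀ ∧ ∀ B : ℝ → ℝ → ℝ → ℂ, IsZeroOrderSymbol a b B →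
      (∀ α ≤ ⌊|s₁|⌋₊ + 2, ∀ β ≤ ⌊|s₂|⌋₊ + 2,
        symbolSeminorm a b 0 α β B < ENNReal.ofReal ε₀) →
      ∃ R, IsPerturbedRightInverse p q a b B s₁ s₂ R := by
  obtain ⟨C, hC, hS⟩ := h.exists_norm_sobStripInv_le q s₂ (ν := 1 / 2) (by norm_num)
  obtain ⟨A, hA, hAB⟩ := exists_norm_sobFamily_le s₁ s₂
  have hab : 0 < b - a := by linarith [h.mem.1, h.mem.2]
  set w := endWeight a b (1 / 2) with hw
  set κ := (b - a) ^ (1 / 2 : ℝ) * (b - a) ^ (1 / 2 : ℝ) with hκ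
  have hκ0 : 0 ≤ κ := by positivity
  -- The choice makes operator norm times kernel constant at most `1/2`; `A + 1` replaces `A`
  -- because `A` may be `0`.
  refine ⟨1 / (2 * (A + 1) * C), by positivity, fun B hB hsmall => ?_⟩
  set ε := 1 / (2 * (A + 1) * C) with hε
  have hε0 : 0 ≤ ε := by positivity
  have hδC : A * ε * C ≤ 1 / 2 := by
    rw [hε]
    have : A * (1 / (2 * (A + 1) * C)) * C = A / (A + 1) * (1 / 2) := by
      field_simp
    rw [this]
    have : A / (A + 1) ≤ 1 := (div_le_one (by positivity)).2 (by linarith)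
    linarith
  set T := hB.sobFamily s₁ s₂ with hTdef
  have hT : ContinuousOn T (Ioo a b) := (hB.continuousOn_sobFamily s₁ s₂).mono Ioo_subset_Icc_self
  have hTδ : ∀ t ∈ Ioo a b, ‖T t‖ ≤ A * ε := fun t ht =>
    hAB a b B hB ε hε0 (fun α hα β hβ => (hsmall α hα β hβ).le) t (Ioo_subset_Icc_self ht)
  have hδ : 0 ≤ A * ε := by positivity
  -- The auxiliary functions are chosen separately for each `f`, with zero for inadmissible `f`, so
  -- linearity must be recovered from uniqueness.
  have ex : ∀ f, ∃ G H : ℝ → L2, ∃ M : ℝ, ContinuousIntoSob s₁ s₂ (Icc a b) f →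
      (∀ t ∈ Icc a b, f t = sobEmb s₁ s₂ (G t)) ∧ ContinuousOn H (Ioo a b) ∧
      (∀ t ∈ Ioo a b, H t = G t - T t (sobStripInv p q θ s₂ H t)) ∧
      0 ≤ M ∧ ENNReal.ofReal M = sobSupNorm s₁ s₂ a b f ∧
      ∀ t ∈ Ioo a b, ‖sobStripInv p q θ s₂ H t‖ ≤ 2 * (M * κ) * C * (w t)⁻¹ := by
    intro f
    by_cases hf : ContinuousIntoSob s₁ s₂ (Icc a b) f
    · obtain ⟨G, hG, hfG⟩ := hf.exists_continuousOn
      obtain ⟨M, hM, hMe, hGM⟩ := exists_norm_le_sobSupNorm hG hfG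
      obtain ⟨H, hH, hHeq, hb⟩ := h.exists_eq_sub_sobStripInv hC hδ hδC (by positivity : 0 ≤ M * κ)
        hS hT hTδ (hG.mono Ioo_subset_Icc_self)
        (norm_le_mul_inv_endWeight (by norm_num) hM hGM)
      exact ⟨G, H, M, fun _ => ⟨hfG, hH, hHeq, hM, hMe, hb⟩⟩
    · exact ⟨0, 0, 0, fun hf' => absurd hf' hf⟩
  choose G H M hGHM using ex
  have hL1 : ∀ f, ContinuousIntoSob s₁ s₂ (Icc a b) f →
      sobL1Norm s₁ s₂ a b (fun t => sobEmb s₁ s₂ (sobStripInv p q θ s₂ (H f) t)) ≤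
        (ENNReal.ofReal (2 * κ * C) * ∫⁻ t in Ioo a b, ENNReal.ofReal (w t)⁻¹) *
          sobSupNorm s₁ s₂ a b f := by
    intro f hf
    obtain ⟨-, -, -, hM, hMe, hb⟩ := hGHM f hf
    simp only [sobL1Norm, sobNorm_sobEmb]
    refine (lintegral_enorm_le (by positivity) hb).trans (le_of_eq ?_)
    rw [← hMe, mul_right_comm (ENNReal.ofReal _), ← ENNReal.ofReal_mul (by positivity),
      show 2 * (M f * κ) * C = 2 * κ * C * M f by ring]
  have hI : ENNReal.ofReal (2 * κ * C) * ∫⁻ t in Ioo a b, ENNReal.ofReal (w t)⁻¹ < ⊤ :=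
    ENNReal.mul_lt_top ENNReal.ofReal_lt_top
      (lintegral_inv_endWeight_lt_top (by norm_num) (by norm_num))
  refine ⟨fun f t => sobEmb s₁ s₂ (sobStripInv p q θ s₂ (H f) t), ?_, ?_, ?_, ?_, ?_, ?_⟩
  · intro f g hf hg c t ht
    have hfg : ContinuousIntoSob s₁ s₂ (Icc a b) (c • f + g) := by
      obtain ⟨Gf, hGf, hf'⟩ := hf.exists_continuousOn
      obtain ⟨Gg, hGg, hg'⟩ := hg.exists_continuousOn
      have h1 : ContinuousOn (fun t => c • Gf t + Gg t) (Icc a b) := (hGf.const_smul c).add hGg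
      refine (continuousIntoSob_sobEmb h1).congr fun t ht => ?_
      rw [sobEmb_add, sobEmb_smul, ← hf' t ht, ← hg' t ht]
      rfl
    obtain ⟨ef, cf, Hf, Mf, -, bf⟩ := hGHM f hf
    obtain ⟨eg, cg, Hg, Mg, -, bg⟩ := hGHM g hg
    obtain ⟨efg, cfg, Hfg, Mfg, -, bfg⟩ := hGHM (c • f + g) hfg
    have hGe : ∀ t ∈ Ioo a b, G (c • f + g) t = c • G f t + G g t := fun t ht => by
      have ht' := Ioo_subset_Icc_self ht
      refine sobEmb_injective s₁ s₂ ?_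
      rw [← efg t ht', sobEmb_add, sobEmb_smul, ← ef t ht', ← eg t ht']
      rfl
    have c2 : ContinuousOn (c • H f + H g) (Ioo a b) := (cf.const_smul c).add cg
    -- `D` measures the failure of `f ↦ H` to be linear. It satisfies the homogeneous equation, and
    -- the bootstrap bound with `M = 0` forces `L⁻¹D = 0`.
    set D := (-1 : ℂ) • (c • H f + H g) + H (c • f + g) with hD
    have hSD : ∀ t ∈ Ioo a b, sobStripInv p q θ s₂ D t =
        sobStripInv p q θ s₂ (H (c • f + g)) t -
          (c • sobStripInv p q θ s₂ (H f) t + sobStripInv p q θ s₂ (H g) t) := fun t ht => by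
      rw [hD, h.sobStripInv_smul_add q s₂ c2 cfg _ ht, h.sobStripInv_smul_add q s₂ cf cg _ ht,
        neg_one_smul]
      abel
    have hDe : ∀ t ∈ Ioo a b, D t = -(T t (sobStripInv p q θ s₂ D t)) := fun t ht => by
      rw [hSD t ht, map_sub, map_add, map_smul]
      change (-1 : ℂ) • (c • H f t + H g t) + H (c • f + g) t = _
      rw [Hf t ht, Hg t ht, Hfg t ht, hGe t ht, neg_one_smul, smul_sub]
      abel
    have hz := norm_sobStripInv_le_of_norm_le (H := D) (M := 0)
      (K := 2 * (M (c • f + g) * κ) * C + (‖c‖ * (2 * (M f * κ) * C) + 2 * (M g * κ) * C))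
      hC hδ hδC le_rfl (by positivity) hS (fun τ hτ => by
        rw [zero_mul, zero_add]
        conv_lhs => rw [hDe τ hτ]
        rw [norm_neg]
        exact ((T τ).le_opNorm _).trans (mul_le_mul_of_nonneg_right (hTδ τ hτ) (norm_nonneg _)))
      (fun τ hτ => by
        rw [hSD τ hτ, add_mul, add_mul, mul_assoc ‖c‖]
        refine (norm_sub_le _ _).trans (add_le_add (bfg τ hτ) ((norm_add_le _ _).trans
          (add_le_add ?_ (bg τ hτ))))
        rw [norm_smul]
        exact mul_le_mul_of_nonneg_left (bf τ hτ) (norm_nonneg _)) t ht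
    have hz0 : sobStripInv p q θ s₂ D t = 0 := by
      rw [← norm_le_zero_iff]
      simpa using hz
    rw [hSD t ht, sub_eq_zero] at hz0
    rw [hz0, sobEmb_add, sobEmb_smul]
  · intro f hf
    obtain ⟨ef, cf, Hf, -, -, -⟩ := hGHM f hf
    refine ⟨fun t => sobEmb s₁ s₂ (T t (sobStripInv p q θ s₂ (H f) t)),
      fun t ht => hB.isPseudoDiff s₁ s₂ (Ioo_subset_Icc_self ht) _,
      (h.solvesField_sobStripInv q s₁ s₂ cf).congr fun t ht => ?_⟩
    rw [Hf t ht, sobEmb_sub, ← ef t (Ioo_subset_Icc_self ht)]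
    rfl
  · intro f hf
    exact continuousIntoSob_sobEmb (h.continuousOn_sobStripInv q s₂ (hGHM f hf).2.1)
  · intro f hf
    refine (hL1 f hf).trans_lt (ENNReal.mul_lt_top hI ?_)
    rw [← (hGHM f hf).2.2.2.2.1]
    exact ENNReal.ofReal_lt_top
  · refine ⟨(ENNReal.ofReal (2 * κ * C) * ∫⁻ t in Ioo a b, ENNReal.ofReal (w t)⁻¹).toNNReal,
      fun f hf => ?_⟩
    rw [ENNReal.coe_toNNReal hI.ne]
    exact hL1 f hf
  · intro K hK hKs
    have h1 : ContinuousOn (fun t => (w t)⁻¹) K :=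
      ((continuousOn_endWeight a b (1 / 2)).mono hKs).inv₀ fun t ht =>
        (endWeight_pos _ (hKs ht)).ne'
    obtain ⟨E, hE⟩ := hK.exists_bound_of_continuousOn h1
    refine ⟨(2 * κ * C * E).toNNReal, fun f hf t ht => ?_⟩
    obtain ⟨-, -, -, hM, hMe, hb⟩ := hGHM f hf
    have hE0 : 0 ≤ E := (norm_nonneg _).trans (hE t ht)
    rw [sobNorm_sobEmb, ← hMe, ← ofReal_norm, ← ENNReal.ofReal,
      ← ENNReal.ofReal_mul (by positivity)]
    refine ENNReal.ofReal_le_ofReal ((hb t (hKs ht)).trans ?_)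
    have h2 := (le_abs_self _).trans (hE t ht)
    calc 2 * (M f * κ) * C * (w t)⁻¹ ≤ 2 * (M f * κ) * C * E :=
          mul_le_mul_of_nonneg_left h2 (by positivity)
      _ = _ := by ring

end IsStrip

end Strip
-- Assembly of the four parts
namespace Strip

theorem IsAdmissible.isStrip {p q : Polynomial ℝ} {N : ℕ} {t : Fin N → ℝ}
    (hL : IsAdmissible p q N t) {j : ℕ} (hj : j + 1 < N) {θ : ℝ}
    (hθ : θ ∈ Ioo (t ⟨j, Nat.lt_of_succ_lt hj⟩) (t ⟨j + 1, hj⟩)) :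
    IsStrip p (t ⟨j, Nat.lt_of_succ_lt hj⟩) (t ⟨j + 1, hj⟩) θ where
  mem := hθ
  zero_left := (hL.zero_iff _).2 ⟨_, rfl⟩
  zero_right := (hL.zero_iff _).2 ⟨_, rfl⟩
  simple_left := hL.simple _
  simple_right := hL.simple _
  ne_zero := fun s hs h0 => by
    obtain ⟨i, rfl⟩ := (hL.zero_iff s).1 h0
    have h1 := hL.strictMono.lt_iff_lt.1 hs.1
    have h2 := hL.strictMono.lt_iff_lt.1 hs.2
    rw [Fin.lt_def] at h1 h2
    simp only at h1 h2
    omega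

end Strip

theorem proposition3p1 (p q : Polynomial ℝ) (N : ℕ) (t : Fin N → ℝ)
    (hL : IsAdmissible p q N t) (j : ℕ) (hj : j + 1 < N) (a b θ : ℝ)
    (ha : a = t ⟨j, Nat.lt_of_succ_lt hj⟩) (hb : b = t ⟨j + 1, hj⟩)
    (hsep : IsSeparatrix p q a b) (hθ : θ ∈ Ioo a b) (hqθ : q.eval θ = 0) :
    -- i) exponential growth (`r = ε`) and exponential decay (`r = -ε`)
    (∀ ε : ℝ, 0 < ε → ε < min |logCoeff p q a|⁻¹ |logCoeff p q b|⁻¹ →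
      ∀ r : ℝ, (r = ε ∨ r = -ε) → ∀ f : ℝ → ℝ → ℂ, SmoothExpClosed a b r f →
        IntegrableExp a b r (stripInv p q θ f) ∧
        SmoothExpOpen a b r (stripInv p q θ f) ∧
        ∀ s ∈ Ioo a b, ∀ x : ℝ,
          ((p.eval s : ℝ) : ℂ) * pderiv 1 0 (stripInv p q θ f) s x +
            ((q.eval s : ℝ) : ℂ) * pderiv 0 1 (stripInv p q θ f) s x = f s x) ∧
    -- ii) weighted Sobolev spaces
    (∀ s₁ s₂ : ℝ,
      (∀ f, ContinuousIntoSob s₁ s₂ (Icc a b) f →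
        ∃ u, IsStripInv p q a b θ f u ∧
          sobL1Norm s₁ s₂ a b u < ⊤ ∧
          ContinuousIntoSob s₁ s₂ (Ioo a b) u ∧
          SolvesField p q a b u f) ∧
      ∀ ε : ℝ, 0 < ε → ∃ C : ℝ≥0, ∀ f u, ContinuousIntoSob s₁ s₂ (Icc a b) f →
        IsStripInv p q a b θ f u → ∀ s ∈ Ioo a b,
          ENNReal.ofReal (|s - a| ^ ε * |s - b| ^ ε) * sobNorm s₁ s₂ (u s) ≤
            C * sobSupNorm s₁ s₂ a b f) ∧
    -- iii) right-hand sides that are polynomial in `x`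
    (∀ k : ℕ, ∃ γa γb : ℕ → ℝ, (∀ l ≤ k, γa l ≠ 0 ∧ γb l ≠ 0) ∧
      ∀ F : ℕ → ℝ → ℂ, (∀ l ≤ k, ContinuousOn (F l) (Icc a b)) →
        ∃ g : ℕ → ℝ → ℂ,
          (∀ s ∈ Ioo a b, ∀ x : ℝ,
            stripInv p q θ (fun τ y => ∑ l ∈ Finset.range (k + 1), F l τ * (y : ℂ) ^ l) s x =
              ∑ l ∈ Finset.range (k + 1), g l s * (x : ℂ) ^ l) ∧
          ∀ l ≤ k,
            HasLogAsymptotics (𝓝[>] a) a (k + 1 - l) (F k a * γa l) (g l) ∧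
            HasLogAsymptotics (𝓝[<] b) b (k + 1 - l) (F k b * γb l) (g l)) ∧
    -- iv) small perturbations of order zero
    (∀ s₁ s₂ : ℝ, ∃ ε₀ : ℝ, 0 < ε₀ ∧
      ∀ B : ℝ → ℝ → ℝ → ℂ, IsZeroOrderSymbol a b B →
        (∀ α ≤ ⌊|s₁|⌋₊ + 2, ∀ β ≤ ⌊|s₂|⌋₊ + 2,
          symbolSeminorm a b 0 α β B < ENNReal.ofReal ε₀) →
        ∃ R, IsPerturbedRightInverse p q a b B s₁ s₂ R) := by
  have h : IsStrip p a b θ := by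
    subst ha hb
    exact hL.isStrip hj hθ
  have hqa : q.eval a ≠ 0 := fun h0 => hL.nonsingular a ⟨h.zero_left, h0⟩
  have hqb : q.eval b ≠ 0 := fun h0 => hL.nonsingular b ⟨h.zero_right, h0⟩
  exact ⟨fun ε hε hεc r hr f hf => h.exponential q hε hεc hr hf, h.sobolev q,
    h.polynomial hqa hqb, h.perturbation q⟩
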